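/- Let $\Omega\subset\mathbb{R}^2$ be a simply connected Lipschitz domain and let $\mathcal{G}_h$ be a finite conforming (edge-to-edge) subdivision of $\overline\Omega$ into closed convex quadrilaterals; let $h$ be the largest cell diameter. For a cell $Q$ with vertices $a_1,\dots,a_4$ in anticlockwise order, let $e_i=[a_i,a_{i+1}]$ (indices mod 4) be its edges, $m_i$ the midpoint of $e_i$, $O$ the common midpoint of $m_1m_3$ and $m_2m_4$, $\mathbf r=\overrightarrow{Om_3}$, $\mathbf s=\overrightarrow{Om_4}$, and let $\xi,\eta$ be the coordinate functions with $\xi(O+a\mathbf r+b\mathbf s)=a$, $\eta(O+a\mathbf r+b\mathbf s)=b$. Put $\mathcal R_Q=\max\{\frac{|\mathbf r||\mathbf s|}{\mathbf r\times\mathbf s},\frac{|\mathbf r|}{|\mathbf s|},\frac{|\mathbf s|}{|\mathbf r|}\}$. For $v\in H^1(Q)$ let $I_Qv$ be the unique element of $P_1(Q)+\mathrm{span}\{\xi^2-\eta^2\}$ whose averages over the four edges of $Q$ are those of (the trace of) $v$, and for $v\in H^1(\Omega)$ let $I_hv\in L^2(\Omega)$ be given by $(I_hv)|_Q=I_Q(v|_Q)$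 for all $Q\in\mathcal{G}_h$. Write $|w|_{1,h}^2=\sum_{Q\in\mathcal G_h}|w|_{1,Q}^2$. Let $V^{\rm PS}_{h0}$ (the Park–Sheen space) be the set of all $w\in L^2(\Omega)$ such that $w|_Q\in P_1(Q)$ for every $Q\in\mathcal G_h$, the average of $w$ over each interior edge is the same from both sides, and the average of $w$ over each boundary edge is zero; let $\mathring V^{\rm PS}_{h0}$ be the set of $w\in (V^{\rm PS}_{h0})^2$ with $\mathrm{div}\,(w|_Q)=0$ for every $Q\in\mathcal G_h$. Let $\mathcal T_h$ be the criss-cross refinement of $\mathcal G_h$, in which each cell is divided into four triangles by its two diagonals; let $V^{\rm le}_{h0}$ be the set of functions in $H^1_0(\Omega)$ that are continuous on $\overline\Omega$ and linear on every triangle of $\mathcal T_h$, and let $\mathring V^{\rm le}_{h0}$ be the set of $w\in(V^{\rm le}_{h0})^2$ with $\mathrm{div}\,w=0$. (1) For every $\rho$ there is a constant $C$, depending on $\rho$ only, such that, whenever $\mathcal R_Q\le\rho$ for all $Q\in\mathcal G_h$, $$|I_hv-v|_{1,h}\le C\,h\,|v|_{2,\Omega}\qquad\text{for all } v\in H^1_0(\Omega)\cap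 H^2(\Omega).$$ (2) $I_h V^{\rm le}_{h0}=V^{\rm PS}_{h0}$, and, with $I_h$ acting componentwise, $I_h\mathring V^{\rm le}_{h0}=\mathring V^{\rm PS}_{h0}$. -/

import Mathlib

namespace QGB

open MeasureTheory Filter Topology
open scoped ContDiff

noncomputable section

/-- The Euclidean plane. -/
abbrev Plane : Type := EuclideanSpace ℝ (Fin 2)

/-- The scalar cross product `u × v` of plane vectors. -/
def cross (u v : Plane) : ℝ := u 0 * v 1 - u 1 * v 0

/-! ### Sobolev spaces

Functions are ordinary functions on the plane; only their restriction to the open set `U` at hand,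
up to null sets, matters. -/

/-- `φ ∈ C_c^∞(U)`. -/
def IsTestFunction (U : Set Plane) (φ : Plane → ℝ) : Prop :=
  ContDiff ℝ ∞ φ ∧ HasCompactSupport φ ∧ tsupport φ ⊆ U

/-- The classical `k`-th partial derivative. -/
def pderiv (k : Fin 2) (φ : Plane → ℝ) (x : Plane) : ℝ :=
  fderiv ℝ φ x (EuclideanSpace.single k (1 : ℝ))

/-- `g ∈ L²(U)` is the weak `k`-th partial derivative of `v` on `U`. -/
def IsWeakDeriv (U : Set Plane) (k : Fin 2) (v g : Plane → ℝ) : Prop :=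
  MemLp g 2 (volume.restrict U) ∧
    ∀ φ : Plane → ℝ, IsTestFunction U φ →
      ∫ x in U, v x * pderiv k φ x = -∫ x in U, g x * φ x

/-- `v ∈ H¹(U)`. -/
def MemH1 (U : Set Plane) (v : Plane → ℝ) : Prop :=
  MemLp v 2 (volume.restrict U) ∧ ∀ k, ∃ g, IsWeakDeriv U k v g

open Classical in
/-- The weak derivative `∂ₖ v` on `U` (unique up to null sets for `v ∈ H¹(U)`). -/
def wderiv (U : Set Plane) (k : Fin 2) (v : Plane → ℝ) : Plane → ℝ :=
  if h : ∃ g, IsWeakDeriv U k v g then h.choose else 0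

/-- `v ∈ H²(U)`. -/
def MemH2 (U : Set Plane) (v : Plane → ℝ) : Prop :=
  MemH1 U v ∧ ∀ k, MemH1 U (wderiv U k v)

/-- The seminorm `|v|_{1,U}`. -/
def semiH1 (U : Set Plane) (v : Plane → ℝ) : ℝ :=
  Real.sqrt (∑ k, ∫ x in U, wderiv U k v x ^ 2)

/-- The seminorm `|v|_{2,U}`. -/
def semiH2 (U : Set Plane) (v : Plane → ℝ) : ℝ :=
  Real.sqrt (∑ k, ∑ l, ∫ x in U, wderiv U l (wderiv U k v) x ^ 2)

/-- The smooth functions `φ n` converge to `v ∈ H¹(U)` in the norm of `H¹(U)`. -/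
def H1Tendsto (U : Set Plane) (φ : ℕ → Plane → ℝ) (v : Plane → ℝ) : Prop :=
  Tendsto (fun n => ∫ x in U, (φ n x - v x) ^ 2) atTop (𝓝 0) ∧
    ∀ k, Tendsto (fun n => ∫ x in U, (pderiv k (φ n) x - wderiv U k v x) ^ 2) atTop (𝓝 0)

/-- `v ∈ H¹₀(U)`: the closure of `C_c^∞(U)` in `H¹(U)`. -/
def MemH10 (U : Set Plane) (v : Plane → ℝ) : Prop :=
  MemH1 U v ∧ ∃ φ : ℕ → Plane → ℝ, (∀ n, IsTestFunction U (φ n)) ∧ H1Tendsto U φ v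

/-- `div w = 0` on `U`, for a vector field `w` with components in `H¹(U)`. -/
def IsDivFree (U : Set Plane) (w : Fin 2 → Plane → ℝ) : Prop :=
  ∀ᵐ x ∂(volume.restrict U), ∑ k, wderiv U k (w k) x = 0

/-- The average over the segment `[a, b]` of a continuous function. -/
def segMean (a b : Plane) (φ : Plane → ℝ) : ℝ :=
  ∫ t in (0 : ℝ)..1, φ (AffineMap.lineMap a b t)

/-- `t` is the average over `[a, b] ⊆ ∂U` of the trace of `v ∈ H¹(U)`; the trace is the continuous
extension to `H¹(U)` of the restriction of functions that are smooth up to the boundary. -/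
def HasTraceMean (U : Set Plane) (a b : Plane) (v : Plane → ℝ) (t : ℝ) : Prop :=
  MemH1 U v ∧ ∃ φ : ℕ → Plane → ℝ, (∀ n, ContDiff ℝ ∞ (φ n)) ∧ H1Tendsto U φ v ∧
    Tendsto (fun n => segMean a b (φ n)) atTop (𝓝 t)

open Classical in
/-- The average over `[a, b] ⊆ ∂U` of the trace of `v ∈ H¹(U)`. -/
def traceMean (U : Set Plane) (a b : Plane) (v : Plane → ℝ) : ℝ :=
  if h : ∃ t, HasTraceMean U a b v t then h.choose else 0

/-! ### Convex quadrilaterals -/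

/-- A (nondegenerate) convex quadrilateral with its vertices in anticlockwise order: the four turns
at the vertices are all strictly to the left. -/
structure Quad where
  a : Fin 4 → Plane
  convex : ∀ i, 0 < cross (a (i + 1) - a i) (a (i + 2) - a (i + 1))

namespace Quad

variable (Q : Quad)

/-- The closed cell. -/
def carrier : Set Plane := convexHull ℝ (Set.range Q.a)

/-- The open cell. -/
def inner : Set Plane := interior Q.carrier

/-- The edge `eᵢ`, with ends `aᵢ` and `aᵢ₊₁`. -/
def edge (i : Fin 4) : Set Plane := segment ℝ (Q.a i) (Q.a (i + 1))

/-- The midpoint `mᵢ` of the edge `eᵢ`. -/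
def mid (i : Fin 4) : Plane := midpoint ℝ (Q.a i) (Q.a (i + 1))

/-- The common midpoint `O` of the two segments that join the midpoints of opposite edges. -/
def O : Plane := midpoint ℝ (Q.mid 0) (Q.mid 2)

/-- The vector `r` from `O` to the midpoint of the third edge. -/
def r : Plane := Q.mid 2 - Q.O

/-- The vector `s` from `O` to the midpoint of the fourth edge. -/
def s : Plane := Q.mid 3 - Q.O

/-- The coordinate `ξ`, with `ξ (O + a r + b s) = a`. -/
def ξ (x : Plane) : ℝ := cross (x - Q.O) Q.s / cross Q.r Q.s

/-- The coordinate `η`, with `η (O + a r + b s) = b`. -/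
def η (x : Plane) : ℝ := cross Q.r (x - Q.O) / cross Q.r Q.s

/-- The shape regularity indicator of the cell. -/
def regularity : ℝ :=
  max (‖Q.r‖ * ‖Q.s‖ / cross Q.r Q.s) (max (‖Q.r‖ / ‖Q.s‖) (‖Q.s‖ / ‖Q.r‖))

/-- The intersection point of the two diagonals. -/
def diagCross : Plane :=
  AffineMap.lineMap (Q.a 0) (Q.a 2)
    (cross (Q.a 1 - Q.a 0) (Q.a 3 - Q.a 1) / cross (Q.a 2 - Q.a 0) (Q.a 3 - Q.a 1))

/-- The average over the edge `eᵢ` of (the trace of) `v ∈ H¹(Q)`. -/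
def edgeMean (i : Fin 4) (v : Plane → ℝ) : ℝ :=
  traceMean Q.inner (Q.a i) (Q.a (i + 1)) v

/-- The shape function space `P₁ + span {ξ² - η²}`. -/
def IsShapeFn (p : Plane → ℝ) : Prop :=
  ∃ (l : Plane →ᵃ[ℝ] ℝ) (c : ℝ), ∀ x, p x = l x + c * (Q.ξ x ^ 2 - Q.η x ^ 2)

open Classical in
/-- The local interpolant: the shape function with the same edge averages as `v`. -/
def interp (v : Plane → ℝ) : Plane → ℝ :=
  if h : ∃ p, Q.IsShapeFn p ∧ ∀ i, Q.edgeMean i p = Q.edgeMean i v then h.choose else 0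

end Quad

/-! ### Domains and subdivisions -/

/-- Near each of its boundary points the set lies, in suitable orthonormal coordinates, strictly
above the graph of a Lipschitz function. -/
def IsLipschitzDomain (Ω : Set Plane) : Prop :=
  ∀ x ∈ frontier Ω, ∃ (L : Plane ≃ₗᵢ[ℝ] Plane) (γ : ℝ → ℝ) (K : NNReal) (ε : ℝ),
    LipschitzWith K γ ∧ 0 < ε ∧ ∀ y ∈ Metric.ball x ε, (y ∈ Ω ↔ γ (L y 0) < L y 1)

/-- A conforming (edge-to-edge) finite subdivision of `Ω` into convex quadrilaterals. -/
structure Subdivision (Ω : Set Plane) where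
  cells : Finset Quad
  cover : ⋃ Q ∈ cells, Q.carrier = closure Ω
  conforming : ∀ Q ∈ cells, ∀ Q' ∈ cells, Q ≠ Q' →
    Q.carrier ∩ Q'.carrier = ∅ ∨
    (∃ i j, Q.a i = Q'.a j ∧ Q.carrier ∩ Q'.carrier = {Q.a i}) ∨
    (∃ i j, Q.edge i = Q'.edge j ∧ Q.carrier ∩ Q'.carrier = Q.edge i)

namespace Subdivision

variable {Ω : Set Plane} (G : Subdivision Ω)

/-- The mesh size `h`: the largest diameter of a cell. -/
def meshSize : ℝ := sSup ((fun Q : Quad => Metric.diam Q.carrier) '' (G.cells : Set Quad))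

/-- The broken seminorm `|w|_{1,h}`. -/
def brokenSemiH1 (w : Plane → ℝ) : ℝ :=
  Real.sqrt (∑ Q ∈ G.cells, semiH1 Q.inner w ^ 2)

/-- The global interpolant: on each (open) cell it is the local interpolant. -/
def interp (v : Plane → ℝ) (x : Plane) : ℝ :=
  ∑ Q ∈ G.cells, Q.inner.indicator (Q.interp v) x

/-- The Park–Sheen space `V^PS_{h0}`: piecewise linear functions whose edge averages are continuous
across interior edges and vanish on boundary edges. -/
def parkSheen : Set (Plane → ℝ) :=
  {w | MemLp w 2 (volume.restrict Ω) ∧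
    (∀ Q ∈ G.cells, ∃ l : Plane →ᵃ[ℝ] ℝ, ∀ᵐ x ∂(volume.restrict Q.inner), w x = l x) ∧
    (∀ Q ∈ G.cells, ∀ Q' ∈ G.cells, ∀ i j, Q.edge i = Q'.edge j →
      Q.edgeMean i w = Q'.edgeMean j w) ∧
    (∀ Q ∈ G.cells, ∀ i, Q.edge i ⊆ frontier Ω → Q.edgeMean i w = 0)}

/-- Pairs of Park–Sheen functions with vanishing cell-by-cell divergence. -/
def parkSheenDivFree : Set (Fin 2 → Plane → ℝ) :=
  {w | (∀ k, w k ∈ G.parkSheen) ∧ ∀ Q ∈ G.cells, IsDivFree Q.inner w}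

/-- The triangles, as triples of vertices, of the criss-cross refinement: each cell is divided into
four triangles by its two diagonals. -/
def crissCross : Set (Fin 3 → Plane) :=
  {T | ∃ Q ∈ G.cells, ∃ i : Fin 4, T = ![Q.diagCross, Q.a i, Q.a (i + 1)]}

end Subdivision

/-- The linear element space `V^le_h` of a triangulation `𝒯` of `Ω`: continuous functions on the
closure of `Ω` that are linear on every triangle. -/
def linearElement (Ω : Set Plane) (𝒯 : Set (Fin 3 → Plane)) : Set (Plane → ℝ) :=
  {w | ∃ f : Plane → ℝ, ContinuousOn f (closure Ω) ∧
    (∀ T ∈ 𝒯, ∃ l : Plane →ᵃ[ℝ] ℝ, ∀ x ∈ convexHull ℝ (Set.range T), f x = l x) ∧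
    ∀ᵐ x ∂(volume.restrict Ω), w x = f x}

/-- `V^le_{h0} = V^le_h ∩ H¹₀(Ω)`. -/
def linearElement0 (Ω : Set Plane) (𝒯 : Set (Fin 3 → Plane)) : Set (Plane → ℝ) :=
  {w | w ∈ linearElement Ω 𝒯 ∧ MemH10 Ω w}

/-- Pairs of functions in `V^le_{h0}` with vanishing divergence. -/
def linearElement0DivFree (Ω : Set Plane) (𝒯 : Set (Fin 3 → Plane)) :
    Set (Fin 2 → Plane → ℝ) :=
  {w | (∀ k, w k ∈ linearElement0 Ω 𝒯) ∧ IsDivFree Ω w}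

end

end QGB

namespace QGB

open MeasureTheory Filter Topology
open scoped ContDiff

noncomputable section

/-! ### Geometry of a convex quadrilateral -/

/-! Part (1). The local interpolation reproduces affine functions, so for smooth φ and affine T the
gradient of the error is ∇(φ − T) − ∇I(φ − T). Let T be the averaged first-order Taylor polynomial
over the open cell, which is convex (`exists_affine_approx`). The Poincaré inequality bounds ∇(φ −
T) in L². A Taylor estimate bounds φ − T uniformly, hence also its edge averages. The explicit shape
function with given averages (`Quad.shape`, `Quad.abs_pderiv_shape_le`) then bounds ∇I(φ − T) by
these averages times (|r| + |s|) / (r × s), which the regularity bound ρ controls against the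
diameter. Smooth functions are dense in H² of a cell (`exists_smooth_approx`), and edge averages are
continuous in H¹ because they equal integrals over triangles (`segMean_eq_integral`); this carries
the bound over to v in H². The squares are summed over the cells.

Part (2). The edge averages of a piecewise linear function are half sums of vertex values, so their
alternating sum round a cell vanishes; the interpolant then has no quadratic term and is a
Park–Sheen function. For surjectivity, vertex values W are sought whose half sums are prescribed
edge averages. Passing along an edge with average μ sends a value v to 2μ − v. Round one cell this
is consistent, because the alternating sum of the edge averages of an affine function is zero, and
neighbouring cells agree on their common edge. The passages thus form a cocycle of constant maps
over Ω, and simple connectedness yields a flat section with one free real parameter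
(`exists_flat_section`, `Subdivision.exists_local_values`). Since a Lipschitz domain is locally
connected at its boundary, cells that meet at a boundary vertex assign it the same value. The
parameter is spent on making W vanish at one boundary vertex. Boundary edges have average zero, so
|W| is constant along them, and the boundary of a bounded simply connected open set is connected
(`isPreconnected_frontier`); hence W vanishes on the whole boundary
(`Subdivision.exists_vertex_values`). The resulting function is Lipschitz and zero off Ω, and it
lies in H¹₀ by truncation and mollification (`memH10_of_lipschitz`).

Divergence. The flux of a field out of a cell is determined by its edge averages, so a
divergence-free piecewise linear field has a divergence-free interpolant
(`Quad.affineDiv_eq_zero_of_tri`). Conversely the value at the crossing point of the diagonals does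
not affect the edge averages. The vertex values differ from those of the affine field by an
alternating vector, and because opposite vertices are collinear with the centre, the four divergence
conditions follow from two, which the two components of the centre value satisfy
(`Quad.exists_center_value`). -/

theorem cross_add_left (u v w : Plane) : cross (u + v) w = cross u w + cross v w := by
  simp [cross]; ring

theorem cross_add_right (u v w : Plane) : cross u (v + w) = cross u v + cross u w := by
  simp [cross]; ring

theorem cross_sub_left (u v w : Plane) : cross (u - v) w = cross u w - cross v w := by
  simp [cross]; ring

theorem cross_sub_right (u v w : Plane) : cross u (v - w) = cross u v - cross u w := by
  simp [cross]; ring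

theorem cross_smul_left (t : ℝ) (u v : Plane) : cross (t • u) v = t * cross u v := by
  simp [cross]; ring

theorem cross_smul_right (t : ℝ) (u v : Plane) : cross u (t • v) = t * cross u v := by
  simp [cross]; ring

theorem cross_self (u : Plane) : cross u u = 0 := by
  simp [cross]; ring

theorem cross_swap (u v : Plane) : cross u v = -cross v u := by
  simp [cross]; ring

theorem cross_neg_left (u v : Plane) : cross (-u) v = -cross u v := by
  simp [cross]; ring

theorem cross_neg_right (u v : Plane) : cross u (-v) = -cross u v := by
  simp [cross]; ring

/-- The Cramer rule in the plane. -/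
theorem cross_smul_eq (u v x : Plane) :
    cross u v • x = cross x v • u + cross u x • v := by
  ext k; fin_cases k <;> simp [cross] <;> ring

/-- The affine function `x ↦ cross u (x - p)`. -/
def crossAffine (u p : Plane) : Plane →ᵃ[ℝ] ℝ where
  toFun x := cross u (x - p)
  linear :=
    { toFun := cross u
      map_add' := cross_add_right u
      map_smul' := fun t v => cross_smul_right t u v }
  map_vadd' x v := by
    simp only [vadd_eq_add, LinearMap.coe_mk, AddHom.coe_mk, cross_sub_right, cross_add_right]
    ring

theorem segment_comp_affine (l : Plane →ᵃ[ℝ] ℝ) (a b : Plane) (t : ℝ) :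
    l (AffineMap.lineMap a b t) = l a + t * (l b - l a) := by
  rw [AffineMap.apply_lineMap, AffineMap.lineMap_apply]; simp; ring

theorem affine_combo (l : Plane →ᵃ[ℝ] ℝ) (a b : Plane) {s t : ℝ} (h : s + t = 1) :
    l (s • a + t • b) = s * l a + t * l b := by
  have := Convex.combo_affine_apply (f := l) h (x := a) (y := b)
  simpa using this

theorem affine_midpoint (l : Plane →ᵃ[ℝ] ℝ) (a b : Plane) :
    l (midpoint ℝ a b) = (l a + l b) / 2 := by
  rw [AffineMap.map_midpoint, midpoint_eq_smul_add]; simp; ring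

namespace Quad

variable (Q : Quad)

/-- Twice the area of the triangle `aᵢ aᵢ₊₁ aᵢ₊₂`. -/
def turn (i : Fin 4) : ℝ := cross (Q.a (i + 1) - Q.a i) (Q.a (i + 2) - Q.a (i + 1))

theorem turn_pos (i : Fin 4) : 0 < Q.turn i := Q.convex i

/-- Twice the area of the cell. -/
def area2 : ℝ := Q.turn 0 + Q.turn 2

theorem area2_pos : 0 < Q.area2 := add_pos (Q.turn_pos 0) (Q.turn_pos 2)

/-- Either diagonal splits the cell into two triangles with the same total area. -/
theorem turn_add_turn (i : Fin 4) : Q.turn i + Q.turn (i + 2) = Q.area2 := by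
  unfold area2 turn
  fin_cases i <;> simp [cross] <;> ring

theorem cross_diag (i : Fin 4) :
    cross (Q.a (i + 2) - Q.a i) (Q.a (i + 3) - Q.a (i + 1)) = Q.area2 := by
  unfold area2 turn
  fin_cases i <;> simp [cross] <;> ring

/-- `diagCross` is defined along one diagonal only. This is the symmetric description: seen from any
vertex, it divides the diagonal in a ratio of areas. Clearing the denominator leaves a polynomial
identity in the coordinates. -/
theorem area2_smul_diagCross_sub (i : Fin 4) :
    Q.area2 • (Q.diagCross - Q.a i) = Q.turn (i + 3) • (Q.a (i + 2) - Q.a i) := by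
  have h0 : cross (Q.a 2 - Q.a 0) (Q.a 3 - Q.a 1) = Q.area2 := Q.cross_diag 0
  have hne := Q.area2_pos.ne'
  have h : Q.area2 • Q.diagCross = Q.area2 • Q.a 0 +
      cross (Q.a 1 - Q.a 0) (Q.a 3 - Q.a 1) • (Q.a 2 - Q.a 0) := by
    unfold diagCross
    rw [h0, AffineMap.lineMap_apply, vsub_eq_sub, vadd_eq_add, smul_add, smul_smul,
      mul_div_cancel₀ _ hne, add_comm]
  rw [smul_sub, h]
  unfold area2 turn
  fin_cases i <;> (ext k; fin_cases k) <;> simp [cross, -mul_eq_mul_right_iff, -mul_eq_mul_left_iff] <;> ring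

/-- The affine function with value `1` at `aᵢ` that vanishes on the diagonal through `aᵢ₊₁`. -/
def baryAff (i : Fin 4) : Plane →ᵃ[ℝ] ℝ :=
  (Q.turn (i + 3))⁻¹ • crossAffine (Q.a (i + 3) - Q.a (i + 1)) Q.diagCross

theorem baryAff_apply (i : Fin 4) (x : Plane) :
    Q.baryAff i x = (Q.turn (i + 3))⁻¹ * cross (Q.a (i + 3) - Q.a (i + 1)) (x - Q.diagCross) := rfl

theorem sub_diagCross (i : Fin 4) :
    Q.a i - Q.diagCross = (-(Q.turn (i + 3) / Q.area2)) • (Q.a (i + 2) - Q.a i) := by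
  have h := Q.area2_smul_diagCross_sub i
  have hne := Q.area2_pos.ne'
  rw [neg_smul, div_eq_inv_mul, mul_smul, ← h, smul_smul, inv_mul_cancel₀ hne, one_smul]
  abel

theorem baryAff_self (i : Fin 4) : Q.baryAff i (Q.a i) = 1 := by
  rw [baryAff_apply, sub_diagCross, cross_smul_right, cross_swap, cross_diag]
  have h1 := (Q.turn_pos (i + 3)).ne'
  have h2 := Q.area2_pos.ne'
  field_simp

theorem baryAff_succ (i : Fin 4) : Q.baryAff i (Q.a (i + 1)) = 0 := by
  rw [baryAff_apply, sub_diagCross, cross_smul_right, show i + 1 + 2 = i + 3 by fin_cases i <;> rfl, cross_self]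
  simp

theorem baryAff_center (i : Fin 4) : Q.baryAff i Q.diagCross = 0 := by
  rw [baryAff_apply]; simp [cross]

/-- Opposite nodal functions vanish on the same diagonal, hence are proportional. The factor is
negative, so at most one of the two is positive at any point. -/
theorem turn_mul_baryAff (i : Fin 4) (x : Plane) :
    Q.turn (i + 3) * Q.baryAff i x = -(Q.turn (i + 1) * Q.baryAff (i + 2) x) := by
  rw [baryAff_apply, baryAff_apply, ← mul_assoc, ← mul_assoc,
    mul_inv_cancel₀ (Q.turn_pos _).ne', show i + 2 + 3 = i + 1 by fin_cases i <;> rfl,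
    mul_inv_cancel₀ (Q.turn_pos _).ne', show i + 2 + 1 = i + 3 by fin_cases i <;> rfl,
    ← neg_sub (Q.a (i + 3)), cross_neg_left]
  ring

theorem baryAff_opp (i : Fin 4) : Q.baryAff i (Q.a (i + 2)) < 0 := by
  have h := Q.turn_mul_baryAff i (Q.a (i + 2))
  rw [baryAff_self] at h
  nlinarith [Q.turn_pos (i + 3), Q.turn_pos (i + 1)]

theorem baryAff_pred (i : Fin 4) : Q.baryAff i (Q.a (i + 3)) = 0 := by
  have h := Q.turn_mul_baryAff i (Q.a (i + 2 + 1))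
  rw [baryAff_succ, mul_zero, neg_zero] at h
  rw [show i + 3 = i + 2 + 1 by fin_cases i <;> rfl]
  exact (mul_eq_zero.1 h).resolve_left (Q.turn_pos _).ne'

/-- The nodal function of the vertex `aᵢ`, vanishing at the other vertices and at the centre. -/
def bary (i : Fin 4) (x : Plane) : ℝ := max 0 (Q.baryAff i x)

theorem bary_nonneg (i : Fin 4) (x : Plane) : 0 ≤ Q.bary i x := le_max_left _ _

theorem baryAff_pos_iff_opp_neg (i : Fin 4) (x : Plane) :
    0 < Q.baryAff i x ↔ Q.baryAff (i + 2) x < 0 := by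
  have h := Q.turn_mul_baryAff i x
  have h1 := Q.turn_pos (i + 3)
  have h2 := Q.turn_pos (i + 1)
  constructor <;> intro h3
  · by_contra! h4; nlinarith [mul_pos h1 h3, mul_nonneg h2.le h4]
  · by_contra! h4; nlinarith [mul_pos h2 (neg_pos.2 h3), mul_nonneg h1.le (neg_nonneg.2 h4)]

theorem bary_eq_of_opp (i : Fin 4) (x : Plane) (h : Q.bary (i + 2) x = 0) :
    Q.bary i x = Q.baryAff i x := by
  unfold bary at *
  rw [max_eq_right]
  by_contra! h1
  have h2 := (Q.baryAff_pos_iff_opp_neg (i + 2) x).2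
  rw [show i + 2 + 2 = i by fin_cases i <;> rfl] at h2
  have := h2 h1
  rw [max_eq_right this.le] at h
  linarith

theorem bary_mul_opp (i : Fin 4) (x : Plane) : Q.bary i x = 0 ∨ Q.bary (i + 2) x = 0 := by
  unfold bary
  rcases le_or_gt (Q.baryAff i x) 0 with h | h
  · left; exact max_eq_left h
  · right; exact max_eq_left ((Q.baryAff_pos_iff_opp_neg i x).1 h).le

theorem bary_apply_vertex (i j : Fin 4) : Q.bary i (Q.a j) = if i = j then 1 else 0 := by
  obtain ⟨k, rfl⟩ : ∃ k, j = i + k := ⟨j - i, (add_sub_cancel i j).symm⟩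
  have h1 := Q.baryAff_succ i
  have h2 := Q.baryAff_opp i
  have h3 := Q.baryAff_pred i
  have h0 := Q.baryAff_self i
  unfold bary
  fin_cases k
  · simp [h0]
  · simp [h1]
  · simp [max_eq_left h2.le]
  · simp [h3]

theorem bary_center (i : Fin 4) : Q.bary i Q.diagCross = 0 := by
  unfold bary; rw [baryAff_center]; simp

@[fun_prop]
theorem continuous_baryAff (i : Fin 4) : Continuous (Q.baryAff i) := AffineMap.continuous_of_finiteDimensional _

@[fun_prop]
theorem continuous_bary (i : Fin 4) : Continuous (Q.bary i) := by unfold bary; fun_prop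

/-- The gauge of the cell with respect to its centre. -/
def gauge (x : Plane) : ℝ := ∑ i, Q.bary i x

@[fun_prop]
theorem continuous_gauge : Continuous Q.gauge := by unfold gauge; fun_prop

theorem gauge_vertex (j : Fin 4) : Q.gauge (Q.a j) = 1 := by
  simp [gauge, bary_apply_vertex]

theorem gauge_center : Q.gauge Q.diagCross = 0 := by
  simp [gauge, bary_center]

theorem convexOn_bary (i : Fin 4) : ConvexOn ℝ Set.univ (Q.bary i) := by
  refine ⟨convex_univ, fun x _ y _ s t hs ht hst => ?_⟩
  unfold bary
  rw [affine_combo _ _ _ hst]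
  simp only [smul_eq_mul]
  refine max_le ?_ ?_
  · have h1 := le_max_left 0 (Q.baryAff i x)
    have h2 := le_max_left 0 (Q.baryAff i y)
    positivity
  · gcongr <;> exact le_max_right _ _

theorem convexOn_gauge : ConvexOn ℝ Set.univ Q.gauge := by
  refine ⟨convex_univ, fun x _ y _ s t hs ht hst => ?_⟩
  unfold gauge
  simp only [smul_eq_mul, Finset.mul_sum, ← Finset.sum_add_distrib]
  exact Finset.sum_le_sum fun i _ => (Q.convexOn_bary i).2 trivial trivial hs ht hst

theorem bary_add_smul (i : Fin 4) (x : Plane) {t : ℝ} (ht : 0 ≤ t) :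
    Q.bary i (Q.diagCross + t • (x - Q.diagCross)) = t * Q.bary i x := by
  unfold bary
  rw [baryAff_apply, baryAff_apply, add_sub_cancel_left, cross_smul_right, mul_left_comm,
    mul_max_of_nonneg _ _ ht, mul_zero]

theorem gauge_add_smul (x : Plane) {t : ℝ} (ht : 0 ≤ t) :
    Q.gauge (Q.diagCross + t • (x - Q.diagCross)) = t * Q.gauge x := by
  unfold gauge
  simp only [bary_add_smul _ _ _ ht, Finset.mul_sum]

/-- Cramer's rule in the basis given by the two diagonals, rescaled to the vectors from the centre
to two adjacent vertices. -/
theorem sub_eq_baryAff (i : Fin 4) (x : Plane) : x - Q.diagCross =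
    Q.baryAff i x • (Q.a i - Q.diagCross) + Q.baryAff (i + 1) x • (Q.a (i + 1) - Q.diagCross) := by
  have h := cross_smul_eq (Q.a (i + 2) - Q.a i) (Q.a (i + 3) - Q.a (i + 1)) (x - Q.diagCross)
  rw [cross_diag] at h
  have h0 := Q.area2_pos.ne'
  have h1 := (Q.turn_pos (i + 3)).ne'
  have h2 := (Q.turn_pos i).ne'
  rw [sub_diagCross, sub_diagCross, baryAff_apply, baryAff_apply, show i + 1 + 3 = i by
    fin_cases i <;> rfl, show i + 1 + 1 = i + 2 by fin_cases i <;> rfl, show i + 1 + 2 = i + 3 by fin_cases i <;> rfl, smul_smul,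
    smul_smul]
  refine smul_right_injective Plane h0 ?_
  beta_reduce
  rw [h, smul_add, smul_smul, smul_smul]
  congr 2
  · rw [cross_swap]; field_simp
  · rw [← neg_sub (Q.a (i + 2)), cross_neg_left]; field_simp

/-- The lines through the diagonals cut the plane into four sectors. In each opposite pair of nodal
functions one vanishes, and the two that vanish have adjacent indices. -/
theorem exists_sector (x : Plane) : ∃ i, Q.bary (i + 2) x = 0 ∧ Q.bary (i + 3) x = 0 := by
  rcases Q.bary_mul_opp 0 x with h0 | h0 <;> rcases Q.bary_mul_opp 1 x with h1 | h1
  · exact ⟨2, h0, h1⟩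
  · exact ⟨1, h1, h0⟩
  · exact ⟨3, h1, h0⟩
  · exact ⟨0, h0, h1⟩

theorem gauge_eq_of_sector {i : Fin 4} {x : Plane} (h2 : Q.bary (i + 2) x = 0)
    (h3 : Q.bary (i + 3) x = 0) : Q.gauge x = Q.bary i x + Q.bary (i + 1) x := by
  have : Q.gauge x = Q.bary i x + Q.bary (i + 1) x + Q.bary (i + 2) x + Q.bary (i + 3) x := by
    unfold gauge; rw [Fin.sum_univ_four]; fin_cases i <;> simp <;> ring
  rw [this, h2, h3]; ring

theorem eq_combo_of_sector {i : Fin 4} {x : Plane} (h2 : Q.bary (i + 2) x = 0)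
    (h3 : Q.bary (i + 3) x = 0) :
    x = (1 - Q.gauge x) • Q.diagCross + Q.bary i x • Q.a i + Q.bary (i + 1) x • Q.a (i + 1) := by
  have h := Q.sub_eq_baryAff i x
  rw [Q.gauge_eq_of_sector h2 h3, Q.bary_eq_of_opp i x h2, Q.bary_eq_of_opp (i + 1) x
    (by rwa [show i + 1 + 2 = i + 3 by fin_cases i <;> rfl])]
  rw [sub_eq_iff_eq_add] at h
  nth_rw 1 [h]
  module

theorem vertex_mem (i : Fin 4) : Q.a i ∈ Q.carrier := subset_convexHull ℝ _ ⟨i, rfl⟩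

theorem convex_carrier : Convex ℝ Q.carrier := convex_convexHull ℝ _

theorem center_mem : Q.diagCross ∈ Q.carrier := by
  unfold diagCross
  have h0 : cross (Q.a 2 - Q.a 0) (Q.a 3 - Q.a 1) = Q.area2 := Q.cross_diag 0
  have h3 : cross (Q.a 1 - Q.a 0) (Q.a 3 - Q.a 1) = Q.turn 3 := by
    unfold turn; simp [cross]; ring
  rw [h0, h3]
  have h1 := Q.turn_add_turn 1
  have h4 := Q.turn_pos 3
  have h5 := Q.turn_pos 1
  have h6 := Q.area2_pos
  refine Q.convex_carrier.lineMap_mem (Q.vertex_mem 0) (Q.vertex_mem 2) ⟨by positivity, ?_⟩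
  rw [div_le_one h6]
  change Q.turn 1 + Q.turn 3 = _ at h1
  linarith

/-- The gauge is convex and equals one at the vertices, which gives one inclusion. For the other, a
point is, in its sector, a combination of the centre and two adjacent vertices with weights 1 −
gauge and the two nodal values. -/
theorem mem_carrier_iff {x : Plane} : x ∈ Q.carrier ↔ Q.gauge x ≤ 1 := by
  constructor
  · intro hx
    have h : Q.carrier ⊆ {x ∈ Set.univ | Q.gauge x ≤ 1} :=
      convexHull_min (by rintro _ ⟨i, rfl⟩; exact ⟨trivial, (Q.gauge_vertex i).le⟩)
        (Q.convexOn_gauge.convex_le 1)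
    exact (h hx).2
  · intro hx
    obtain ⟨i, h2, h3⟩ := Q.exists_sector x
    have h := Q.eq_combo_of_sector h2 h3
    have hg := Q.gauge_eq_of_sector h2 h3
    rw [h]
    have := Q.convex_carrier.sum_mem (t := Finset.univ)
      (w := ![1 - Q.gauge x, Q.bary i x, Q.bary (i + 1) x])
      (z := ![Q.diagCross, Q.a i, Q.a (i + 1)]) ?_ ?_ ?_
    · simpa [Fin.sum_univ_three] using this
    · intro j _
      fin_cases j
      · simpa using hx
      · exact Q.bary_nonneg _ _
      · exact Q.bary_nonneg _ _
    · simp [Fin.sum_univ_three, hg]; ring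
    · intro j _
      fin_cases j
      · exact Q.center_mem
      · exact Q.vertex_mem _
      · exact Q.vertex_mem _

theorem isClosed_carrier : IsClosed Q.carrier := by
  have : Q.carrier = Q.gauge ⁻¹' Set.Iic 1 := by ext x; exact Q.mem_carrier_iff
  rw [this]; exact isClosed_Iic.preimage Q.continuous_gauge

theorem isCompact_carrier : IsCompact Q.carrier :=
  (Set.finite_range Q.a).isCompact_convexHull ℝ

/-- The gauge is homogeneous along rays from the centre, so from a point of gauge at least one an
arbitrarily small outward move leaves the cell. -/
theorem mem_inner_iff {x : Plane} : x ∈ Q.inner ↔ Q.gauge x < 1 := by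
  constructor
  · intro hx
    by_contra! h
    have h1 : Tendsto (fun t : ℝ => Q.diagCross + t • (x - Q.diagCross)) (𝓝 1) (𝓝 x) := by
      have : ContinuousAt (fun t : ℝ => Q.diagCross + t • (x - Q.diagCross)) 1 := by fun_prop
      simpa [ContinuousAt] using this
    have h2 := h1.eventually (mem_interior_iff_mem_nhds.1 hx)
    obtain ⟨t, ht, ht1⟩ := ((h2.filter_mono nhdsWithin_le_nhds).and
      (self_mem_nhdsWithin : Set.Ioi (1 : ℝ) ∈ 𝓝[>] 1)).exists
    have h3 := Q.mem_carrier_iff.1 ht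
    have ht1 : 1 < t := ht1
    rw [gauge_add_smul _ _ (by linarith)] at h3
    nlinarith
  · intro hx
    refine mem_interior.2 ⟨Q.gauge ⁻¹' Set.Iio 1, fun y hy => Q.mem_carrier_iff.2 (le_of_lt hy),
      isOpen_Iio.preimage Q.continuous_gauge, hx⟩

theorem isOpen_inner : IsOpen Q.inner := isOpen_interior

theorem inner_subset : Q.inner ⊆ Q.carrier := interior_subset

theorem convex_inner : Convex ℝ Q.inner := Q.convex_carrier.interior

theorem center_mem_inner : Q.diagCross ∈ Q.inner := Q.mem_inner_iff.2 (by simp [gauge_center])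

theorem closure_inner : closure Q.inner = Q.carrier := by
  rw [inner, Q.convex_carrier.closure_interior_eq_closure_of_nonempty_interior
    ⟨_, Q.center_mem_inner⟩, Q.isClosed_carrier.closure_eq]

theorem mem_edge_iff {i : Fin 4} {x : Plane} : x ∈ Q.edge i ↔
    Q.gauge x = 1 ∧ Q.bary (i + 2) x = 0 ∧ Q.bary (i + 3) x = 0 := by
  constructor
  · rintro ⟨s, t, hs, ht, hst, rfl⟩
    have h2 : Q.bary (i + 2) (s • Q.a i + t • Q.a (i + 1)) = 0 := by
      have h := (Q.convexOn_bary (i + 2)).2 (Set.mem_univ (Q.a i)) (Set.mem_univ (Q.a (i + 1)))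
        hs ht hst
      rw [bary_apply_vertex, bary_apply_vertex, if_neg (by fin_cases i <;> decide),
        if_neg (by fin_cases i <;> decide)] at h
      simp only [smul_zero, add_zero] at h
      exact le_antisymm h (Q.bary_nonneg _ _)
    have h3 : Q.bary (i + 3) (s • Q.a i + t • Q.a (i + 1)) = 0 := by
      have h := (Q.convexOn_bary (i + 3)).2 (Set.mem_univ (Q.a i)) (Set.mem_univ (Q.a (i + 1)))
        hs ht hst
      rw [bary_apply_vertex, bary_apply_vertex, if_neg (by fin_cases i <;> decide),
        if_neg (by fin_cases i <;> decide)] at h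
      simp only [smul_zero, add_zero] at h
      exact le_antisymm h (Q.bary_nonneg _ _)
    refine ⟨?_, h2, h3⟩
    rw [Q.gauge_eq_of_sector h2 h3, Q.bary_eq_of_opp i _ h2, Q.bary_eq_of_opp (i + 1) _
      (by rwa [show i + 1 + 2 = i + 3 by fin_cases i <;> rfl]), affine_combo _ _ _ hst, affine_combo _ _ _ hst,
      baryAff_self, baryAff_self, baryAff_succ]
    have := Q.baryAff_pred (i + 1)
    rw [show i + 1 + 3 = i by fin_cases i <;> rfl] at this
    rw [this]; linarith
  · rintro ⟨h1, h2, h3⟩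
    have h := Q.eq_combo_of_sector h2 h3
    have hg := Q.gauge_eq_of_sector h2 h3
    rw [h1, sub_self, zero_smul, zero_add] at h
    exact ⟨_, _, Q.bary_nonneg _ _, Q.bary_nonneg _ _, by rw [← hg, h1], h.symm⟩

theorem edge_subset (i : Fin 4) : Q.edge i ⊆ Q.carrier := fun _ hx =>
  Q.mem_carrier_iff.2 (Q.mem_edge_iff.1 hx).1.le

theorem exists_edge_of_notMem_inner {x : Plane} (hx : x ∈ Q.carrier) (h : x ∉ Q.inner) :
    ∃ i, x ∈ Q.edge i := by
  obtain ⟨i, h2, h3⟩ := Q.exists_sector x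
  exact ⟨i, Q.mem_edge_iff.2 ⟨le_antisymm (Q.mem_carrier_iff.1 hx)
    (not_lt.1 fun h' => h (Q.mem_inner_iff.2 h')), h2, h3⟩⟩

theorem left_mem_edge (i : Fin 4) : Q.a i ∈ Q.edge i := left_mem_segment _ _ _

theorem right_mem_edge (i : Fin 4) : Q.a (i + 1) ∈ Q.edge i := right_mem_segment _ _ _

theorem vertex_injective : Function.Injective Q.a := by
  intro i j h
  by_contra hne
  have h1 := Q.bary_apply_vertex i j
  rw [← h, bary_apply_vertex, if_pos rfl, if_neg hne] at h1
  exact one_ne_zero h1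

theorem vertex_mem_edge {i j : Fin 4} (h : Q.a j ∈ Q.edge i) : j = i ∨ j = i + 1 := by
  obtain ⟨-, h2, h3⟩ := Q.mem_edge_iff.1 h
  rw [bary_apply_vertex] at h2 h3
  by_contra! hne
  obtain ⟨k, rfl⟩ : ∃ k, j = i + k := ⟨j - i, (add_sub_cancel i j).symm⟩
  fin_cases k <;> simp_all

end Quad

/-! ### The boundary of a bounded simply connected open set is connected -/

/-- Otherwise a half-integer lying between two of the values would be attained. -/
theorem IsPreconnected.eq_of_mem_int {X : Type*} [TopologicalSpace X] {S : Set X}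
    (hS : IsPreconnected S) {f : X → ℝ} (hf : ContinuousOn f S) (h : ∀ x ∈ S, ∃ n : ℤ, f x = n)
    {x y : X} (hx : x ∈ S) (hy : y ∈ S) : f x = f y := by
  wlog hlt : f x ≤ f y generalizing x y
  · exact (this hy hx (not_le.1 hlt).le).symm
  obtain ⟨n, hn⟩ := h x hx
  obtain ⟨m, hm⟩ := h y hy
  by_contra hne
  have hnm : n < m := by
    have : f x < f y := lt_of_le_of_ne hlt hne
    rw [hn, hm] at this
    exact_mod_cast this
  have h1 : (n : ℝ) + 1 ≤ m := by exact_mod_cast hnm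
  have h2 : (n : ℝ) + 1 / 2 ∈ Set.Icc (f x) (f y) := by
    rw [hn, hm]; constructor <;> linarith
  obtain ⟨z, hz, hz'⟩ := hS.intermediate_value hx hy hf h2
  obtain ⟨k, hk⟩ := h z hz
  rw [hk] at hz'
  have h3 : (2 * k : ℤ) = 2 * n + 1 := by
    have : (2 : ℝ) * k = 2 * n + 1 := by linarith
    exact_mod_cast this
  omega

theorem exists_continuous_log {g : Plane → ℂ} (hg : Continuous g) (h0 : ∀ x, g x ≠ 0) :
    ∃ f : Plane → ℂ, Continuous f ∧ ∀ x, Complex.exp (f x) = g x := by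
  have hs : IsSimplyConnected (Set.univ : Set Plane) := by
    have : ContractibleSpace (Set.univ : Set Plane) :=
      Convex.contractibleSpace (convex_univ : Convex ℝ _) ⟨0, trivial⟩
    exact SimplyConnectedSpace.ofContractible _
  obtain ⟨f, hf, hfg⟩ := Complex.exists_continuousOn_eqOn_exp_comp hs isOpen_univ
    hg.continuousOn (by rintro ⟨x, -, hx⟩; exact h0 x hx)
  exact ⟨f, continuousOn_univ.1 hf, fun x => hfg (Set.mem_univ x)⟩

/-- The identification of the plane with `ℂ`. -/
def toC (x : Plane) : ℂ := x 0 + x 1 * Complex.I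

@[fun_prop]
theorem continuous_toC : Continuous toC := by unfold toC; fun_prop

theorem toC_injective : Function.Injective toC := by
  intro x y h
  have h0 := congrArg Complex.re h
  have h1 := congrArg Complex.im h
  simp only [toC, Complex.add_re, Complex.ofReal_re, Complex.mul_re, Complex.I_re, mul_zero,
    Complex.ofReal_im, Complex.I_im, mul_one, sub_self, add_zero, Complex.add_im, Complex.mul_im,
    zero_add] at h0 h1
  ext k
  fin_cases k
  · exact h0
  · exact h1

/-- There is no continuous logarithm along a circle. -/
theorem no_continuous_log_circle (z : Plane) {R : ℝ} (hR : 0 < R) (h : Plane → ℂ)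
    (hc : Continuous h)
    (he : ∀ x, dist x z = R → Complex.exp (h x) = toC x - toC z) : False := by
  let γ : ℝ → Plane := fun t => z + !₂[R * Real.cos t, R * Real.sin t]
  have hγ : Continuous γ := by
    refine continuous_const.add ?_
    refine (PiLp.continuous_toLp 2 _).comp ?_
    refine continuous_pi fun k => ?_
    fin_cases k <;> simp <;> fun_prop
  have hγd : ∀ t, dist (γ t) z = R := by
    intro t
    simp only [γ, dist_eq_norm, add_sub_cancel_left, EuclideanSpace.norm_eq, Fin.sum_univ_two]
    simp only [Matrix.cons_val_zero, Matrix.cons_val_one,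
      Real.norm_eq_abs, sq_abs]
    rw [show (R * Real.cos t) ^ 2 + (R * Real.sin t) ^ 2 = R ^ 2 by
      nlinarith [Real.sin_sq_add_cos_sq t], Real.sqrt_sq hR.le]
  have hγe : ∀ t, toC (γ t) - toC z = R * Complex.exp (t * Complex.I) := by
    intro t
    rw [Complex.exp_mul_I]
    simp [γ, toC]
    ring
  -- The imaginary part of the logarithm minus the angle, in units of 2π, is an integer and hence
  -- constant. But γ closes up while the angle grows by 2π.
  let k : ℝ → ℝ := fun t => ((h (γ t)).im - t) / (2 * Real.pi)
  have hk : ∀ t, ∃ n : ℤ, k t = n := by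
    intro t
    have h1 := he _ (hγd t)
    rw [hγe] at h1
    have h2 : Complex.exp (h (γ t) - t * Complex.I - Real.log R) = 1 := by
      rw [Complex.exp_sub, Complex.exp_sub, h1, ← Complex.ofReal_exp, Real.exp_log hR]
      have := Complex.exp_ne_zero (t * Complex.I)
      have hR' : (R : ℂ) ≠ 0 := by exact_mod_cast hR.ne'
      field_simp
    obtain ⟨n, hn⟩ := Complex.exp_eq_one_iff.1 h2
    refine ⟨n, ?_⟩
    have h3 := congrArg Complex.im hn
    simp at h3
    have := Real.pi_pos
    simp only [k]
    field_simp
    linarith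
  have hkc : Continuous k := by
    simp only [k]
    have := Complex.continuous_im.comp (hc.comp hγ)
    simp only [Function.comp_def] at this
    fun_prop
  have h3 := IsPreconnected.eq_of_mem_int isPreconnected_univ hkc.continuousOn (fun t _ => hk t)
    (Set.mem_univ 0) (Set.mem_univ (2 * Real.pi))
  have h4 : γ 0 = γ (2 * Real.pi) := by simp [γ]
  have := Real.pi_pos
  simp only [k, h4] at h3
  field_simp at h3
  linarith

/-- A simply connected open subset of the plane does not surround a compact set. -/
theorem no_compact_hole {Ω K L : Set Plane} (ho : IsOpen Ω) (hs : IsSimplyConnected Ω)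
    (hΩ : Bornology.IsBounded Ω) (hK : IsCompact K) (hL : IsClosed L) (hKL : Disjoint K L)
    (hu : Ωᶜ = K ∪ L) (hne : K.Nonempty) : False := by
  obtain ⟨z, hz⟩ := hne
  have hzΩ : z ∉ Ω := fun h => (hu ▸ Or.inl hz : z ∈ Ωᶜ) h
  obtain ⟨f, hf, hfe⟩ := Complex.exists_continuousOn_eqOn_exp_comp hs ho
    (g := fun x => toC x - toC z) (by fun_prop) (by
      rintro ⟨x, hx, hx0⟩
      rw [toC_injective (sub_eq_zero.1 hx0)] at hx
      exact hzΩ hx)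
  obtain ⟨κ, hκK, hκL, hκ⟩ := exists_continuous_zero_one_of_isClosed hK.isClosed hL hKL
  have hκc : Continuous κ := κ.continuous
  -- Rescaling and clamping make the cutoff identically zero near K and identically one near L, not
  -- only on these sets. This is what makes the glued function below continuous across the boundary
  -- of Ω.
  let κ' : Plane → ℝ := fun x => max 0 (min 1 (3 * κ x - 1))
  have hκ' : Continuous κ' := by simp only [κ']; fun_prop
  classical
  -- On Ω there is a logarithm f of x − z. Cutting it off joins x − z on L to the constant 1 on K
  -- without zeros, although z lies in K. A logarithm of this function on the whole plane restricts
  -- to one of x − z on a circle beyond Ω ∪ K, which cannot exist.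
  let H : Plane → ℂ := fun x =>
    if x ∈ Ω then Complex.exp (κ' x * f x) else if x ∈ K then 1 else toC x - toC z
  have hHΩ : ∀ x ∈ Ω, H x = Complex.exp (κ' x * f x) := fun x hx => if_pos hx
  have hHK : ∀ x ∈ K, H x = 1 := fun x hx => by
    have : x ∉ Ω := fun h => (hu ▸ Or.inl hx : x ∈ Ωᶜ) h
    simp [H, this, hx]
  have hHL : ∀ x ∈ L, H x = toC x - toC z := fun x hx => by
    have : x ∉ Ω := fun h => (hu ▸ Or.inr hx : x ∈ Ωᶜ) h
    have h2 : x ∉ K := fun h => Set.disjoint_left.1 hKL h hx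
    simp [H, this, h2]
  have hcase : ∀ x, x ∈ Ω ∨ x ∈ K ∨ x ∈ L := fun x => by
    by_cases h : x ∈ Ω
    · exact Or.inl h
    · have : x ∈ Ωᶜ := h
      rw [hu] at this
      exact Or.inr this
  have hH0 : ∀ x, H x ≠ 0 := by
    intro x
    rcases hcase x with h | h | h
    · rw [hHΩ x h]; exact Complex.exp_ne_zero _
    · rw [hHK x h]; exact one_ne_zero
    · rw [hHL x h]
      intro h0
      rw [toC_injective (sub_eq_zero.1 h0)] at h
      exact Set.disjoint_left.1 hKL hz h
  have hHc : Continuous H := by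
    rw [continuous_iff_continuousAt]
    intro x
    rcases hcase x with h | h | h
    · have h1 : H =ᶠ[𝓝 x] fun y => Complex.exp (κ' y * f y) :=
        eventuallyEq_of_mem (ho.mem_nhds h) hHΩ
      refine ContinuousAt.congr ?_ h1.symm
      have h2 := hf.continuousAt (ho.mem_nhds h)
      have h3 : ContinuousAt (fun y => (κ' y : ℂ)) x := by
        exact (Complex.continuous_ofReal.comp hκ').continuousAt
      exact (h3.mul h2).cexp
    · have h1 : H =ᶠ[𝓝 x] fun _ => 1 := by
        have : ∀ᶠ y in 𝓝 x, κ y < 1 / 3 := by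
          refine hκc.continuousAt.eventually_lt_const ?_
          rw [hκK h]; norm_num
        filter_upwards [this] with y hy
        rcases hcase y with h' | h' | h'
        · rw [hHΩ y h']
          have : κ' y = 0 := max_eq_left (le_trans (min_le_right _ _) (by linarith))
          simp [this]
        · exact hHK y h'
        · have := hκL h'
          rw [this] at hy
          norm_num at hy
      exact continuousAt_const.congr h1.symm
    · have h1 : H =ᶠ[𝓝 x] fun y => toC y - toC z := by
        have : ∀ᶠ y in 𝓝 x, 2 / 3 < κ y := by
          refine hκc.continuousAt.eventually_const_lt ?_
          rw [hκL h]; norm_num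
        filter_upwards [this] with y hy
        rcases hcase y with h' | h' | h'
        · rw [hHΩ y h']
          have : κ' y = 1 := by
            simp only [κ']
            rw [min_eq_left (by linarith)]; simp
          rw [this]
          simpa using hfe h'
        · have := hκK h'
          rw [this] at hy
          norm_num at hy
        · exact hHL y h'
      refine ContinuousAt.congr ?_ h1.symm
      fun_prop
  obtain ⟨h, hhc, hhe⟩ := exists_continuous_log hHc hH0
  obtain ⟨R, hR, hsub⟩ : ∃ R > 0, Ω ∪ K ⊆ Metric.ball z R := by
    obtain ⟨R, hR⟩ := (hΩ.union hK.isBounded).subset_ball z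
    exact ⟨max R 1, by positivity, hR.trans (Metric.ball_subset_ball (le_max_left _ _))⟩
  refine no_continuous_log_circle z hR h hhc fun x hx => ?_
  rw [hhe, hHL]
  have hnot : x ∉ Ω ∪ K := fun hx' => by
    have := hsub hx'
    rw [Metric.mem_ball, hx] at this
    exact lt_irrefl _ this
  rcases hcase x with h' | h' | h'
  · exact absurd (Or.inl h') hnot
  · exact absurd (Or.inr h') hnot
  · exact h'

/-- The radial map that adds R to the norm carries the punctured plane onto the exterior of the
ball. -/
theorem isPreconnected_exterior {R : ℝ} (hR : 0 ≤ R) :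
    IsPreconnected (Metric.closedBall (0 : Plane) R)ᶜ := by
  have h1 : IsPreconnected ({0}ᶜ : Set Plane) :=
    (isConnected_compl_singleton_of_one_lt_rank (by simp [← Module.finrank_eq_rank])
      0).isPreconnected
  have h2 : ContinuousOn (fun x : Plane => (1 + R / ‖x‖) • x) {0}ᶜ := by
    refine ContinuousOn.smul (continuousOn_const.add (continuousOn_const.div
      continuous_norm.continuousOn fun x hx => ?_)) continuousOn_id
    exact norm_ne_zero_iff.2 hx
  convert h1.image _ h2 using 1
  ext y
  simp only [Set.mem_compl_iff, Metric.mem_closedBall, dist_zero_right, not_le, Set.mem_image,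
    Set.mem_singleton_iff]
  constructor
  · intro hy
    have hy0 : 0 < ‖y‖ := hR.trans_lt hy
    have h3 : 0 < 1 - R / ‖y‖ := by rw [sub_pos, div_lt_one hy0]; exact hy
    refine ⟨(1 - R / ‖y‖) • y, smul_ne_zero h3.ne' (norm_pos_iff.1 hy0), ?_⟩
    rw [norm_smul, Real.norm_of_nonneg h3.le, smul_smul]
    convert one_smul ℝ y
    have h4 : ‖y‖ - R ≠ 0 := (sub_pos.2 hy).ne'
    field_simp
    ring
  · rintro ⟨x, hx, rfl⟩
    have hx0 : 0 < ‖x‖ := norm_pos_iff.2 hx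
    rw [norm_smul, Real.norm_of_nonneg (by positivity), add_mul, div_mul_cancel₀ _ hx0.ne']
    linarith

/-- Suppose the boundary splits, and let χ be 0 on one piece and 1 on the other. Then exp(2πiχ) on Ω
extends by 1 to the plane, and has a logarithm; let ψ be its imaginary part over 2π. Off Ω it is an
integer, while ψ − χ is constant on the closure of Ω, so ψ takes two different integer values on the
two pieces. Far away ψ takes only one value, so some level of ψ in the complement of Ω is bounded;
this is the hole excluded by `no_compact_hole`. -/
theorem isPreconnected_frontier {Ω : Set Plane} (ho : IsOpen Ω) (hs : IsSimplyConnected Ω)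
    (hΩ : Bornology.IsBounded Ω) : IsPreconnected (frontier Ω) := by
  rw [isPreconnected_closed_iff]
  intro t t' ht ht' hcov ⟨p, hpf, hpt⟩ ⟨p', hpf', hpt'⟩
  by_contra hdis
  have hd : Disjoint (frontier Ω ∩ t) (frontier Ω ∩ t') :=
    Set.disjoint_left.2 fun x hx hx' => hdis ⟨x, hx.1, hx.2, hx'.2⟩
  obtain ⟨χ, hχ0, hχ1, -⟩ := exists_continuous_zero_one_of_isClosed
    (isClosed_frontier.inter ht) (isClosed_frontier.inter ht') hd
  have hχc : Continuous χ := χ.continuous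
  classical
  let F : Plane → ℂ := Ω.piecewise (fun x => Complex.exp (χ x * (2 * Real.pi * Complex.I)))
    (fun _ => 1)
  have hFc : Continuous F := by
    refine Continuous.piecewise ?_ (by fun_prop) continuous_const
    intro x hx
    rcases hcov hx with h | h
    · rw [hχ0 ⟨hx, h⟩]; simp
    · rw [hχ1 ⟨hx, h⟩]; simp
  have hF0 : ∀ x, F x ≠ 0 := by
    intro x
    by_cases h : x ∈ Ω
    · simp [F, h]
    · simp [F, h]
  obtain ⟨f, hfc, hfe⟩ := exists_continuous_log hFc hF0
  let ψ : Plane → ℝ := fun x => (f x).im / (2 * Real.pi)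
  have hψc : Continuous ψ := by
    have := Complex.continuous_im.comp hfc
    simp only [Function.comp_def] at this
    simp only [ψ]; fun_prop
  have hpi := Real.pi_pos
  have hψout : ∀ x ∉ Ω, ∃ n : ℤ, ψ x = n := by
    intro x hx
    have h1 := hfe x
    simp only [F, Set.piecewise_eq_of_notMem _ _ _ hx] at h1
    obtain ⟨n, hn⟩ := Complex.exp_eq_one_iff.1 h1
    refine ⟨n, ?_⟩
    have h3 := congrArg Complex.im hn
    simp at h3
    simp only [ψ]
    field_simp
    linarith
  have hψin : ∀ x ∈ Ω, ∃ n : ℤ, ψ x - χ x = n := by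
    intro x hx
    have h1 := hfe x
    simp only [F, Set.piecewise_eq_of_mem _ _ _ hx] at h1
    obtain ⟨n, hn⟩ := Complex.exp_eq_exp_iff_exists_int.1 h1
    refine ⟨n, ?_⟩
    have h3 := congrArg Complex.im hn
    simp at h3
    simp only [ψ]
    field_simp
    linarith
  obtain ⟨x₀, hx₀⟩ := hs.nonempty
  obtain ⟨n, hn⟩ := hψin x₀ hx₀
  have hconst : ∀ x ∈ closure Ω, ψ x - χ x = n := by
    have hcl : IsClosed {x | ψ x - χ x = n} := isClosed_eq (by fun_prop) continuous_const
    refine fun x hx => closure_minimal (fun y hy => ?_) hcl hx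
    have := IsPreconnected.eq_of_mem_int hs.isPathConnected.isConnected.isPreconnected
      (f := fun x => ψ x - χ x) (by fun_prop) hψin hy hx₀
    exact this.trans hn
  have hp : ψ p = n := by
    have := hconst p (frontier_subset_closure hpf)
    rwa [hχ0 ⟨hpf, hpt⟩, Pi.zero_apply, sub_zero] at this
  have hp' : ψ p' = n + 1 := by
    have := hconst p' (frontier_subset_closure hpf')
    rw [hχ1 ⟨hpf', hpt'⟩, Pi.one_apply] at this
    linarith
  have hnot : ∀ x ∈ frontier Ω, x ∉ Ω := fun x hx h => by
    rw [ho.frontier_eq] at hx; exact hx.2 h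
  obtain ⟨R, hR0, hR⟩ : ∃ R, 0 ≤ R ∧ Ω ⊆ Metric.closedBall (0 : Plane) R := by
    obtain ⟨R, hR⟩ := hΩ.subset_closedBall (0 : Plane)
    exact ⟨max R 0, le_max_right _ _, hR.trans (Metric.closedBall_subset_closedBall
      (le_max_left _ _))⟩
  have hext : IsPreconnected (Metric.closedBall (0 : Plane) R)ᶜ := isPreconnected_exterior hR0
  have hextΩ : ∀ x ∈ (Metric.closedBall (0 : Plane) R)ᶜ, x ∉ Ω := fun x hx h => hx (hR h)
  have hne : (Metric.closedBall (0 : Plane) R)ᶜ.Nonempty := by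
    rw [Set.nonempty_compl]
    intro h
    exact NormedSpace.unbounded_univ ℝ Plane (h ▸ Metric.isBounded_closedBall)
  obtain ⟨y, hy⟩ := hne
  -- Of the two levels n and n + 1 attained on the boundary, at least one differs from the level
  -- near infinity.
  obtain ⟨m, q, hmy, hq, hqm⟩ : ∃ (m : ℤ) (q : Plane), ψ y ≠ m ∧ q ∉ Ω ∧ ψ q = m := by
    by_cases h : ψ y = n
    · exact ⟨n + 1, p', by rw [h]; simp, hnot p' hpf', by rw [hp']; simp⟩
    · exact ⟨n, p, h, hnot p hpf, hp⟩
  have hKb : Ωᶜ ∩ {x | ψ x = m} ⊆ Metric.closedBall 0 R := by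
    intro x hx
    by_contra hxR
    have := IsPreconnected.eq_of_mem_int hext (f := ψ) hψc.continuousOn
      (fun x hx => hψout x (hextΩ x hx)) hxR hy
    exact hmy (this.symm.trans hx.2)
  refine no_compact_hole (K := Ωᶜ ∩ {x | ψ x = m}) (L := Ωᶜ ∩ {x | 1 / 2 ≤ |ψ x - m|}) ho hs hΩ
    ?_ ?_ ?_ ?_ ⟨q, hq, hqm⟩
  · exact (isCompact_closedBall _ _).of_isClosed_subset
      (ho.isClosed_compl.inter (isClosed_eq hψc continuous_const)) hKb
  · exact ho.isClosed_compl.inter (isClosed_le continuous_const (by fun_prop))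
  · rw [Set.disjoint_left]
    rintro x ⟨-, hx⟩ ⟨-, hx'⟩
    simp only [Set.mem_ofPred_eq] at hx hx'
    rw [hx] at hx'
    norm_num at hx'
  · rw [← Set.inter_union_distrib_left]
    refine (Set.inter_eq_left.2 fun x hx => ?_).symm
    obtain ⟨k, hk⟩ := hψout x hx
    by_cases hkm : k = m
    · left; simp [hk, hkm]
    · right
      simp only [Set.mem_ofPred_eq, hk]
      have : (1 : ℝ) ≤ |(k : ℝ) - m| := by
        have : (1 : ℤ) ≤ |k - m| := Int.one_le_abs (sub_ne_zero.2 hkm)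
        exact_mod_cast this
      linarith

/-! ### Lipschitz domains -/

section Chart

variable {Ω : Set Plane} {x : Plane} {L : Plane ≃ₗᵢ[ℝ] Plane} {γ : ℝ → ℝ} {ε : ℝ}

theorem chart_notMem_closure (hγ : Continuous γ)
    (h : ∀ y ∈ Metric.ball x ε, (y ∈ Ω ↔ γ (L y 0) < L y 1)) {z : Plane}
    (hz : z ∈ Metric.ball x ε) (hlt : L z 1 < γ (L z 0)) : z ∉ closure Ω := by
  have hL : Continuous L := L.continuous
  have ho : IsOpen (Metric.ball x ε ∩ {z | L z 1 < γ (L z 0)}) :=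
    Metric.isOpen_ball.inter (isOpen_lt (by fun_prop) (by fun_prop))
  rw [mem_closure_iff]
  intro hcl
  obtain ⟨y, ⟨hy, hy1⟩, hyΩ⟩ := hcl _ ho ⟨hz, hlt⟩
  exact lt_asymm hy1 ((h y hy).1 hyΩ)

theorem chart_graph (hγ : Continuous γ) (hε : 0 < ε)
    (h : ∀ y ∈ Metric.ball x ε, (y ∈ Ω ↔ γ (L y 0) < L y 1)) (hx : x ∈ frontier Ω)
    (hxΩ : x ∉ Ω) : γ (L x 0) = L x 1 := by
  have hxb := Metric.mem_ball_self (x := x) hε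
  refine le_antisymm ?_ ?_
  · by_contra! hlt
    exact chart_notMem_closure hγ h hxb hlt (frontier_subset_closure hx)
  · by_contra! hlt
    exact hxΩ ((h x hxb).2 hlt)

/-- The point with given chart coordinates. -/
def chartPoint (L : Plane ≃ₗᵢ[ℝ] Plane) (p q : ℝ) : Plane := L.symm !₂[p, q]

@[simp] theorem chartPoint_zero (p q : ℝ) : L (chartPoint L p q) 0 = p := by simp [chartPoint]

@[simp] theorem chartPoint_one (p q : ℝ) : L (chartPoint L p q) 1 = q := by simp [chartPoint]

theorem chartPoint_eta (z : Plane) : chartPoint L (L z 0) (L z 1) = z := by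
  unfold chartPoint
  rw [LinearIsometryEquiv.symm_apply_eq]
  ext k; fin_cases k <;> simp

theorem continuous_chartPoint {X : Type*} [TopologicalSpace X] {p q : X → ℝ} (hp : Continuous p)
    (hq : Continuous q) : Continuous fun t => chartPoint L (p t) (q t) := by
  unfold chartPoint
  refine L.symm.continuous.comp ((PiLp.continuous_toLp 2 _).comp ?_)
  refine continuous_pi fun k => ?_
  fin_cases k <;> simpa

theorem chart_mem_frontier
    (h : ∀ y ∈ Metric.ball x ε, (y ∈ Ω ↔ γ (L y 0) < L y 1)) (ho : IsOpen Ω) {z : Plane}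
    (hz : z ∈ Metric.ball x ε) (he : γ (L z 0) = L z 1) : z ∈ frontier Ω := by
  rw [ho.frontier_eq]
  refine ⟨?_, fun hzΩ => ((h z hz).1 hzΩ).ne he⟩
  have hc : Continuous fun t : ℝ => chartPoint L (L z 0) (L z 1 + t) :=
    continuous_chartPoint (by fun_prop) (by fun_prop)
  have ht : Tendsto (fun t : ℝ => chartPoint L (L z 0) (L z 1 + t)) (𝓝[>] 0) (𝓝 z) := by
    have := hc.tendsto 0
    rw [add_zero, chartPoint_eta] at this
    exact this.mono_left nhdsWithin_le_nhds
  refine mem_closure_of_tendsto ht ?_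
  filter_upwards [ht (Metric.isOpen_ball.mem_nhds hz), self_mem_nhdsWithin] with t ht1 ht2
  have ht2 : 0 < t := ht2
  rw [h _ ht1]
  simp [he, ht2]

end Chart

/-- Below each boundary point there are points strictly under the graph, arbitrarily near, and these
are not in the closure. -/
theorem IsLipschitzDomain.interior_closure {Ω : Set Plane} (hL : IsLipschitzDomain Ω)
    (ho : IsOpen Ω) : interior (closure Ω) = Ω := by
  refine Set.Subset.antisymm (fun x hx => ?_) (interior_maximal subset_closure ho)
  by_contra hxΩ
  have hxf : x ∈ frontier Ω := by rw [ho.frontier_eq]; exact ⟨interior_subset hx, hxΩ⟩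
  obtain ⟨L, γ, K, ε, hγ, hε, h⟩ := hL x hxf
  have hg := chart_graph hγ.continuous hε h hxf hxΩ
  have hc : Continuous fun t : ℝ => chartPoint L (L x 0) (L x 1 - t) :=
    continuous_chartPoint (by fun_prop) (by fun_prop)
  have ht : Tendsto (fun t : ℝ => chartPoint L (L x 0) (L x 1 - t)) (𝓝[>] 0) (𝓝 x) := by
    have := hc.tendsto 0
    rw [sub_zero, chartPoint_eta] at this
    exact this.mono_left nhdsWithin_le_nhds
  obtain ⟨t, ⟨ht1, ht2⟩, ht3⟩ := (((ht.eventually (Metric.ball_mem_nhds x hε)).and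
    (ht.eventually (isOpen_interior.mem_nhds hx))).and self_mem_nhdsWithin).exists
  have ht3 : 0 < t := ht3
  exact chart_notMem_closure hγ.continuous h ht1 (by simp [hg, ht3]) (interior_subset ht2)

/-- Near x the boundary contains an injective arc through x, the graph; a finite set meets it in
finitely many points only. -/
theorem IsLipschitzDomain.mem_closure_frontier_diff {Ω : Set Plane} (hL : IsLipschitzDomain Ω)
    (ho : IsOpen Ω) {x : Plane} (hx : x ∈ frontier Ω) {F : Set Plane} (hF : F.Finite) :
    x ∈ closure (frontier Ω \ F) := by
  have hxΩ : x ∉ Ω := by rw [ho.frontier_eq] at hx; exact hx.2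
  obtain ⟨L, γ, K, ε, hγ, hε, h⟩ := hL x hx
  have hg := chart_graph hγ.continuous hε h hx hxΩ
  have hγc := hγ.continuous
  have hc : Continuous fun t : ℝ => chartPoint L (L x 0 + t) (γ (L x 0 + t)) :=
    continuous_chartPoint (by fun_prop) (by fun_prop)
  have ht : Tendsto (fun t : ℝ => chartPoint L (L x 0 + t) (γ (L x 0 + t))) (𝓝[≠] 0) (𝓝 x) := by
    have := hc.tendsto 0
    rw [add_zero, hg, chartPoint_eta] at this
    exact this.mono_left nhdsWithin_le_nhds
  have hinj : Function.Injective fun t : ℝ => chartPoint L (L x 0 + t) (γ (L x 0 + t)) := by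
    intro s t hst
    have := congrArg (fun z => L z 0) hst
    simpa using this
  have hcof : ∀ᶠ t in 𝓝[≠] (0 : ℝ), chartPoint L (L x 0 + t) (γ (L x 0 + t)) ∉ F :=
    nhdsNE_le_cofinite 0 (hF.preimage hinj.injOn).compl_mem_cofinite
  refine mem_closure_of_tendsto ht ?_
  filter_upwards [ht (Metric.ball_mem_nhds x hε), hcof] with t ht1 ht2
  exact ⟨chart_mem_frontier h ho ht1 (by simp), ht2⟩

theorem dist_le_of_coords (u v : Plane) : dist u v ≤ |u 0 - v 0| + |u 1 - v 1| := by
  rw [EuclideanSpace.dist_eq, Fin.sum_univ_two, Real.dist_eq, Real.dist_eq]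
  refine Real.sqrt_le_iff.2 ⟨by positivity, ?_⟩
  nlinarith [abs_nonneg (u 0 - v 0), abs_nonneg (u 1 - v 1)]

theorem abs_sub_coord_le_dist (u v : Plane) (k : Fin 2) : |u k - v k| ≤ dist u v := by
  rw [dist_eq_norm, ← PiLp.sub_apply, ← Real.norm_eq_abs]
  exact PiLp.norm_apply_le (u - v) k

/-- A Lipschitz domain is locally connected at its boundary. -/
theorem IsLipschitzDomain.exists_preconnected {Ω : Set Plane} (hL : IsLipschitzDomain Ω)
    (ho : IsOpen Ω) {x : Plane} (hx : x ∈ closure Ω) {U : Set Plane} (hU : U ∈ 𝓝 x) :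
    ∃ S, IsPreconnected S ∧ S ⊆ Ω ∩ U ∧ ∃ V ∈ 𝓝 x, Ω ∩ V ⊆ S := by
  by_cases hxΩ : x ∈ Ω
  · obtain ⟨r, hr, hrU⟩ := Metric.mem_nhds_iff.1 (inter_mem (ho.mem_nhds hxΩ) hU)
    exact ⟨Metric.ball x r, (convex_ball x r).isPreconnected, hrU, _, Metric.ball_mem_nhds x hr,
      Set.inter_subset_right⟩
  have hxf : x ∈ frontier Ω := by rw [ho.frontier_eq]; exact ⟨hx, hxΩ⟩
  obtain ⟨L, γ, K, ε, hγ, hε, h⟩ := hL x hxf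
  have hg := chart_graph hγ.continuous hε h hxf hxΩ
  have hγc := hγ.continuous
  obtain ⟨ε', hε', hU'⟩ := Metric.mem_nhds_iff.1 (inter_mem (Metric.ball_mem_nhds x hε) hU)
  -- Over an interval of radius η the graph moves by at most Kη, so a ceiling at height Mη stays
  -- above it. The choice (M + 1)η = ε' keeps the region inside the ball, the distance being at most
  -- the sum of the coordinate differences.
  set M : ℝ := K + 1
  have hM : 0 < M := by positivity
  set η : ℝ := ε' / (M + 1)
  have hη : 0 < η := by positivity
  have hηε : (M + 1) * η = ε' := by simp only [η]; field_simp
  have hγl : ∀ p, |p - L x 0| < η → |γ p - L x 1| ≤ K * η := by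
    intro p hp
    have h1 := hγ.dist_le_mul p (L x 0)
    rw [Real.dist_eq, Real.dist_eq, hg] at h1
    exact h1.trans (by gcongr)
  let S : Set Plane := {z | |L z 0 - L x 0| < η ∧ γ (L z 0) < L z 1 ∧ L z 1 < L x 1 + M * η}
  have hSball : S ⊆ Metric.ball x ε' := by
    rintro z ⟨h1, h2, h3⟩
    rw [Metric.mem_ball, ← L.dist_map]
    have h4 := abs_le.1 (hγl _ h1)
    have h5 : |L z 1 - L x 1| ≤ M * η := by
      rw [abs_le]
      constructor
      · simp only [M]; nlinarith
      · linarith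
    have h6 := dist_le_of_coords (L z) (L x)
    nlinarith
  refine ⟨S, ?_, fun z hz => ?_, Metric.ball x η, Metric.ball_mem_nhds x hη, ?_⟩
  -- The region between graph and ceiling is the continuous image of a rectangle: each vertical
  -- fibre is rescaled to the unit interval.
  · have himg : S = (fun w : ℝ × ℝ => chartPoint L w.1 (γ w.1 + w.2 * (L x 1 + M * η - γ w.1))) ''
        (Set.Ioo (L x 0 - η) (L x 0 + η) ×ˢ Set.Ioo 0 1) := by
      have hpos : ∀ p, |p - L x 0| < η → 0 < L x 1 + M * η - γ p := by
        intro p hp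
        have := abs_le.1 (hγl p hp)
        simp only [M]; nlinarith
      ext z
      constructor
      · rintro ⟨h1, h2, h3⟩
        have h4 := hpos _ h1
        refine ⟨(L z 0, (L z 1 - γ (L z 0)) / (L x 1 + M * η - γ (L z 0))), ⟨?_, ?_, ?_⟩, ?_⟩
        · have := abs_lt.1 h1
          constructor <;> simp only <;> linarith
        · exact div_pos (by linarith) h4
        · simp only; rw [div_lt_one h4]; linarith
        · simp only
          rw [div_mul_cancel₀ _ h4.ne', add_sub_cancel, chartPoint_eta]
      · rintro ⟨⟨p, t⟩, ⟨⟨hp1, hp2⟩, ht1, ht2⟩, rfl⟩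
        simp only at hp1 hp2 ht1 ht2
        have hp : |p - L x 0| < η := by rw [abs_lt]; constructor <;> linarith
        have h4 := hpos p hp
        refine ⟨by simpa using hp, ?_, ?_⟩
        · simp only [chartPoint_zero, chartPoint_one]
          nlinarith
        · simp only [chartPoint_one]
          nlinarith
    rw [himg]
    refine (isPreconnected_Ioo.prod isPreconnected_Ioo).image _ ?_
    exact (continuous_chartPoint (by fun_prop) (by fun_prop)).continuousOn
  · have h1 := hU' (hSball hz)
    exact ⟨(h z h1.1).2 hz.2.1, h1.2⟩
  · rintro z ⟨hzΩ, hz⟩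
    have h1 := abs_sub_coord_le_dist (L z) (L x) 0
    have h2 := abs_sub_coord_le_dist (L z) (L x) 1
    rw [L.dist_map] at h1 h2
    rw [Metric.mem_ball] at hz
    have h3 := abs_lt.1 (h2.trans_lt hz)
    have hηM : η ≤ M * η := by simp only [M]; nlinarith [K.coe_nonneg]
    have hball : z ∈ Metric.ball x ε := by
      refine (hU' (?_ : z ∈ Metric.ball x ε')).1
      rw [Metric.mem_ball]; nlinarith
    exact ⟨h1.trans_lt hz, (h z hball).1 hzΩ, by linarith⟩

/-! ### Combinatorics of a conforming subdivision -/

/-- Expressing each pair of ends by parameters on the other segment gives (v − u)(t − s) = 1. All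
parameters lie in [0, 1], so t − s = ±1 and the ends match. -/
theorem segment_eq_segment {a b c d : Plane} (h : segment ℝ a b = segment ℝ c d) :
    (a = c ∧ b = d) ∨ (a = d ∧ b = c) := by
  have ha : a ∈ segment ℝ c d := h ▸ left_mem_segment ℝ a b
  have hb : b ∈ segment ℝ c d := h ▸ right_mem_segment ℝ a b
  have hc : c ∈ segment ℝ a b := h ▸ left_mem_segment ℝ c d
  have hd : d ∈ segment ℝ a b := h ▸ right_mem_segment ℝ c d
  rw [segment_eq_image'] at ha hb hc hd
  obtain ⟨s, ⟨hs0, hs1⟩, rfl⟩ := ha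
  obtain ⟨t, ⟨ht0, ht1⟩, rfl⟩ := hb
  obtain ⟨u, ⟨hu0, hu1⟩, hu⟩ := hc
  obtain ⟨v, ⟨hv0, hv1⟩, hv⟩ := hd
  by_cases hcd : d - c = 0
  · rw [sub_eq_zero] at hcd
    subst hcd; simp
  have h1 : (v - u) * (t - s) = 1 := by
    have h2 : (1 - (v - u) * (t - s)) • (d - c) = 0 := by
      nth_rw 1 [sub_smul, one_smul]
      have : d - c = ((v - u) * (t - s)) • (d - c) := by
        have h3 := congrArg₂ (· - ·) hv hu
        simp only at h3
        refine h3.symm.trans ?_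
        module
      rw [← this, sub_self]
    rcases smul_eq_zero.1 h2 with h3 | h3
    · linarith
    · exact absurd h3 hcd
  rcases le_total s t with hst | hst
  · have : 1 ≤ t - s := by
      by_contra! hlt
      nlinarith
    have hs : s = 0 := by linarith
    have ht : t = 1 := by linarith
    left; subst hs ht; simp
  · have : 1 ≤ s - t := by
      by_contra! hlt
      nlinarith
    have hs : s = 1 := by linarith
    have ht : t = 0 := by linarith
    right; subst hs ht; simp

/-! ### Vertices, edges and sides of a single cell. -/

namespace Quad

variable (Q : Quad)

/-- `x` is a vertex of the cell. -/
def IsVertex (x : Plane) : Prop := ∃ i, Q.a i = x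

theorem eq_or_isVertex_of_mem_edges {i j : Fin 4} {x : Plane} (hi : x ∈ Q.edge i)
    (hj : x ∈ Q.edge j) : i = j ∨ Q.IsVertex x := by
  obtain ⟨h1, h2, h3⟩ := Q.mem_edge_iff.1 hi
  obtain ⟨-, h2', h3'⟩ := Q.mem_edge_iff.1 hj
  have hx := Q.eq_combo_of_sector h2 h3
  have hg := Q.gauge_eq_of_sector h2 h3
  rw [h1] at hg
  rw [h1, sub_self, zero_smul, zero_add] at hx
  obtain ⟨k, rfl⟩ : ∃ k, j = i + k := ⟨j - i, (add_sub_cancel i j).symm⟩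
  fin_cases k
  · simp
  · right
    have h0 : Q.bary i x = 0 := by
      rw [show i = i + 1 + 3 by fin_cases i <;> rfl]; exact h3'
    rw [h0, zero_add] at hg
    rw [h0, ← hg, zero_smul, one_smul, zero_add] at hx
    exact ⟨_, hx.symm⟩
  · have h0 : Q.bary i x = 0 := by
      rw [show i = i + 2 + 2 by fin_cases i <;> rfl]; exact h2'
    have h0' : Q.bary (i + 1) x = 0 := by
      rw [show i + 1 = i + 2 + 3 by fin_cases i <;> rfl]; exact h3'
    rw [h0, h0'] at hg
    norm_num at hg
  · right
    have h0 : Q.bary (i + 1) x = 0 := by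
      rw [show i + 1 = i + 3 + 2 by fin_cases i <;> rfl]; exact h2'
    rw [h0, add_zero] at hg
    rw [h0, ← hg, zero_smul, one_smul, add_zero] at hx
    exact ⟨_, hx.symm⟩

theorem IsVertex.mem {Q : Quad} {x : Plane} (h : Q.IsVertex x) : x ∈ Q.carrier := by
  obtain ⟨i, rfl⟩ := h; exact Q.vertex_mem i

theorem IsVertex.gauge_eq {Q : Quad} {x : Plane} (h : Q.IsVertex x) : Q.gauge x = 1 := by
  obtain ⟨i, rfl⟩ := h; exact Q.gauge_vertex i

/-- The affine function that vanishes on the line through the edge `eᵢ`, positive in the cell. -/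
def side (i : Fin 4) : Plane →ᵃ[ℝ] ℝ := crossAffine (Q.a (i + 1) - Q.a i) (Q.a i)

theorem side_apply (i : Fin 4) (x : Plane) :
    Q.side i x = cross (Q.a (i + 1) - Q.a i) (x - Q.a i) := rfl

theorem side_left (i : Fin 4) : Q.side i (Q.a i) = 0 := by rw [side_apply]; simp [cross]

theorem side_right (i : Fin 4) : Q.side i (Q.a (i + 1)) = 0 := by rw [side_apply, cross_self]

theorem side_center_pos (i : Fin 4) : 0 < Q.side i Q.diagCross := by
  have h := Q.area2_smul_diagCross_sub i
  have h1 : Q.area2 * Q.side i Q.diagCross = Q.turn (i + 3) * Q.turn i := by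
    rw [side_apply, ← cross_smul_right, h, cross_smul_right]
    congr 1
    unfold turn
    rw [← sub_add_sub_cancel (Q.a (i + 2)) (Q.a (i + 1)), cross_add_right, cross_self, add_zero]
  have h2 := mul_pos (Q.turn_pos (i + 3)) (Q.turn_pos i)
  rw [← h1] at h2
  exact pos_of_mul_pos_right h2 Q.area2_pos.le

/-- Both sides are affine and agree at the two ends of the edge and at the centre. -/
theorem side_eq (i : Fin 4) (x : Plane) :
    Q.side i x = (1 - Q.baryAff i x - Q.baryAff (i + 1) x) * Q.side i Q.diagCross := by
  have h := Q.sub_eq_baryAff i x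
  have h1 : x - Q.a i = (Q.diagCross - Q.a i) + (Q.baryAff i x • (Q.a i - Q.diagCross) +
      Q.baryAff (i + 1) x • ((Q.a (i + 1) - Q.a i) - (Q.diagCross - Q.a i))) := by
    rw [sub_sub_sub_cancel_right, ← h]; abel
  rw [side_apply, side_apply, h1, cross_add_right, cross_add_right, cross_smul_right,
    cross_smul_right, cross_sub_right _ (Q.a (i + 1) - Q.a i), cross_self, ← neg_sub Q.diagCross,
    cross_neg_right]
  ring

theorem baryAff_pos_of_mem_edge {i : Fin 4} {x : Plane} (hx : x ∈ Q.edge i)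
    (hv : ¬ Q.IsVertex x) : 0 < Q.baryAff i x ∧ 0 < Q.baryAff (i + 1) x := by
  obtain ⟨h1, h2, h3⟩ := Q.mem_edge_iff.1 hx
  rw [← Q.bary_eq_of_opp i x h2, ← Q.bary_eq_of_opp (i + 1) x
      (by rwa [show i + 1 + 2 = i + 3 by fin_cases i <;> rfl])]
  have hx := Q.eq_combo_of_sector h2 h3
  have hg := Q.gauge_eq_of_sector h2 h3
  rw [h1] at hg
  rw [h1, sub_self, zero_smul, zero_add] at hx
  constructor
  · refine lt_of_le_of_ne (Q.bary_nonneg _ _) fun h0 => hv ?_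
    rw [← h0, zero_add] at hg
    rw [← h0, ← hg, zero_smul, one_smul, zero_add] at hx
    exact ⟨_, hx.symm⟩
  · refine lt_of_le_of_ne (Q.bary_nonneg _ _) fun h0 => hv ?_
    rw [← h0, add_zero] at hg
    rw [← h0, ← hg, zero_smul, one_smul, add_zero] at hx
    exact ⟨_, hx.symm⟩

/-- Near an inner point of an edge, the cell is a half plane. -/
theorem eventually_mem_of_side_nonneg {i : Fin 4} {x : Plane} (hx : x ∈ Q.edge i)
    (hv : ¬ Q.IsVertex x) : ∀ᶠ y in 𝓝 x, 0 ≤ Q.side i y → y ∈ Q.carrier := by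
  obtain ⟨h1, h2⟩ := Q.baryAff_pos_of_mem_edge hx hv
  filter_upwards [(Q.continuous_baryAff i).continuousAt.eventually_const_lt h1,
    (Q.continuous_baryAff (i + 1)).continuousAt.eventually_const_lt h2] with y hy1 hy2 hy
  have h3 := (Q.baryAff_pos_iff_opp_neg i y).1 hy1
  have h4 := (Q.baryAff_pos_iff_opp_neg (i + 1) y).1 hy2
  rw [show i + 1 + 2 = i + 3 by fin_cases i <;> rfl] at h4
  have h5 : Q.bary (i + 2) y = 0 := max_eq_left h3.le
  have h6 : Q.bary (i + 3) y = 0 := max_eq_left h4.le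
  rw [mem_carrier_iff, Q.gauge_eq_of_sector h5 h6, Q.bary_eq_of_opp i y h5,
    Q.bary_eq_of_opp (i + 1) y (by rwa [show i + 1 + 2 = i + 3 by fin_cases i <;> rfl])]
  rw [side_eq] at hy
  have := nonneg_of_mul_nonneg_left hy (Q.side_center_pos i)
  linarith

theorem side_eq_zero_of_mem_edge {i : Fin 4} {x : Plane} (hx : x ∈ Q.edge i) :
    Q.side i x = 0 := by
  obtain ⟨s, t, -, -, hst, rfl⟩ := hx
  rw [affine_combo _ _ _ hst, side_left, side_right]; ring

theorem isClosed_edge (i : Fin 4) : IsClosed (Q.edge i) := by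
  rw [edge, ← closure_openSegment]; exact isClosed_closure

end Quad

/-! ### How the cells meet each other and the boundary. -/

namespace Subdivision

variable {Ω : Set Plane} (G : Subdivision Ω) {Q Q' : Quad} {x : Plane}

theorem carrier_subset (hQ : Q ∈ G.cells) : Q.carrier ⊆ closure Ω := by
  rw [← G.cover]; exact Set.subset_biUnion_of_mem (u := fun Q : Quad => Q.carrier) hQ

theorem exists_cell (hx : x ∈ closure Ω) : ∃ Q ∈ G.cells, x ∈ Q.carrier := by
  rw [← G.cover] at hx; simpa using hx

theorem isBounded (G : Subdivision Ω) : Bornology.IsBounded Ω := by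
  refine Bornology.IsBounded.subset ?_ (subset_closure (s := Ω))
  rw [← G.cover]
  exact (Bornology.isBounded_biUnion_finset _).2 fun Q _ => Q.isCompact_carrier.isBounded

theorem inner_subset_domain (ho : IsOpen Ω) (hL : IsLipschitzDomain Ω) (hQ : Q ∈ G.cells) :
    Q.inner ⊆ Ω := by
  rw [← hL.interior_closure ho]; exact interior_mono (G.carrier_subset hQ)

/-- Common points of two cells lie on the boundaries of both. -/
theorem exists_common (hQ : Q ∈ G.cells) (hQ' : Q' ∈ G.cells) (hne : Q ≠ Q')
    (hx : x ∈ Q.carrier) (hx' : x ∈ Q'.carrier) :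
    (Q.IsVertex x ∧ Q'.IsVertex x) ∨
    ∃ i j, Q.edge i = Q'.edge j ∧ x ∈ Q.edge i ∧ Q.carrier ∩ Q'.carrier = Q.edge i := by
  rcases G.conforming Q hQ Q' hQ' hne with h | ⟨i, j, hij, h⟩ | ⟨i, j, hij, h⟩
  · exact absurd (h ▸ ⟨hx, hx'⟩ : x ∈ (∅ : Set Plane)) (Set.notMem_empty x)
  · have : x ∈ ({Q.a i} : Set Plane) := h ▸ ⟨hx, hx'⟩
    rw [Set.mem_singleton_iff] at this
    exact Or.inl ⟨⟨i, this.symm⟩, ⟨j, hij.symm.trans this.symm⟩⟩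
  · exact Or.inr ⟨i, j, hij, h ▸ ⟨hx, hx'⟩, h⟩

theorem isVertex_of_mem (hQ : Q ∈ G.cells) (hQ' : Q' ∈ G.cells) (hv : Q.IsVertex x)
    (hx' : x ∈ Q'.carrier) : Q'.IsVertex x := by
  by_cases hne : Q = Q'
  · exact hne ▸ hv
  rcases G.exists_common hQ hQ' hne hv.mem hx' with ⟨-, h⟩ | ⟨i, j, hij, hx, -⟩
  · exact h
  obtain ⟨k, rfl⟩ := hv
  rcases segment_eq_segment hij with ⟨h1, h2⟩ | ⟨h1, h2⟩ <;>
    rcases Q.vertex_mem_edge hx with rfl | rfl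
  exacts [⟨_, h1.symm⟩, ⟨_, h2.symm⟩, ⟨_, h1.symm⟩, ⟨_, h2.symm⟩]

theorem eq_of_mem_inner (hQ : Q ∈ G.cells) (hQ' : Q' ∈ G.cells) (hx : x ∈ Q.inner)
    (hx' : x ∈ Q'.carrier) : Q = Q' := by
  by_contra hne
  have h1 := Q.mem_inner_iff.1 hx
  rcases G.exists_common hQ hQ' hne (Q.inner_subset hx) hx' with ⟨h, -⟩ | ⟨i, j, hij, h, -⟩
  · exact h1.ne h.gauge_eq
  · exact h1.ne (Q.mem_edge_iff.1 h).1

theorem edge_eq_of_mem (hQ : Q ∈ G.cells) (hQ' : Q' ∈ G.cells) (hne : Q ≠ Q') {i : Fin 4}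
    (hx : x ∈ Q.edge i) (hv : ¬ Q.IsVertex x) (hx' : x ∈ Q'.carrier) :
    ∃ j, Q.edge i = Q'.edge j ∧ Q.carrier ∩ Q'.carrier = Q.edge i := by
  rcases G.exists_common hQ hQ' hne (Q.edge_subset i hx) hx' with ⟨h, -⟩ | ⟨k, j, hij, h, hc⟩
  · exact absurd h hv
  rcases Q.eq_or_isVertex_of_mem_edges hx h with rfl | h
  · exact ⟨j, hij, hc⟩
  · exact absurd h hv

theorem edge_eq_or_isVertex (hQ : Q ∈ G.cells) (hQ' : Q' ∈ G.cells) {i j : Fin 4}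
    (hx : x ∈ Q.edge i) (hx' : x ∈ Q'.edge j) :
    Q.edge i = Q'.edge j ∨ (Q.IsVertex x ∧ Q'.IsVertex x) := by
  by_cases hv : Q.IsVertex x
  · exact Or.inr ⟨hv, G.isVertex_of_mem hQ hQ' hv (Q'.edge_subset j hx')⟩
  left
  by_cases hne : Q = Q'
  · subst hne
    rcases Q.eq_or_isVertex_of_mem_edges hx hx' with rfl | h
    · rfl
    · exact absurd h hv
  obtain ⟨k, hk, -⟩ := G.edge_eq_of_mem hQ hQ' hne hx hv (Q'.edge_subset j hx')
  rw [hk] at hx ⊢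
  rcases Q'.eq_or_isVertex_of_mem_edges hx hx' with rfl | h
  · rfl
  · exact absurd (G.isVertex_of_mem hQ' hQ h (Q.edge_subset i (hk ▸ hx))) hv

/-- All cells that contain a given point share a vertex. -/
theorem exists_common_vertex (x : Plane) :
    ∃ a, ∀ Q ∈ G.cells, x ∈ Q.carrier → Q.IsVertex a := by
  by_cases h0 : ∃ Q ∈ G.cells, x ∈ Q.carrier
  swap
  · exact ⟨0, fun Q hQ hx => absurd ⟨Q, hQ, hx⟩ h0⟩
  obtain ⟨Q, hQ, hx⟩ := h0
  by_cases hv : Q.IsVertex x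
  · exact ⟨x, fun Q' hQ' hx' => G.isVertex_of_mem hQ hQ' hv hx'⟩
  by_cases hin : x ∈ Q.inner
  · refine ⟨Q.a 0, fun Q' hQ' hx' => ?_⟩
    rw [← G.eq_of_mem_inner hQ hQ' hin hx']
    exact ⟨0, rfl⟩
  obtain ⟨i, hi⟩ := Q.exists_edge_of_notMem_inner hx hin
  refine ⟨Q.a i, fun Q' hQ' hx' => ?_⟩
  by_cases hne : Q = Q'
  · exact hne ▸ ⟨i, rfl⟩
  obtain ⟨j, hj, -⟩ := G.edge_eq_of_mem hQ hQ' hne hi hv hx'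
  rcases segment_eq_segment hj with ⟨h1, -⟩ | ⟨h1, -⟩
  exacts [⟨_, h1.symm⟩, ⟨_, h1.symm⟩]

/-- Inner points of an edge shared by two cells lie in the domain. -/
theorem mem_domain_of_shared (ho : IsOpen Ω) (hL : IsLipschitzDomain Ω) (hQ : Q ∈ G.cells)
    (hQ' : Q' ∈ G.cells) (hne : Q ≠ Q') {i j : Fin 4} (hij : Q.edge i = Q'.edge j)
    (hx : x ∈ Q.edge i) (hv : ¬ Q.IsVertex x) : x ∈ Ω := by
  have hx' : x ∈ Q'.edge j := hij ▸ hx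
  have hv' : ¬ Q'.IsVertex x := fun h =>
    hv (G.isVertex_of_mem hQ' hQ h (Q.edge_subset i hx))
  have e1 := Q.eventually_mem_of_side_nonneg hx hv
  have e2 := Q'.eventually_mem_of_side_nonneg hx' hv'
  rcases segment_eq_segment hij with ⟨h1, h2⟩ | ⟨h1, h2⟩
  -- If both cells traverse the edge in the same direction, they lie on the same side of it. A point
  -- slightly inside one is then inside the other, but off the edge, which is all they have in
  -- common.
  · exfalso
    have hside : ∀ y, Q'.side j y = Q.side i y := fun y => by
      rw [Quad.side_apply, Quad.side_apply, h1, h2]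
    have hc : Tendsto (fun t : ℝ => (1 - t) • x + t • Q.diagCross) (𝓝[>] 0) (𝓝 x) := by
      have : Continuous fun t : ℝ => (1 - t) • x + t • Q.diagCross := by fun_prop
      have := this.tendsto 0
      simp only [sub_zero, one_smul, zero_smul, add_zero] at this
      exact this.mono_left nhdsWithin_le_nhds
    obtain ⟨t, ⟨ht1, ht2⟩, ht3⟩ := (((hc.eventually e1).and (hc.eventually e2)).and
      (self_mem_nhdsWithin : Set.Ioi (0 : ℝ) ∈ 𝓝[>] 0)).exists
    have ht3 : 0 < t := ht3
    have hpos : 0 < Q.side i ((1 - t) • x + t • Q.diagCross) := by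
      rw [affine_combo _ _ _ (by ring), Q.side_eq_zero_of_mem_edge hx]
      have := mul_pos ht3 (Q.side_center_pos i)
      linarith
    have hm1 := ht1 hpos.le
    have hm2 := ht2 (by rw [hside]; exact hpos.le)
    obtain ⟨k, hk, hkc⟩ := G.edge_eq_of_mem hQ hQ' hne hx hv (Q'.edge_subset j hx')
    have : (1 - t) • x + t • Q.diagCross ∈ Q.edge i := hkc ▸ ⟨hm1, hm2⟩
    exact hpos.ne' (Q.side_eq_zero_of_mem_edge this)
  -- With opposite directions the two cells fill both half discs at x, so x is interior to the
  -- closure of Ω, and that interior is Ω.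
  · have hside : ∀ y, Q'.side j y = -Q.side i y := fun y => by
      rw [Quad.side_apply, Quad.side_apply, ← h1, ← h2]
      simp [cross]; ring
    rw [← hL.interior_closure ho, mem_interior_iff_mem_nhds]
    filter_upwards [e1, e2] with y hy1 hy2
    rcases le_total 0 (Q.side i y) with h | h
    · exact G.carrier_subset hQ (hy1 h)
    · exact G.carrier_subset hQ' (hy2 (by rw [hside]; linarith))

theorem eventually_mem_cells (x : Plane) :
    ∀ᶠ y in 𝓝 x, ∀ Q ∈ G.cells, y ∈ Q.carrier → x ∈ Q.carrier := by
  rw [Filter.eventually_all_finset]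
  intro Q hQ
  by_cases hx : x ∈ Q.carrier
  · exact Eventually.of_forall fun _ _ => hx
  · filter_upwards [Q.isClosed_carrier.isOpen_compl.mem_nhds hx] with y hy hy'
    exact absurd hy' hy

/-- A single boundary point that is not a vertex decides for the entire edge. It shows that no other
cell shares the edge; then a point of the edge that is not a vertex lies in no other cell, and if it
were in Ω it would be interior to the cell. -/
theorem edge_subset_frontier (ho : IsOpen Ω) (hL : IsLipschitzDomain Ω) (hQ : Q ∈ G.cells)
    {i : Fin 4} (hx : x ∈ Q.edge i) (hv : ¬ Q.IsVertex x) (hxf : x ∈ frontier Ω) :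
    Q.edge i ⊆ frontier Ω := by
  have hxΩ : x ∉ Ω := by rw [ho.frontier_eq] at hxf; exact hxf.2
  have honly : ∀ y ∈ Q.edge i, ¬ Q.IsVertex y → ∀ Q' ∈ G.cells, y ∈ Q'.carrier → Q = Q' := by
    intro y hy hyv Q' hQ' hyQ'
    by_contra hne
    obtain ⟨j, hj, -⟩ := G.edge_eq_of_mem hQ hQ' hne hy hyv hyQ'
    exact hxΩ (G.mem_domain_of_shared ho hL hQ hQ' hne hj hx hv)
  have key : ∀ y ∈ Q.edge i, ¬ Q.IsVertex y → y ∈ frontier Ω := by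
    intro y hy hyv
    rw [ho.frontier_eq]
    refine ⟨G.carrier_subset hQ (Q.edge_subset i hy), fun hyΩ => ?_⟩
    have h1 : y ∈ Q.inner := by
      rw [Quad.inner, mem_interior_iff_mem_nhds]
      filter_upwards [ho.mem_nhds hyΩ, G.eventually_mem_cells y] with z hz hz'
      obtain ⟨Q', hQ', hzQ'⟩ := G.exists_cell (subset_closure hz)
      rw [honly y hy hyv Q' hQ' (hz' Q' hQ' hzQ')]
      exact hzQ'
    exact (Q.mem_inner_iff.1 h1).ne (Q.mem_edge_iff.1 hy).1
  rw [Quad.edge, ← closure_openSegment]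
  refine closure_minimal (fun y hy => ?_) isClosed_frontier
  have hye : y ∈ Q.edge i := openSegment_subset_segment _ _ _ hy
  refine key y hye fun hyv => ?_
  obtain ⟨k, rfl⟩ := hyv
  have hab : Q.a i ≠ Q.a (i + 1) := fun h => by
    have := Q.vertex_injective h; fin_cases i <;> simp at this
  rcases Q.vertex_mem_edge hye with rfl | rfl
  · exact hab (left_mem_openSegment_iff.1 hy)
  · exact hab (right_mem_openSegment_iff.1 hy)

/-- The boundary of the domain consists of edges. -/
theorem exists_boundary_edge (ho : IsOpen Ω) (hL : IsLipschitzDomain Ω) (hx : x ∈ frontier Ω) :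
    ∃ Q ∈ G.cells, ∃ i, x ∈ Q.edge i ∧ Q.edge i ⊆ frontier Ω := by
  -- At a vertex on the boundary, an edge through it need not be a boundary edge. Vertices are
  -- therefore left out and recovered by density, the boundary edges being finitely many closed
  -- sets.
  let V : Set Plane := ⋃ Q ∈ G.cells, Set.range Q.a
  have hV : V.Finite := G.cells.finite_toSet.biUnion fun Q _ => Set.finite_range _
  let E : Set (Quad × Fin 4) := {p ∈ (G.cells ×ˢ Finset.univ : Finset (Quad × Fin 4)) |
    p.1.edge p.2 ⊆ frontier Ω}
  have hE : E.Finite := (Finset.finite_toSet _).subset fun p hp => hp.1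
  have hcl : IsClosed (⋃ p ∈ E, p.1.edge p.2) :=
    hE.isClosed_biUnion fun p _ => p.1.isClosed_edge p.2
  have hsub : frontier Ω \ V ⊆ ⋃ p ∈ E, p.1.edge p.2 := by
    rintro y ⟨hy, hyV⟩
    obtain ⟨Q, hQ, hyQ⟩ := G.exists_cell (frontier_subset_closure hy)
    have hyin : y ∉ Q.inner := fun h => by
      rw [ho.frontier_eq] at hy
      exact hy.2 (G.inner_subset_domain ho hL hQ h)
    obtain ⟨i, hi⟩ := Q.exists_edge_of_notMem_inner hyQ hyin
    have hv : ¬ Q.IsVertex y := fun ⟨k, hk⟩ => hyV (Set.mem_biUnion hQ ⟨k, hk⟩)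
    exact Set.mem_biUnion (x := (Q, i)) ⟨by simpa using hQ,
      G.edge_subset_frontier ho hL hQ hi hv hy⟩ hi
  have := closure_minimal hsub hcl (hL.mem_closure_frontier_diff ho hx hV)
  simp only [Set.mem_iUnion] at this
  obtain ⟨p, hp, hxp⟩ := this
  have hp1 := hp.1
  simp only [Finset.mem_product, Finset.mem_univ, and_true] at hp1
  exact ⟨p.1, hp1, p.2, hxp, hp.2⟩

end Subdivision

/-! ### Vertex values with given edge averages -/

/-- A cocycle of constant transition maps over a simply connected space has a flat section. -/
theorem exists_flat_section {B ι F : Type*} [TopologicalSpace B] [SimplyConnectedSpace B]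
    [LocallyPathConnectedSpace B] (U : ι → Set B) (hU : ∀ i, IsOpen (U i))
    (hcov : ∀ x, ∃ i, x ∈ U i) (T : ι → ι → F → F)
    (hself : ∀ i, (U i).Nonempty → ∀ v, T i i v = v)
    (hcomp : ∀ i j k, (U i ∩ U j ∩ U k).Nonempty → ∀ v, T j k (T i j v) = T i k v)
    (i₀ : ι) (x₀ : B) (hx₀ : x₀ ∈ U i₀) (v₀ : F) :
    ∃ c : ι → B → F, (∀ i, ∀ x ∈ U i, ∀ᶠ y in 𝓝 x, c i y = c i x) ∧
      (∀ i j, ∀ x ∈ U i ∩ U j, c j x = T i j (c i x)) ∧ c i₀ x₀ = v₀ := by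
  -- With the discrete topology on the fibre, the cocycle defines a bundle whose projection is a
  -- covering map. A lift of the identity of the simply connected base is the flat section.
  let _ : TopologicalSpace F := ⊥
  have : DiscreteTopology F := ⟨rfl⟩
  choose ind hind using hcov
  let Z : FiberBundleCore ι B F :=
    { baseSet := U
      isOpen_baseSet := hU
      indexAt := ind
      mem_baseSet_at := hind
      coordChange := fun i j _ => T i j
      coordChange_self := fun i x hx v => hself i ⟨x, hx⟩ v
      continuousOn_coordChange := fun i j =>
        ((continuous_of_discreteTopology (f := T i j)).comp continuous_snd).continuousOn
      coordChange_comp := fun i j k x hx v => hcomp i j k ⟨x, hx⟩ v }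
  have cov : IsCoveringMap (Bundle.TotalSpace.proj : Bundle.TotalSpace F Z.Fiber → B) :=
    FiberBundle.isCoveringMap
  obtain ⟨S, ⟨hS0, hS⟩, -⟩ := cov.existsUnique_continuousMap_lifts (ContinuousMap.id B) x₀
    (⟨x₀, T i₀ (ind x₀) v₀⟩ : Bundle.TotalSpace F Z.Fiber) rfl
  have hproj : ∀ x, (S x).proj = x := fun x => congrFun hS x
  refine ⟨fun i x => T (ind (S x).proj) i (S x).snd, ?_, ?_, ?_⟩
  · intro i x hx
    have h1 : ContinuousAt (fun y => (Z.localTriv i (S y)).2) x := by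
      have h2 : S x ∈ (Z.localTriv i).source := by
        rw [FiberBundleCore.mem_localTriv_source, hproj]; exact hx
      have h3 := (Z.localTriv i).continuousAt h2
      exact (continuous_snd.continuousAt.comp h3).comp S.continuous.continuousAt
    have h4 := h1.eventually (show ∀ᶠ w in 𝓝 (Z.localTriv i (S x)).2, w = (Z.localTriv i (S x)).2 by
      rw [nhds_discrete]; simp)
    exact h4
  · intro i j x hx
    refine (hcomp _ i j ⟨x, ?_⟩ _).symm
    rw [hproj]
    exact ⟨⟨hind x, hx.1⟩, hx.2⟩
  · have h := congrArg (fun e : Bundle.TotalSpace F Z.Fiber => T (ind e.proj) i₀ e.snd) hS0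
    refine h.trans ?_
    change T (ind x₀) i₀ (T i₀ (ind x₀) v₀) = v₀
    rw [hcomp i₀ (ind x₀) i₀ ⟨x₀, ⟨hx₀, hind x₀⟩, hx₀⟩, hself i₀ ⟨x₀, hx₀⟩]

theorem IsPreconnected.eq_of_locally_constant {X F : Type*} [TopologicalSpace X] {S : Set X}
    (hS : IsPreconnected S) {f : X → F} (hf : ∀ x ∈ S, ∀ᶠ y in 𝓝 x, f y = f x) {x y : X}
    (hx : x ∈ S) (hy : y ∈ S) : f x = f y := by
  have := isPreconnected_iff_preconnectedSpace.1 hS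
  have h : IsLocallyConstant (fun z : S => f z) := by
    rw [IsLocallyConstant.iff_eventually_eq]
    intro z
    exact continuous_subtype_val.continuousAt.eventually (hf z z.2)
  exact h.apply_eq_of_preconnectedSpace ⟨x, hx⟩ ⟨y, hy⟩

/-- The alternating sign of the vertices of a cell. -/
def altSign (i : Fin 4) : ℝ := (-1) ^ (i : ℕ)

theorem altSign_mul_self (i : Fin 4) : altSign i * altSign i = 1 := by
  unfold altSign; fin_cases i <;> norm_num

theorem altSign_succ (i : Fin 4) : altSign (i + 1) = -altSign i := by
  unfold altSign; fin_cases i <;> norm_num [Fin.val_add]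

namespace Quad

/-- Given the value `v` at the `i`-th vertex, the value at the `j`-th vertex of a function with
the same averages over edges, computed from end values, as the affine function `l`. -/
def transfer (Q : Quad) (l : Plane →ᵃ[ℝ] ℝ) (i j : Fin 4) (v : ℝ) : ℝ :=
  l (Q.a j) + altSign i * altSign j * (v - l (Q.a i))

theorem transfer_self (Q : Quad) (l : Plane →ᵃ[ℝ] ℝ) (i : Fin 4) (v : ℝ) :
    Q.transfer l i i v = v := by
  unfold transfer; rw [altSign_mul_self]; ring

/-- Successive reflections v ↦ 2μ − v alternate in sign, and the sign is well defined on the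
four-cycle of vertices since four is even. This is the cocycle identity inside one cell. -/
theorem transfer_transfer (Q : Quad) (l : Plane →ᵃ[ℝ] ℝ) (i j k : Fin 4) (v : ℝ) :
    Q.transfer l j k (Q.transfer l i j v) = Q.transfer l i k v := by
  unfold transfer
  have := altSign_mul_self j
  linear_combination altSign i * altSign k * (v - l (Q.a i)) * this

theorem transfer_succ (Q : Quad) (l : Plane →ᵃ[ℝ] ℝ) (i : Fin 4) (v : ℝ) :
    Q.transfer l i (i + 1) v = 2 * l (Q.mid i) - v := by
  unfold transfer
  rw [altSign_succ, mid, affine_midpoint]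
  have := altSign_mul_self i
  linear_combination - (v - l (Q.a i)) * this

theorem transfer_pred (Q : Quad) (l : Plane →ᵃ[ℝ] ℝ) (i : Fin 4) (v : ℝ) :
    Q.transfer l (i + 1) i v = 2 * l (Q.mid i) - v := by
  unfold transfer
  rw [altSign_succ, mid, affine_midpoint]
  have := altSign_mul_self i
  linear_combination - (v - l (Q.a (i + 1))) * this

end Quad

namespace Subdivision

variable {Ω : Set Plane} (G : Subdivision Ω)

/-- Affine functions on the cells have the same averages over common edges. -/
def EdgeMatching (l : Quad → Plane →ᵃ[ℝ] ℝ) : Prop :=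
  ∀ Q ∈ G.cells, ∀ Q' ∈ G.cells, ∀ i j, Q.edge i = Q'.edge j → l Q (Q.mid i) = l Q' (Q'.mid j)

variable {G} {l : Quad → Plane →ᵃ[ℝ] ℝ}

/-- Two distinct cells with two vertices in common share exactly an edge, and the passage between
its ends is the reflection in the edge average, on which both cells agree. -/
theorem EdgeMatching.transfer_eq (hl : G.EdgeMatching l) {Q Q' : Quad} (hQ : Q ∈ G.cells)
    (hQ' : Q' ∈ G.cells) {i j i' j' : Fin 4} (hi : Q.a i = Q'.a i') (hj : Q.a j = Q'.a j') (v : ℝ) :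
    Q.transfer (l Q) i j v = Q'.transfer (l Q') i' j' v := by
  by_cases hne : Q = Q'
  · subst hne
    rw [Q.vertex_injective hi, Q.vertex_injective hj]
  by_cases hij : i = j
  · subst hij
    have : i' = j' := Q'.vertex_injective (hi.symm.trans hj)
    subst this
    rw [Quad.transfer_self, Quad.transfer_self]
  have hmi : Q.a i ∈ Q.carrier ∩ Q'.carrier := ⟨Q.vertex_mem i, hi ▸ Q'.vertex_mem i'⟩
  have hmj : Q.a j ∈ Q.carrier ∩ Q'.carrier := ⟨Q.vertex_mem j, hj ▸ Q'.vertex_mem j'⟩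
  have hne' : Q.a i ≠ Q.a j := fun h => hij (Q.vertex_injective h)
  rcases G.conforming Q hQ Q' hQ' hne with h | ⟨k, k', hk, h⟩ | ⟨k, k', hk, h⟩
  · rw [h] at hmi; exact absurd hmi (Set.notMem_empty _)
  · rw [h] at hmi hmj
    exact absurd (hmi.trans hmj.symm) hne'
  · rw [h] at hmi hmj
    have hm := hl Q hQ Q' hQ' k k' hk
    have h1 : Q.transfer (l Q) i j v = 2 * l Q (Q.mid k) - v := by
      rcases Q.vertex_mem_edge hmi with rfl | rfl <;> rcases Q.vertex_mem_edge hmj with rfl | rfl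
      · exact absurd rfl hij
      · exact Q.transfer_succ _ _ _
      · exact Q.transfer_pred _ _ _
      · exact absurd rfl hij
    rw [hk] at hmi hmj
    rw [hi] at hmi
    rw [hj] at hmj
    have hij' : i' ≠ j' := fun h' => hne' (by rw [hi, hj, h'])
    rw [h1, hm]
    rcases Q'.vertex_mem_edge hmi with rfl | rfl <;> rcases Q'.vertex_mem_edge hmj with rfl | rfl
    · exact absurd rfl hij'
    · exact (Q'.transfer_succ _ _ _).symm
    · exact (Q'.transfer_pred _ _ _).symm
    · exact absurd rfl hij'

variable (G) in
/-- The points all of whose cells have `a` as a vertex. -/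
def star (a : Plane) : Set Plane := {x | ∀ Q ∈ G.cells, x ∈ Q.carrier → Q.IsVertex a}

theorem isOpen_star (a : Plane) : IsOpen (G.star a) := by
  rw [isOpen_iff_mem_nhds]
  intro x hx
  filter_upwards [G.eventually_mem_cells x] with y hy Q hQ hyQ
  exact hx Q hQ (hy Q hQ hyQ)

theorem inner_subset_star {Q : Quad} (hQ : Q ∈ G.cells) (i : Fin 4) : Q.inner ⊆ G.star (Q.a i) := by
  intro x hx Q' hQ' hx'
  rw [← G.eq_of_mem_inner hQ hQ' hx hx']
  exact ⟨i, rfl⟩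

theorem vertex_mem_star {Q : Quad} (hQ : Q ∈ G.cells) (i : Fin 4) : Q.a i ∈ G.star (Q.a i) :=
  fun _ hQ' hx' => G.isVertex_of_mem hQ hQ' ⟨i, rfl⟩ hx'

/-- The stars of the vertices cover Ω, and the transfers between vertices of a common cell are the
transition maps. In the flat section, `c a x` is the value at the vertex a as seen from the point x.
It is only locally constant in x; that it does not depend on x at all is a separate matter. -/
theorem exists_local_values (hl : G.EdgeMatching l) (ho : IsOpen Ω) (hs : IsSimplyConnected Ω)
    (a₀ x₀ : Plane) (hx₀Ω : x₀ ∈ Ω) (hx₀ : x₀ ∈ G.star a₀) :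
    ∃ c : Plane → Plane → ℝ, (∀ a, ∀ x ∈ Ω ∩ G.star a, ∀ᶠ y in 𝓝 x, c a y = c a x) ∧
      (∀ Q ∈ G.cells, ∀ i j, ∀ x ∈ Q.inner ∩ Ω,
        c (Q.a j) x = Q.transfer (l Q) i j (c (Q.a i) x)) ∧ c a₀ x₀ = 0 := by
  classical
  have := hs.simplyConnectedSpace
  have := ho.locallyPathConnectedSpace
  -- The default v serves pairs of vertices without a common cell. Their stars do not meet inside Ω,
  -- so no condition involves them.
  let T : Plane → Plane → ℝ → ℝ := fun a b v =>
    if h : ∃ p : Quad × Fin 4 × Fin 4, p.1 ∈ G.cells ∧ p.1.a p.2.1 = a ∧ p.1.a p.2.2 = b then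
      h.choose.1.transfer (l h.choose.1) h.choose.2.1 h.choose.2.2 v else v
  have hT : ∀ Q ∈ G.cells, ∀ i j v, T (Q.a i) (Q.a j) v = Q.transfer (l Q) i j v := by
    intro Q hQ i j v
    have h : ∃ p : Quad × Fin 4 × Fin 4, p.1 ∈ G.cells ∧ p.1.a p.2.1 = Q.a i ∧
      p.1.a p.2.2 = Q.a j := ⟨(Q, i, j), hQ, rfl, rfl⟩
    simp only [T, dif_pos h]
    exact hl.transfer_eq h.choose_spec.1 hQ h.choose_spec.2.1 h.choose_spec.2.2 v
  let U : Plane → Set Ω := fun a => {x | (x : Plane) ∈ G.star a}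
  have hcell : ∀ x : Ω, ∃ Q ∈ G.cells, (x : Plane) ∈ Q.carrier := fun x =>
    G.exists_cell (subset_closure x.2)
  obtain ⟨c, hc1, hc2, hc3⟩ := exists_flat_section U
    (fun a => (isOpen_star a).preimage continuous_subtype_val)
    (fun x => G.exists_common_vertex x) T
    (by
      rintro a ⟨x, hx⟩ v
      obtain ⟨Q, hQ, hxQ⟩ := hcell x
      obtain ⟨i, rfl⟩ := hx Q hQ hxQ
      rw [hT Q hQ, Quad.transfer_self])
    (by
      rintro a b d ⟨x, ⟨hxa, hxb⟩, hxd⟩ v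
      obtain ⟨Q, hQ, hxQ⟩ := hcell x
      obtain ⟨i, rfl⟩ := hxa Q hQ hxQ
      obtain ⟨j, rfl⟩ := hxb Q hQ hxQ
      obtain ⟨k, rfl⟩ := hxd Q hQ hxQ
      rw [hT Q hQ, hT Q hQ, hT Q hQ, Quad.transfer_transfer])
    a₀ ⟨x₀, hx₀Ω⟩ hx₀ 0
  let C : Plane → Plane → ℝ := fun a x => if h : x ∈ Ω then c a ⟨x, h⟩ else 0
  have hC : ∀ a x (h : x ∈ Ω), C a x = c a ⟨x, h⟩ := fun a x h => dif_pos h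
  refine ⟨C, ?_, ?_, ?_⟩
  · rintro a x ⟨hxΩ, hx⟩
    have h1 := hc1 a ⟨x, hxΩ⟩ hx
    rw [nhds_subtype_eq_comap, eventually_comap] at h1
    filter_upwards [h1, ho.mem_nhds hxΩ] with y hy hyΩ
    rw [hC a y hyΩ, hC a x hxΩ]
    exact hy ⟨y, hyΩ⟩ rfl
  · rintro Q hQ i j x ⟨hx, hxΩ⟩
    rw [hC _ x hxΩ, hC _ x hxΩ, hc2 (Q.a i) (Q.a j) ⟨x, hxΩ⟩
      ⟨inner_subset_star hQ i hx, inner_subset_star hQ j hx⟩, hT Q hQ]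
  · rw [hC _ x₀ hx₀Ω, hc3]

/-- The section is normalised to vanish at one end of a boundary edge. Zero averages then change
only the sign of the values along the boundary, and connectedness of the boundary spreads the zero
to all its vertices. -/
theorem exists_vertex_values (hl : G.EdgeMatching l) (ho : IsOpen Ω) (hs : IsSimplyConnected Ω)
    (hL : IsLipschitzDomain Ω)
    (hb : ∀ Q ∈ G.cells, ∀ i, Q.edge i ⊆ frontier Ω → l Q (Q.mid i) = 0) :
    ∃ W : Plane → ℝ,
      (∀ Q ∈ G.cells, ∀ i, (W (Q.a i) + W (Q.a (i + 1))) / 2 = l Q (Q.mid i)) ∧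
      ∀ Q ∈ G.cells, ∀ i, Q.a i ∈ frontier Ω → W (Q.a i) = 0 := by
  classical
  have hfne : (frontier Ω).Nonempty := by
    rw [nonempty_frontier_iff]
    refine ⟨hs.nonempty, fun h => ?_⟩
    exact NormedSpace.unbounded_univ ℝ Plane (h ▸ G.isBounded)
  obtain ⟨p, hp⟩ := hfne
  obtain ⟨Q₀, hQ₀, i₀, -, hE₀⟩ := G.exists_boundary_edge ho hL hp
  have hin : ∀ Q ∈ G.cells, Q.inner ⊆ Ω := fun Q hQ => G.inner_subset_domain ho hL hQ
  obtain ⟨c, hc1, hc2, hc3⟩ := exists_local_values hl ho hs (Q₀.a i₀) Q₀.diagCross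
    (hin Q₀ hQ₀ Q₀.center_mem_inner) (inner_subset_star hQ₀ i₀ Q₀.center_mem_inner)
  -- Two cells at a boundary vertex a might meet nowhere else. Local connectedness of Ω at a links
  -- them inside the star of a, where the value is locally constant.
  have key : ∀ a, ∃ w : ℝ, ∀ Q ∈ G.cells, Q.IsVertex a → ∀ x ∈ Q.inner, c a x = w := by
    intro a
    by_cases hex : ∃ Q ∈ G.cells, Q.IsVertex a
    swap
    · exact ⟨0, fun Q hQ hv => absurd ⟨Q, hQ, hv⟩ hex⟩
    obtain ⟨Q₁, hQ₁, i₁, rfl⟩ := hex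
    obtain ⟨S, hS, hSΩ, V, hV, hVS⟩ := hL.exists_preconnected ho
      (G.carrier_subset hQ₁ (Q₁.vertex_mem i₁))
      ((isOpen_star (G := G) (Q₁.a i₁)).mem_nhds (vertex_mem_star hQ₁ i₁))
    have hnear : ∀ Q ∈ G.cells, Q.IsVertex (Q₁.a i₁) → ∃ x ∈ Q.inner, x ∈ S := by
      intro Q hQ hv
      have hcl : Q₁.a i₁ ∈ closure Q.inner := by rw [Q.closure_inner]; exact hv.mem
      obtain ⟨x, hxV, hxQ⟩ := mem_closure_iff_nhds.1 hcl V hV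
      exact ⟨x, hxQ, hVS ⟨hin Q hQ hxQ, hxV⟩⟩
    obtain ⟨x₁, -, hx₁⟩ := hnear Q₁ hQ₁ ⟨i₁, rfl⟩
    refine ⟨c (Q₁.a i₁) x₁, fun Q hQ hv x hx => ?_⟩
    obtain ⟨y, hyQ, hyS⟩ := hnear Q hQ hv
    obtain ⟨j, hj⟩ := hv
    rw [IsPreconnected.eq_of_locally_constant Q.convex_inner.isPreconnected
      (fun z hz => hc1 _ z ⟨hin Q hQ hz, hj ▸ inner_subset_star hQ j hz⟩) hx hyQ]
    exact IsPreconnected.eq_of_locally_constant hS (fun z hz => hc1 _ z (hSΩ hz)) hyS hx₁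
  choose W hW using key
  have hsum : ∀ Q ∈ G.cells, ∀ i, (W (Q.a i) + W (Q.a (i + 1))) / 2 = l Q (Q.mid i) := by
    intro Q hQ i
    have h := hc2 Q hQ i (i + 1) Q.diagCross ⟨Q.center_mem_inner, hin Q hQ Q.center_mem_inner⟩
    rw [hW _ Q hQ ⟨i, rfl⟩ _ Q.center_mem_inner, hW _ Q hQ ⟨i + 1, rfl⟩ _ Q.center_mem_inner,
      Quad.transfer_succ] at h
    linarith
  have hW₀ : W (Q₀.a i₀) = 0 := by
    rw [← hW _ Q₀ hQ₀ ⟨i₀, rfl⟩ _ Q₀.center_mem_inner, hc3]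
  refine ⟨W, hsum, ?_⟩
  by_contra! hcon
  obtain ⟨Q₁, hQ₁, i₁, hf₁, hne₁⟩ := hcon
  have habs : ∀ Q ∈ G.cells, ∀ i, Q.edge i ⊆ frontier Ω → ∀ x ∈ Q.edge i, Q.IsVertex x →
      |W x| = |W (Q.a i)| := by
    rintro Q hQ i hE _ hx ⟨k, rfl⟩
    rcases Q.vertex_mem_edge hx with rfl | rfl
    · rfl
    · have h1 := hsum Q hQ i
      rw [hb Q hQ i hE] at h1
      rw [show W (Q.a (i + 1)) = -W (Q.a i) by linarith, abs_neg]
  let E : Set (Quad × Fin 4) := {p ∈ (G.cells ×ˢ Finset.univ : Finset (Quad × Fin 4)) |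
    p.1.edge p.2 ⊆ frontier Ω}
  have hEmem : ∀ Q ∈ G.cells, ∀ i, Q.edge i ⊆ frontier Ω → (Q, i) ∈ E := fun Q hQ i h =>
    ⟨by simpa using hQ, h⟩
  have hEc : ∀ p ∈ E, p.1 ∈ G.cells := fun p hp => by simpa using hp.1
  have hEfin : E.Finite := (Finset.finite_toSet _).subset fun p hp => hp.1
  -- The boundary edges are sorted by whether W vanishes at their first end, equivalently at both
  -- ends. If both classes occurred, connectedness would give a common point, which is a vertex
  -- unless the edges coincide; either way |W| would have to agree.
  let t : Set Plane := ⋃ p ∈ {p ∈ E | W (p.1.a p.2) = 0}, p.1.edge p.2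
  let t' : Set Plane := ⋃ p ∈ {p ∈ E | W (p.1.a p.2) ≠ 0}, p.1.edge p.2
  have ht : IsClosed t := (hEfin.subset fun p hp => hp.1).isClosed_biUnion
    fun p _ => p.1.isClosed_edge p.2
  have ht' : IsClosed t' := (hEfin.subset fun p hp => hp.1).isClosed_biUnion
    fun p _ => p.1.isClosed_edge p.2
  have hcov : frontier Ω ⊆ t ∪ t' := by
    intro x hx
    obtain ⟨Q, hQ, i, hxi, hE⟩ := G.exists_boundary_edge ho hL hx
    by_cases h0 : W (Q.a i) = 0
    · exact Or.inl (Set.mem_biUnion (x := (Q, i)) ⟨hEmem Q hQ i hE, h0⟩ hxi)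
    · exact Or.inr (Set.mem_biUnion (x := (Q, i)) ⟨hEmem Q hQ i hE, h0⟩ hxi)
  have hcon := isPreconnected_closed_iff.1 (isPreconnected_frontier ho hs G.isBounded) t t' ht ht'
    hcov ⟨Q₀.a i₀, hE₀ (Q₀.left_mem_edge i₀),
      Set.mem_biUnion (x := (Q₀, i₀)) ⟨hEmem Q₀ hQ₀ i₀ hE₀, hW₀⟩ (Q₀.left_mem_edge i₀)⟩ ?_
  · obtain ⟨x, hxf, hxt, hxt'⟩ := hcon
    simp only [t, t', Set.mem_iUnion] at hxt hxt'
    obtain ⟨⟨Q, i⟩, ⟨hp, h0⟩, hx⟩ := hxt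
    obtain ⟨⟨Q', j⟩, ⟨hp', h0'⟩, hx'⟩ := hxt'
    simp only at h0 h0' hx hx'
    have hQ := hEc _ hp
    have hQ' := hEc _ hp'
    rcases G.edge_eq_or_isVertex hQ hQ' hx hx' with h | ⟨hv, hv'⟩
    · have h1 := habs Q hQ i hp.2 (Q'.a j) (h ▸ Q'.left_mem_edge j)
        (G.isVertex_of_mem hQ' hQ ⟨j, rfl⟩ (Q.edge_subset i (h ▸ Q'.left_mem_edge j)))
      rw [h0, abs_zero, abs_eq_zero] at h1
      exact h0' h1
    · have h1 := habs Q hQ i hp.2 x hx hv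
      rw [habs Q' hQ' j hp'.2 x hx' hv', h0, abs_zero, abs_eq_zero] at h1
      exact h0' h1
  · obtain ⟨Q, hQ, i, hxi, hE⟩ := G.exists_boundary_edge ho hL hf₁
    refine ⟨Q₁.a i₁, hf₁, Set.mem_biUnion (x := (Q, i)) ⟨hEmem Q hQ i hE, ?_⟩ hxi⟩
    have h1 := habs Q hQ i hE _ hxi (G.isVertex_of_mem hQ₁ hQ ⟨i₁, rfl⟩ (Q.edge_subset i hxi))
    intro h0
    simp only at h0
    rw [h0, abs_zero, abs_eq_zero] at h1
    exact hne₁ h1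

end Subdivision

/-! ### The `L²` norm -/

section L2

variable {X : Type*} [MeasurableSpace X] {μ : Measure X} {f g : X → ℝ}

/-- The `L²` norm. -/
def l2norm (μ : Measure X) (f : X → ℝ) : ℝ := Real.sqrt (∫ x, f x ^ 2 ∂μ)

theorem l2norm_nonneg (μ : Measure X) (f : X → ℝ) : 0 ≤ l2norm μ f := Real.sqrt_nonneg _

theorem integral_sq_nonneg (μ : Measure X) (f : X → ℝ) : 0 ≤ ∫ x, f x ^ 2 ∂μ :=
  integral_nonneg fun _ => sq_nonneg _

theorem l2norm_sq (μ : Measure X) (f : X → ℝ) : l2norm μ f ^ 2 = ∫ x, f x ^ 2 ∂μ :=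
  Real.sq_sqrt (integral_sq_nonneg μ f)

theorem integrable_mul_of_memLp (hf : MemLp f 2 μ) (hg : MemLp g 2 μ) :
    Integrable (fun x => f x * g x) μ := hf.integrable_mul hg

/-- The integral of (f + t g)² is a quadratic polynomial in t without sign change, so its
discriminant is not positive. -/
theorem integral_mul_sq_le (hf : MemLp f 2 μ) (hg : MemLp g 2 μ) :
    (∫ x, f x * g x ∂μ) ^ 2 ≤ (∫ x, f x ^ 2 ∂μ) * ∫ x, g x ^ 2 ∂μ := by
  have h : ∀ t : ℝ, 0 ≤ (∫ x, g x ^ 2 ∂μ) * (t * t) + (2 * ∫ x, f x * g x ∂μ) * t +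
      ∫ x, f x ^ 2 ∂μ := by
    intro t
    have h1 : 0 ≤ ∫ x, (f x + t * g x) ^ 2 ∂μ := integral_nonneg fun _ => sq_nonneg _
    have h2 : ∀ x, (f x + t * g x) ^ 2 = f x ^ 2 + (2 * t * (f x * g x) + t ^ 2 * g x ^ 2) :=
      fun x => by ring
    simp only [h2] at h1
    have i1 := hf.integrable_sq
    have i2 := (integrable_mul_of_memLp hf hg).const_mul (2 * t)
    have i3 := hg.integrable_sq.const_mul (t ^ 2)
    have i23 : Integrable (fun x => 2 * t * (f x * g x) + t ^ 2 * g x ^ 2) μ := i2.add i3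
    rw [integral_add i1 i23, integral_add i2 i3, integral_const_mul,
      integral_const_mul] at h1
    linarith
  have := discrim_le_zero h
  unfold discrim at this
  nlinarith

theorem abs_integral_mul_le (hf : MemLp f 2 μ) (hg : MemLp g 2 μ) :
    |∫ x, f x * g x ∂μ| ≤ l2norm μ f * l2norm μ g := by
  refine abs_le_of_sq_le_sq ?_ (mul_nonneg (l2norm_nonneg _ _) (l2norm_nonneg _ _))
  rw [mul_pow, l2norm_sq, l2norm_sq]
  exact integral_mul_sq_le hf hg

theorem l2norm_add_le (hf : MemLp f 2 μ) (hg : MemLp g 2 μ) :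
    l2norm μ (fun x => f x + g x) ≤ l2norm μ f + l2norm μ g := by
  refine Real.sqrt_le_iff.2 ⟨add_nonneg (l2norm_nonneg _ _) (l2norm_nonneg _ _), ?_⟩
  have h2 : ∀ x, (f x + g x) ^ 2 = f x ^ 2 + (2 * (f x * g x) + g x ^ 2) := fun x => by ring
  simp only [h2]
  have i1 := hf.integrable_sq
  have i2 := (integrable_mul_of_memLp hf hg).const_mul 2
  have i3 := hg.integrable_sq
  have i23 : Integrable (fun x => 2 * (f x * g x) + g x ^ 2) μ := i2.add i3
  rw [integral_add i1 i23, integral_add i2 i3, integral_const_mul, add_sq, l2norm_sq,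
    l2norm_sq]
  have := le_of_abs_le (abs_integral_mul_le hf hg)
  linarith

theorem l2norm_neg : l2norm μ (fun x => -f x) = l2norm μ f := by
  unfold l2norm; simp

theorem l2norm_sub_comm : l2norm μ (fun x => f x - g x) = l2norm μ (fun x => g x - f x) := by
  rw [← l2norm_neg]; simp

theorem l2norm_const_mul (c : ℝ) : l2norm μ (fun x => c * f x) = |c| * l2norm μ f := by
  unfold l2norm
  simp only [mul_pow]
  rw [integral_const_mul, Real.sqrt_mul (sq_nonneg c), Real.sqrt_sq_eq_abs]

theorem l2norm_congr (h : f =ᵐ[μ] g) : l2norm μ f = l2norm μ g := by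
  unfold l2norm
  congr 1
  exact integral_congr_ae (h.mono fun x hx => by simp only [hx])

theorem l2norm_mono (hg : MemLp g 2 μ) (h : ∀ᵐ x ∂μ, |f x| ≤ |g x|) : l2norm μ f ≤ l2norm μ g := by
  refine Real.sqrt_le_sqrt ?_
  refine integral_mono_of_nonneg (Eventually.of_forall fun _ => sq_nonneg _) hg.integrable_sq ?_
  exact h.mono fun x hx => sq_le_sq.2 hx

theorem l2norm_triangle {h : X → ℝ} (hf : MemLp f 2 μ) (hg : MemLp g 2 μ) (hh : MemLp h 2 μ) :
    l2norm μ (fun x => f x - h x) ≤ l2norm μ (fun x => f x - g x) +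
      l2norm μ (fun x => g x - h x) := by
  have h1 := l2norm_add_le (hf.sub hg) (hg.sub hh)
  simp only [Pi.sub_apply, sub_add_sub_cancel] at h1
  exact h1

theorem l2norm_le_of_bound [IsFiniteMeasure μ] {B : ℝ} (hB : 0 ≤ B) (h : ∀ᵐ x ∂μ, |f x| ≤ B) :
    l2norm μ f ≤ B * Real.sqrt (μ.real Set.univ) := by
  have h1 : l2norm μ f ≤ l2norm μ (fun _ => B) :=
    l2norm_mono (memLp_const B) (h.mono fun x hx => hx.trans (le_abs_self B))
  refine h1.trans (le_of_eq ?_)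
  unfold l2norm
  rw [integral_const, smul_eq_mul, mul_comm, Real.sqrt_mul (sq_nonneg B), Real.sqrt_sq hB]

theorem tendsto_l2norm_iff {F : ℕ → X → ℝ} :
    Tendsto (fun n => l2norm μ (F n)) atTop (𝓝 0) ↔
      Tendsto (fun n => ∫ x, F n x ^ 2 ∂μ) atTop (𝓝 0) := by
  constructor
  · intro h
    have := h.pow 2
    simpa [l2norm_sq] using this
  · intro h
    have := h.sqrt
    simpa [l2norm] using this

end L2

/-! ### Weak derivatives -/

/-- The `k`-th unit vector. -/
abbrev unitVec (k : Fin 2) : Plane := EuclideanSpace.single k (1 : ℝ)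

theorem IsTestFunction.mono {U V : Set Plane} (h : V ⊆ U) {φ : Plane → ℝ}
    (hφ : IsTestFunction V φ) : IsTestFunction U φ := ⟨hφ.1, hφ.2.1, hφ.2.2.trans h⟩

theorem continuous_pderiv {φ : Plane → ℝ} (hφ : ContDiff ℝ 1 φ) (k : Fin 2) :
    Continuous (pderiv k φ) :=
  (hφ.continuous_fderiv one_ne_zero).clm_apply continuous_const

theorem contDiff_pderiv {φ : Plane → ℝ} (hφ : ContDiff ℝ ∞ φ) (k : Fin 2) :
    ContDiff ℝ ∞ (pderiv k φ) :=
  (hφ.fderiv_right (m := ∞) (by exact_mod_cast le_rfl)).clm_apply contDiff_const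

theorem IsTestFunction.continuous {U : Set Plane} {φ : Plane → ℝ} (hφ : IsTestFunction U φ) :
    Continuous φ := hφ.1.continuous

theorem IsTestFunction.pderiv {U : Set Plane} {φ : Plane → ℝ} (hφ : IsTestFunction U φ)
    (k : Fin 2) : IsTestFunction U (pderiv k φ) := by
  have hs : tsupport (QGB.pderiv k φ) ⊆ tsupport φ :=
    (tsupport_fderiv_apply_subset ℝ (unitVec k))
  exact ⟨contDiff_pderiv hφ.1 k, hφ.2.1.of_isClosed_subset (isClosed_tsupport _) hs, hs.trans hφ.2.2⟩

theorem IsTestFunction.eq_zero {U : Set Plane} {φ : Plane → ℝ} (hφ : IsTestFunction U φ)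
    {x : Plane} (hx : x ∉ U) : φ x = 0 :=
  image_eq_zero_of_notMem_tsupport fun h => hx (hφ.2.2 h)

theorem IsTestFunction.setIntegral_mul {U : Set Plane} {φ : Plane → ℝ} (hφ : IsTestFunction U φ)
    (f : Plane → ℝ) : ∫ x in U, f x * φ x = ∫ x, f x * φ x :=
  setIntegral_eq_integral_of_forall_compl_eq_zero fun x hx => by rw [hφ.eq_zero hx, mul_zero]

theorem IsTestFunction.memLp {U : Set Plane} {φ : Plane → ℝ} (hφ : IsTestFunction U φ)
    (μ : Measure Plane) [IsFiniteMeasureOnCompacts μ] : MemLp φ 2 μ :=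
  hφ.continuous.memLp_of_hasCompactSupport hφ.2.1

theorem IsWeakDeriv.mono {U V : Set Plane} (h : V ⊆ U) {k : Fin 2} {v g : Plane → ℝ}
    (hg : IsWeakDeriv U k v g) : IsWeakDeriv V k v g := by
  refine ⟨hg.1.mono_measure (Measure.restrict_mono h le_rfl), fun φ hφ => ?_⟩
  have h1 := hg.2 φ (hφ.mono h)
  rw [(hφ.mono h).setIntegral_mul, ((hφ.mono h).pderiv k).setIntegral_mul] at h1
  rw [hφ.setIntegral_mul, (hφ.pderiv k).setIntegral_mul, h1]

theorem IsWeakDeriv.congr {U : Set Plane} {k : Fin 2} {v v' g g' : Plane → ℝ}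
    (hg : IsWeakDeriv U k v g) (hv : v =ᵐ[volume.restrict U] v')
    (hg' : g =ᵐ[volume.restrict U] g') : IsWeakDeriv U k v' g' := by
  refine ⟨(memLp_congr_ae hg').1 hg.1, fun φ hφ => ?_⟩
  have h1 := hg.2 φ hφ
  rw [integral_congr_ae (hv.mono fun x hx => by simp only [hx] : (fun x => v x * pderiv k φ x)
    =ᵐ[volume.restrict U] fun x => v' x * pderiv k φ x),
    integral_congr_ae (hg'.mono fun x hx => by simp only [hx] : (fun x => g x * φ x)
    =ᵐ[volume.restrict U] fun x => g' x * φ x)] at h1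
  exact h1

theorem IsWeakDeriv.sub {U : Set Plane} {k : Fin 2} {v v' g g' : Plane → ℝ}
    (hg : IsWeakDeriv U k v g) (hg' : IsWeakDeriv U k v' g')
    (hv : MemLp v 2 (volume.restrict U)) (hv' : MemLp v' 2 (volume.restrict U)) :
    IsWeakDeriv U k (fun x => v x - v' x) (fun x => g x - g' x) := by
  refine ⟨hg.1.sub hg'.1, fun φ hφ => ?_⟩
  have m := hφ.memLp (volume.restrict U)
  have m' := (hφ.pderiv k).memLp (volume.restrict U)
  simp only [sub_mul]
  rw [integral_sub (integrable_mul_of_memLp hv m') (integrable_mul_of_memLp hv' m'),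
    integral_sub (integrable_mul_of_memLp hg.1 m) (integrable_mul_of_memLp hg'.1 m),
    hg.2 φ hφ, hg'.2 φ hφ]
  ring

theorem memLp_locallyIntegrableOn {U : Set Plane} {g : Plane → ℝ}
    (hg : MemLp g 2 (volume.restrict U)) : LocallyIntegrableOn g U := by
  refine LocallyIntegrableOn.mono_set (t := U) ?_ subset_rfl
  refine locallyIntegrableOn_of_locallyIntegrable_restrict ?_
  exact hg.locallyIntegrable (by norm_num)

/-- The fundamental lemma of the calculus of variations. It makes the choice in `wderiv` immaterial
up to null sets. -/
theorem IsWeakDeriv.ae_eq {U : Set Plane} (hU : IsOpen U) {k : Fin 2} {v g g' : Plane → ℝ}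
    (hg : IsWeakDeriv U k v g) (hg' : IsWeakDeriv U k v g') : g =ᵐ[volume.restrict U] g' := by
  have h := hU.ae_eq_zero_of_integral_contDiff_smul_eq_zero (μ := volume)
    (f := fun x => g x - g' x) (memLp_locallyIntegrableOn (hg.1.sub hg'.1)) ?_
  · rw [EventuallyEq, ae_restrict_iff' hU.measurableSet]
    exact h.mono fun x hx hxU => sub_eq_zero.1 (hx hxU)
  · intro φ h1 h2 h3
    have hφ : IsTestFunction U φ := ⟨h1, h2, h3⟩
    have m := hφ.memLp (volume.restrict U)
    have e := (hg.2 φ hφ).symm.trans (hg'.2 φ hφ)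
    simp only [smul_eq_mul, mul_comm (φ _)]
    rw [← hφ.setIntegral_mul]
    simp only [sub_mul]
    rw [integral_sub (integrable_mul_of_memLp hg.1 m) (integrable_mul_of_memLp hg'.1 m)]
    linarith

theorem MemH1.wderiv_spec {U : Set Plane} {v : Plane → ℝ} (hv : MemH1 U v) (k : Fin 2) :
    IsWeakDeriv U k v (wderiv U k v) := by
  unfold wderiv
  rw [dif_pos (hv.2 k)]
  exact (hv.2 k).choose_spec

theorem IsWeakDeriv.wderiv_spec {U : Set Plane} {k : Fin 2} {v g : Plane → ℝ}
    (hg : IsWeakDeriv U k v g) : IsWeakDeriv U k v (wderiv U k v) := by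
  have h : ∃ g, IsWeakDeriv U k v g := ⟨g, hg⟩
  unfold wderiv
  rw [dif_pos h]
  exact h.choose_spec

theorem IsWeakDeriv.wderiv_ae_eq {U : Set Plane} (hU : IsOpen U) {k : Fin 2} {v g : Plane → ℝ}
    (hg : IsWeakDeriv U k v g) : wderiv U k v =ᵐ[volume.restrict U] g :=
  hg.wderiv_spec.ae_eq hU hg

theorem MemH1.mono {U V : Set Plane} (h : V ⊆ U) {v : Plane → ℝ} (hv : MemH1 U v) : MemH1 V v :=
  ⟨hv.1.mono_measure (Measure.restrict_mono h le_rfl), fun k => ⟨_, (hv.wderiv_spec k).mono h⟩⟩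

theorem MemH1.congr {U : Set Plane} {v v' : Plane → ℝ} (hv : MemH1 U v)
    (h : v =ᵐ[volume.restrict U] v') : MemH1 U v' :=
  ⟨(memLp_congr_ae h).1 hv.1, fun k => ⟨_, (hv.wderiv_spec k).congr h (ae_eq_refl _)⟩⟩

theorem MemH1.wderiv_mono {U V : Set Plane} (hV : IsOpen V) (h : V ⊆ U) {v : Plane → ℝ}
    (hv : MemH1 U v) (k : Fin 2) : wderiv V k v =ᵐ[volume.restrict V] wderiv U k v :=
  ((hv.wderiv_spec k).mono h).wderiv_ae_eq hV

theorem MemH2.mono {U V : Set Plane} (hV : IsOpen V) (h : V ⊆ U) {v : Plane → ℝ}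
    (hv : MemH2 U v) : MemH2 V v :=
  ⟨hv.1.mono h, fun k => ((hv.2 k).mono h).congr (hv.1.wderiv_mono hV h k).symm⟩

theorem MemH2.wderiv_mono {U V : Set Plane} (hV : IsOpen V) (h : V ⊆ U) {v : Plane → ℝ}
    (hv : MemH2 U v) (k l : Fin 2) : wderiv V l (wderiv V k v) =ᵐ[volume.restrict V]
      wderiv U l (wderiv U k v) := by
  refine IsWeakDeriv.wderiv_ae_eq hV ?_
  exact (((hv.2 k).wderiv_spec l).mono h).congr (hv.1.wderiv_mono hV h k).symm (ae_eq_refl _)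

theorem integral_mul_pderiv {f φ : Plane → ℝ} (hf : ContDiff ℝ 1 f) (hφ : ContDiff ℝ 1 φ)
    (hc : HasCompactSupport φ) (k : Fin 2) :
    ∫ x, f x * pderiv k φ x = -∫ x, pderiv k f x * φ x := by
  have hcs : HasCompactSupport (pderiv k φ) :=
    hc.of_isClosed_subset (isClosed_tsupport _) (tsupport_fderiv_apply_subset ℝ (unitVec k))
  refine integral_mul_fderiv_eq_neg_fderiv_mul_of_integrable ?_ ?_ ?_
    (fun x _ => (hf.differentiable one_ne_zero) x) (fun x _ => (hφ.differentiable one_ne_zero) x)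
  · exact ((continuous_pderiv hf k).mul hφ.continuous).integrable_of_hasCompactSupport hc.mul_left
  · exact (hf.continuous.mul (continuous_pderiv hφ k)).integrable_of_hasCompactSupport hcs.mul_left
  · exact (hf.continuous.mul hφ.continuous).integrable_of_hasCompactSupport hc.mul_left

theorem Continuous.memLp_of_isBounded {f : Plane → ℝ} (hf : Continuous f) {U : Set Plane}
    (hU : Bornology.IsBounded U) : MemLp f 2 (volume.restrict U) := by
  obtain ⟨R, hR⟩ := hU.subset_closedBall 0
  have hK := isCompact_closedBall (0 : Plane) R
  have : IsFiniteMeasure (volume.restrict (Metric.closedBall (0 : Plane) R)) :=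
    ⟨by rw [Measure.restrict_apply_univ]; exact hK.measure_lt_top⟩
  obtain ⟨C, hC⟩ := hK.exists_bound_of_continuousOn hf.continuousOn
  have h : MemLp f 2 (volume.restrict (Metric.closedBall (0 : Plane) R)) :=
    MemLp.of_bound hf.aestronglyMeasurable C
      ((ae_restrict_iff' hK.isClosed.measurableSet).2 (Eventually.of_forall hC))
  exact h.mono_measure (Measure.restrict_mono hR le_rfl)

theorem isWeakDeriv_of_contDiff {f : Plane → ℝ} (hf : ContDiff ℝ 1 f) {U : Set Plane}
    (hU : Bornology.IsBounded U) (k : Fin 2) : IsWeakDeriv U k f (pderiv k f) := by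
  refine ⟨Continuous.memLp_of_isBounded (continuous_pderiv hf k) hU, fun φ hφ => ?_⟩
  rw [hφ.setIntegral_mul, (hφ.pderiv k).setIntegral_mul]
  exact integral_mul_pderiv hf (hφ.1.of_le (by exact_mod_cast le_top)) hφ.2.1 k

theorem memH1_of_contDiff {f : Plane → ℝ} (hf : ContDiff ℝ 1 f) {U : Set Plane}
    (hU : Bornology.IsBounded U) : MemH1 U f :=
  ⟨Continuous.memLp_of_isBounded hf.continuous hU, fun k => ⟨_, isWeakDeriv_of_contDiff hf hU k⟩⟩

theorem h1Tendsto_const {f : Plane → ℝ} (hf : ContDiff ℝ 1 f) {U : Set Plane} (hUo : IsOpen U)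
    (hU : Bornology.IsBounded U) : H1Tendsto U (fun _ => f) f := by
  refine ⟨by simp, fun k => ?_⟩
  have h := (isWeakDeriv_of_contDiff hf hU k).wderiv_ae_eq hUo
  have : ∫ x in U, (pderiv k f x - wderiv U k f x) ^ 2 = 0 := by
    rw [integral_congr_ae (g := fun _ => (0 : ℝ)) (h.mono fun x hx => by simp [hx])]
    simp
  simp [this]

theorem contDiff_affine (l : Plane →ᵃ[ℝ] ℝ) {n : WithTop ℕ∞} : ContDiff ℝ n l := by
  have : (l : Plane → ℝ) = fun x => l.linear.toContinuousLinearMap x + l 0 := by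
    ext x
    simpa using congrFun (AffineMap.decomp l) x
  rw [this]
  exact (ContinuousLinearMap.contDiff _).add contDiff_const

theorem pderiv_affine (l : Plane →ᵃ[ℝ] ℝ) (k : Fin 2) (x : Plane) :
    pderiv k l x = l.linear (unitVec k) := by
  have h : HasFDerivAt l l.linear.toContinuousLinearMap x := by
    have : (l : Plane → ℝ) = fun x => l.linear.toContinuousLinearMap x + l 0 := by
      ext x
      simpa using congrFun (AffineMap.decomp l) x
    rw [this]
    exact (ContinuousLinearMap.hasFDerivAt _).add_const _
  rw [pderiv, h.fderiv]
  rfl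

theorem H1Tendsto.congr_right {U : Set Plane} (hU : IsOpen U) {φ : ℕ → Plane → ℝ}
    {v v' : Plane → ℝ} (hv : MemH1 U v) (h : H1Tendsto U φ v) (he : v =ᵐ[volume.restrict U] v') :
    H1Tendsto U φ v' := by
  refine ⟨h.1.congr fun n => ?_, fun k => (h.2 k).congr fun n => ?_⟩
  · exact integral_congr_ae (he.mono fun x hx => by simp only [hx])
  · have h1 := (((hv.wderiv_spec k).congr he (ae_eq_refl _)).wderiv_ae_eq hU)
    exact integral_congr_ae (h1.mono fun x hx => by simp only [hx])

theorem integral_sq_tendsto_mono {U V : Set Plane} (h : V ⊆ U) {F : ℕ → Plane → ℝ}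
    (hF : ∀ n, MemLp (F n) 2 (volume.restrict U))
    (ht : Tendsto (fun n => ∫ x in U, F n x ^ 2) atTop (𝓝 0)) :
    Tendsto (fun n => ∫ x in V, F n x ^ 2) atTop (𝓝 0) := by
  refine squeeze_zero (fun n => integral_sq_nonneg _ _) (fun n => ?_) ht
  exact setIntegral_mono_set (hF n).integrable_sq (Eventually.of_forall fun x => sq_nonneg _)
    h.eventuallyLE

theorem H1Tendsto.mono {U V : Set Plane} (hV : IsOpen V) (h : V ⊆ U)
    (hU : Bornology.IsBounded U) {φ : ℕ → Plane → ℝ} {v : Plane → ℝ}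
    (hφ : ∀ n, ContDiff ℝ ∞ (φ n)) (hv : MemH1 U v) (ht : H1Tendsto U φ v) :
    H1Tendsto V φ v := by
  have h1 : ∀ n, ContDiff ℝ 1 (φ n) := fun n => (hφ n).of_le (by exact_mod_cast le_top)
  refine ⟨integral_sq_tendsto_mono h
    (fun n => (Continuous.memLp_of_isBounded (h1 n).continuous hU).sub hv.1) ht.1, fun k => ?_⟩
  refine (integral_sq_tendsto_mono h (fun n => (Continuous.memLp_of_isBounded
    (continuous_pderiv (h1 n) k) hU).sub (hv.wderiv_spec k).1) (ht.2 k)).congr fun n => ?_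
  exact integral_congr_ae ((hv.wderiv_mono hV h k).mono fun x hx => by
    simp only [hx, Pi.sub_apply])

/-! ### Affine parametrizations of the plane -/

section Param

variable (c p q : Plane)

/-- The affine parametrization `(s, t) ↦ c + s p + t q`. -/
def param (w : ℝ × ℝ) : Plane := c + w.1 • p + w.2 • q

@[fun_prop]
theorem continuous_param : Continuous (param c p q) := by unfold param; fun_prop

variable {c p q}

theorem param_injective (h : cross p q ≠ 0) : Function.Injective (param c p q) := by
  rintro ⟨s, t⟩ ⟨s', t'⟩ he
  have h1 : (s - s') • p + (t - t') • q = 0 := by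
    have := sub_eq_zero.2 he
    simp only [param] at this
    rw [← this]; module
  have h2 : (s - s') * cross p q = 0 := by
    have := congrArg (fun z => cross z q) h1
    simp only [cross_add_left, cross_smul_left, cross_self, mul_zero, add_zero] at this
    rw [this]; simp [cross]
  have h3 : (t - t') * cross p q = 0 := by
    have := congrArg (fun z => cross p z) h1
    simp only [cross_add_right, cross_smul_right, cross_self, mul_zero, zero_add] at this
    rw [this]; simp [cross]
  have h4 := (mul_eq_zero.1 h2).resolve_right h
  have h5 := (mul_eq_zero.1 h3).resolve_right h
  exact Prod.ext (sub_eq_zero.1 h4) (sub_eq_zero.1 h5)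

theorem measurableEmbedding_param (h : cross p q ≠ 0) : MeasurableEmbedding (param c p q) :=
  (continuous_param c p q).measurableEmbedding (param_injective h)

theorem map_param (h : cross p q ≠ 0) :
    Measure.map (param c p q) volume = ENNReal.ofReal |cross p q|⁻¹ • volume := by
  let f : Plane →ₗ[ℝ] Plane :=
    { toFun := fun w => w 0 • p + w 1 • q
      map_add' := fun w w' => by simp only [PiLp.add_apply]; module
      map_smul' := fun t w => by simp only [PiLp.smul_apply, smul_eq_mul, RingHom.id_apply]; module }
  have hdet : LinearMap.det f = cross p q := by
    rw [← LinearMap.det_toMatrix (EuclideanSpace.basisFun (Fin 2) ℝ).toBasis, Matrix.det_fin_two]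
    simp [LinearMap.toMatrix_apply, f, cross]
    ring
  have e1 : MeasurePreserving (fun w : ℝ × ℝ => (!₂[w.1, w.2] : Plane)) volume volume :=
    (PiLp.volume_preserving_toLp (Fin 2)).comp (volume_preserving_finTwoArrow ℝ).symm
  have hcomp : param c p q = (fun x => c + x) ∘ f ∘ fun w : ℝ × ℝ => (!₂[w.1, w.2] : Plane) := by
    ext1 w
    simp [param, f, add_assoc]
  have hf : Measurable f := (LinearMap.continuous_of_finiteDimensional f).measurable
  rw [hcomp, ← Measure.map_map (measurable_const_add c) (hf.comp e1.measurable),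
    ← Measure.map_map hf e1.measurable, e1.map_eq,
    Measure.map_linearMap_addHaar_eq_smul_addHaar volume (by rw [hdet]; exact h), hdet,
    Measure.map_smul, map_add_left_eq_self, abs_inv]

theorem integral_param (h : cross p q ≠ 0) (F : Plane → ℝ) :
    ∫ x, F x = |cross p q| * ∫ w, F (param c p q w) := by
  have h1 := (measurableEmbedding_param (c := c) h).integral_map (μ := volume) F
  rw [map_param h, integral_smul_measure] at h1
  rw [← h1, ENNReal.toReal_ofReal (by positivity), smul_eq_mul, ← mul_assoc,
    mul_inv_cancel₀ (abs_ne_zero.2 h), one_mul]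

end Param

/-! ### Averages over segments as integrals over triangles -/

/-- The substitution (r, t) ↦ (r, r t), with Jacobian r: r measures the progress from the apex to
the opposite side, t the position along that side. -/
theorem integral_triangle {F : ℝ × ℝ → ℝ} (hF : Continuous F) :
    ∫ w in {w : ℝ × ℝ | 0 < w.2 ∧ w.2 < w.1 ∧ w.1 < 1}, F w =
      ∫ r in (0 : ℝ)..1, ∫ t in (0 : ℝ)..1, r * F (r, r * t) := by
  have hm : MeasurableSet {w : ℝ × ℝ | 0 < w.2 ∧ w.2 < w.1 ∧ w.1 < 1} := by
    refine IsOpen.measurableSet ?_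
    exact (isOpen_lt continuous_const continuous_snd).inter
      ((isOpen_lt continuous_snd continuous_fst).inter (isOpen_lt continuous_fst continuous_const))
  have hsub : {w : ℝ × ℝ | 0 < w.2 ∧ w.2 < w.1 ∧ w.1 < 1} ⊆ Set.Icc 0 1 ×ˢ Set.Icc 0 1 := by
    rintro ⟨r, t⟩ ⟨h1, h2, h3⟩
    simp only at h1 h2 h3
    exact ⟨⟨by linarith, by linarith⟩, ⟨by linarith, by linarith⟩⟩
  have hinteg : IntegrableOn F {w : ℝ × ℝ | 0 < w.2 ∧ w.2 < w.1 ∧ w.1 < 1} :=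
    (hF.continuousOn.integrableOn_compact (isCompact_Icc.prod isCompact_Icc)).mono_set hsub
  rw [← integral_indicator hm, Measure.volume_eq_prod,
    integral_prod _ ((integrable_indicator_iff hm).2 hinteg),
    intervalIntegral.integral_of_le zero_le_one, integral_Ioc_eq_integral_Ioo,
    ← integral_indicator measurableSet_Ioo]
  congr 1
  ext r
  by_cases hr : r ∈ Set.Ioo (0 : ℝ) 1
  · rw [Set.indicator_of_mem hr, intervalIntegral.integral_const_mul]
    have h1 := intervalIntegral.smul_integral_comp_mul_left (a := 0) (b := 1)
      (f := fun t => F (r, t)) r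
    rw [smul_eq_mul, mul_zero, mul_one] at h1
    rw [h1, intervalIntegral.integral_of_le hr.1.le, integral_Ioc_eq_integral_Ioo,
      ← integral_indicator measurableSet_Ioo]
    congr 1
    ext t
    by_cases ht : t ∈ Set.Ioo 0 r
    · rw [Set.indicator_of_mem ht, Set.indicator_of_mem]
      exact ⟨ht.1, ht.2, hr.2⟩
    · rw [Set.indicator_of_notMem ht, Set.indicator_of_notMem]
      exact fun h => ht ⟨h.1, h.2.1⟩
  · rw [Set.indicator_of_notMem hr]
    convert integral_zero ℝ ℝ with t
    rw [Set.indicator_of_notMem]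
    rintro ⟨h1, h2, h3⟩
    exact hr ⟨h1.trans h2, h3⟩

/-- The open triangle with vertices `a`, `b`, `c`. -/
def openTri (a b c : Plane) : Set Plane :=
  param c (a - c) (b - a) '' {w : ℝ × ℝ | 0 < w.2 ∧ w.2 < w.1 ∧ w.1 < 1}

theorem fderiv_apply_eq {φ : Plane → ℝ} (x u : Plane) :
    fderiv ℝ φ x u = ∑ k, pderiv k φ x * u k := by
  have hu : u = ∑ k, u k • unitVec k := by
    ext j
    fin_cases j <;> simp [Fin.sum_univ_two]
  nth_rw 1 [hu]
  rw [map_sum]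
  exact Finset.sum_congr rfl fun k _ => by rw [map_smul, smul_eq_mul, mul_comm]; rfl

/-- This is the divergence theorem for the field φ(x)(x − c) on the triangle: its flux through the
two sides at c is zero. The right side makes sense for H¹ functions and is continuous in H¹, so edge
averages of traces need no further trace theorem. -/
theorem segMean_eq_integral {φ : Plane → ℝ} (hφ : ContDiff ℝ 1 φ) (a b c : Plane)
    (h : cross (a - c) (b - a) ≠ 0) :
    segMean a b φ = |cross (a - c) (b - a)|⁻¹ *
      ∫ x in openTri a b c, (2 * φ x + ∑ k, pderiv k φ x * (x - c) k) := by
  have hm : MeasurableSet {w : ℝ × ℝ | 0 < w.2 ∧ w.2 < w.1 ∧ w.1 < 1} := by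
    refine IsOpen.measurableSet ?_
    exact (isOpen_lt continuous_const continuous_snd).inter
      ((isOpen_lt continuous_snd continuous_fst).inter (isOpen_lt continuous_fst continuous_const))
  have hmT : MeasurableSet (openTri a b c) :=
    (measurableEmbedding_param h).measurableSet_image.2 hm
  have hdc := hφ.continuous_fderiv one_ne_zero
  have hφc := hφ.continuous
  simp only [← fderiv_apply_eq]
  rw [← integral_indicator hmT, integral_param (c := c) h, ← mul_assoc,
    inv_mul_cancel₀ (abs_ne_zero.2 h), one_mul]
  have h1 : ∀ w, (openTri a b c).indicator (fun x => 2 * φ x + fderiv ℝ φ x (x - c))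
      (param c (a - c) (b - a) w) = {w : ℝ × ℝ | 0 < w.2 ∧ w.2 < w.1 ∧ w.1 < 1}.indicator
      (fun w => 2 * φ (param c (a - c) (b - a) w) +
        fderiv ℝ φ (param c (a - c) (b - a) w) (param c (a - c) (b - a) w - c)) w := by
    intro w
    unfold openTri
    by_cases hw : w ∈ {w : ℝ × ℝ | 0 < w.2 ∧ w.2 < w.1 ∧ w.1 < 1}
    · rw [Set.indicator_of_mem hw, Set.indicator_of_mem (Set.mem_image_of_mem _ hw)]
    · rw [Set.indicator_of_notMem hw, Set.indicator_of_notMem]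
      rwa [(param_injective h).mem_set_image]
  simp only [h1]
  have hcF : Continuous (fun w => 2 * φ (param c (a - c) (b - a) w) +
      fderiv ℝ φ (param c (a - c) (b - a) w) (param c (a - c) (b - a) w - c)) := by
    have hp := continuous_param c (a - c) (b - a)
    exact (continuous_const.mul (hφc.comp hp)).add
      ((hdc.comp hp).clm_apply (hp.sub continuous_const))
  rw [integral_indicator hm, integral_triangle hcF]
  have hsw : ∫ r in (0 : ℝ)..1, ∫ t in (0 : ℝ)..1,
      r * (2 * φ (param c (a - c) (b - a) (r, r * t)) +
        fderiv ℝ φ (param c (a - c) (b - a) (r, r * t))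
          (param c (a - c) (b - a) (r, r * t) - c)) =
      ∫ t in (0 : ℝ)..1, ∫ r in (0 : ℝ)..1,
      r * (2 * φ (param c (a - c) (b - a) (r, r * t)) +
        fderiv ℝ φ (param c (a - c) (b - a) (r, r * t))
          (param c (a - c) (b - a) (r, r * t) - c)) := by
    refine intervalIntegral_intervalIntegral_swap ?_
    refine IntegrableOn.mono_set (t := Set.Icc 0 1 ×ˢ Set.Icc 0 1) ?_ ?_
    · refine ContinuousOn.integrableOn_compact (isCompact_Icc.prod isCompact_Icc) ?_
      have hq : Continuous fun w : ℝ × ℝ => ((w.1, w.1 * w.2) : ℝ × ℝ) := by fun_prop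
      exact (continuous_fst.mul (hcF.comp hq)).continuousOn
    · rw [Set.uIoc_of_le zero_le_one]
      exact Set.prod_mono Set.Ioc_subset_Icc_self Set.Ioc_subset_Icc_self
  rw [hsw]
  unfold segMean
  refine intervalIntegral.integral_congr fun t _ => ?_
  set y : Plane := AffineMap.lineMap a b t
  have hy : ∀ r : ℝ, param c (a - c) (b - a) (r, r * t) = c + r • (y - c) := by
    intro r
    simp only [param, y, AffineMap.lineMap_apply, vsub_eq_sub, vadd_eq_add]
    module
  simp only [hy, add_sub_cancel_left]
  -- Along the ray from c to a point y of the side, the integrand, with its factor r, is the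
  -- derivative of r² φ(c + r(y − c)), which runs from 0 to φ(y).
  have hder : ∀ r : ℝ, HasDerivAt (fun r : ℝ => r ^ 2 * φ (c + r • (y - c)))
      (r * (2 * φ (c + r • (y - c)) + fderiv ℝ φ (c + r • (y - c)) (r • (y - c)))) r := by
    intro r
    have h2 : HasDerivAt (fun r : ℝ => c + r • (y - c)) (y - c) r := by
      have := ((hasDerivAt_id r).smul_const (y - c)).const_add c
      simpa using this
    have h3 := ((hφ.differentiable one_ne_zero) (c + r • (y - c))).hasFDerivAt.comp_hasDerivAt r h2
    have h4 := (hasDerivAt_pow 2 r).mul h3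
    refine h4.congr_deriv ?_
    rw [map_smul, smul_eq_mul]
    simp
    ring
  rw [intervalIntegral.integral_eq_sub_of_hasDerivAt (fun r _ => hder r)]
  · simp
  · refine Continuous.intervalIntegrable ?_ _ _
    fun_prop

theorem affine_param (l : Plane →ᵃ[ℝ] ℝ) (a b c : Plane) (w : ℝ × ℝ) :
    l (param c (a - c) (b - a) w) = l c + w.1 * (l a - l c) + w.2 * (l b - l a) := by
  have h : ∀ u v : Plane, l (u + v) = l u + l.linear v := fun u v => by
    rw [add_comm u v, ← vadd_eq_add, l.map_vadd, vadd_eq_add, add_comm]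
  have h2 : ∀ u v : Plane, l.linear (u - v) = l u - l v := fun u v => by
    have := h v (u - v)
    rw [add_sub_cancel] at this
    linarith
  unfold param
  rw [h, h, map_smul, map_smul, h2, h2, smul_eq_mul, smul_eq_mul]

theorem volume_affine_zero {l : Plane →ᵃ[ℝ] ℝ} (hl : ∃ x, l x ≠ 0) :
    volume {x | l x = 0} = 0 := by
  have h := Measure.addHaar_affineSubspace (volume : Measure Plane)
    (AffineSubspace.comap l (AffineSubspace.mk' 0 ⊥)) (by
      obtain ⟨x, hx⟩ := hl
      intro h
      have : x ∈ AffineSubspace.comap l (AffineSubspace.mk' 0 ⊥) := h ▸ AffineSubspace.mem_top ℝ _ x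
      rw [AffineSubspace.mem_comap, AffineSubspace.mem_mk'] at this
      simp at this
      exact hx this)
  convert h using 2
  ext x
  simp [AffineSubspace.mem_mk']

/-! ### The open triangles cut from a cell by its diagonals. -/

namespace Quad

variable (Q : Quad)

/-- The open triangle cut from the cell by the diagonals at the edge `eᵢ`. -/
def tri (i : Fin 4) : Set Plane := openTri (Q.a i) (Q.a (i + 1)) Q.diagCross

theorem cross_tri_pos (i : Fin 4) : 0 < cross (Q.a i - Q.diagCross) (Q.a (i + 1) - Q.a i) := by
  have h := Q.side_center_pos i
  rw [side_apply] at h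
  rwa [cross_swap, ← cross_neg_right, neg_sub]

theorem baryAff_succ_left (i : Fin 4) : Q.baryAff (i + 1) (Q.a i) = 0 := by
  have := Q.baryAff_pred (i + 1)
  rwa [show i + 1 + 3 = i by fin_cases i <;> rfl] at this

theorem mem_tri_iff {i : Fin 4} {x : Plane} : x ∈ Q.tri i ↔ 0 < Q.baryAff i x ∧
    0 < Q.baryAff (i + 1) x ∧ Q.baryAff i x + Q.baryAff (i + 1) x < 1 := by
  constructor
  · rintro ⟨⟨r, t⟩, ⟨h1, h2, h3⟩, rfl⟩
    simp only at h1 h2 h3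
    rw [affine_param, affine_param]
    simp only [baryAff_center, baryAff_self, baryAff_succ, baryAff_succ_left]
    refine ⟨by linarith, by linarith, by linarith⟩
  · rintro ⟨h1, h2, h3⟩
    refine ⟨(Q.baryAff i x + Q.baryAff (i + 1) x, Q.baryAff (i + 1) x), ⟨h2, ?_, h3⟩, ?_⟩
    · simp only; linarith
    · have h := Q.sub_eq_baryAff i x
      rw [sub_eq_iff_eq_add] at h
      refine Eq.trans ?_ h.symm
      unfold param
      module

theorem isOpen_tri (i : Fin 4) : IsOpen (Q.tri i) := by
  have : Q.tri i = {x | 0 < Q.baryAff i x} ∩ ({x | 0 < Q.baryAff (i + 1) x} ∩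
      {x | Q.baryAff i x + Q.baryAff (i + 1) x < 1}) := by
    ext x; exact Q.mem_tri_iff
  rw [this]
  exact (isOpen_lt continuous_const (Q.continuous_baryAff i)).inter
    ((isOpen_lt continuous_const (Q.continuous_baryAff _)).inter
    (isOpen_lt ((Q.continuous_baryAff i).add (Q.continuous_baryAff _)) continuous_const))

theorem bary_of_mem_tri {i : Fin 4} {x : Plane} (hx : x ∈ Q.tri i) :
    Q.bary (i + 2) x = 0 ∧ Q.bary (i + 3) x = 0 ∧ Q.bary i x = Q.baryAff i x ∧
      Q.bary (i + 1) x = Q.baryAff (i + 1) x := by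
  obtain ⟨h1, h2, h3⟩ := Q.mem_tri_iff.1 hx
  have h4 := (Q.baryAff_pos_iff_opp_neg (i + 1) x).1 h2
  rw [show i + 1 + 2 = i + 3 by fin_cases i <;> rfl] at h4
  exact ⟨max_eq_left ((Q.baryAff_pos_iff_opp_neg i x).1 h1).le, max_eq_left h4.le,
    max_eq_right h1.le, max_eq_right h2.le⟩

theorem tri_subset (i : Fin 4) : Q.tri i ⊆ Q.inner := by
  intro x hx
  obtain ⟨h1, h2, h3, h4⟩ := Q.bary_of_mem_tri hx
  rw [mem_inner_iff, Q.gauge_eq_of_sector h1 h2, h3, h4]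
  exact (Q.mem_tri_iff.1 hx).2.2

/-- Only points on the two diagonals are lost, and they form a null set. -/
theorem ae_mem_tri : ∀ᵐ x ∂(volume.restrict Q.inner), ∃ i, x ∈ Q.tri i := by
  have hz : ∀ i, ∀ᵐ x ∂(volume : Measure Plane), Q.baryAff i x ≠ 0 := by
    intro i
    have := volume_affine_zero (l := Q.baryAff i) ⟨Q.a i, by rw [baryAff_self]; exact one_ne_zero⟩
    rw [ae_iff]
    simpa using this
  rw [ae_restrict_iff' Q.isOpen_inner.measurableSet]
  filter_upwards [hz 0, hz 1] with x h0 h1 hx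
  rw [mem_inner_iff] at hx
  obtain ⟨i, h2, h3⟩ := Q.exists_sector x
  rw [Q.gauge_eq_of_sector h2 h3, Q.bary_eq_of_opp i x h2, Q.bary_eq_of_opp (i + 1) x
    (by rwa [show i + 1 + 2 = i + 3 by fin_cases i <;> rfl])] at hx
  have hn : ∀ j, Q.baryAff j x ≠ 0 := by
    have key : ∀ j, Q.baryAff j x ≠ 0 → Q.baryAff (j + 2) x ≠ 0 := by
      intro j hj h
      have := Q.turn_mul_baryAff j x
      rw [h, mul_zero, neg_zero] at this
      exact hj ((mul_eq_zero.1 this).resolve_left (Q.turn_pos _).ne')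
    intro j
    fin_cases j
    exacts [h0, h1, key 0 h0, key 1 h1]
  have e1 := Q.bary_eq_of_opp i x h2
  have e2 := Q.bary_eq_of_opp (i + 1) x (by rwa [show i + 1 + 2 = i + 3 by fin_cases i <;> rfl])
  refine ⟨i, Q.mem_tri_iff.2 ⟨?_, ?_, hx⟩⟩
  · exact lt_of_le_of_ne (e1 ▸ Q.bary_nonneg i x) (hn i).symm
  · exact lt_of_le_of_ne (e2 ▸ Q.bary_nonneg (i + 1) x) (hn (i + 1)).symm

theorem isBounded_inner : Bornology.IsBounded Q.inner :=
  Q.isCompact_carrier.isBounded.subset Q.inner_subset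

end Quad

/-! ### Traces -/

theorem tendsto_setIntegral_mul {U T : Set Plane} (hT : T ⊆ U) {F : ℕ → Plane → ℝ}
    {f w : Plane → ℝ} (hF : ∀ n, MemLp (F n) 2 (volume.restrict U))
    (hf : MemLp f 2 (volume.restrict U)) (hw : MemLp w 2 (volume.restrict U))
    (h : Tendsto (fun n => ∫ x in U, (F n x - f x) ^ 2) atTop (𝓝 0)) :
    Tendsto (fun n => ∫ x in T, F n x * w x) atTop (𝓝 (∫ x in T, f x * w x)) := by
  have hle := Measure.restrict_mono hT (le_refl (volume : Measure Plane))
  have h1 := integral_sq_tendsto_mono hT (F := fun n x => F n x - f x)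
    (fun n => (hF n).sub hf) h
  rw [← tendsto_l2norm_iff] at h1
  rw [tendsto_iff_norm_sub_tendsto_zero]
  refine squeeze_zero (fun n => norm_nonneg _) (fun n => ?_) (by
    have := h1.mul_const (l2norm (volume.restrict T) w)
    rwa [zero_mul] at this)
  have m1 := (hF n).mono_measure hle
  have m2 := hf.mono_measure hle
  have m3 := hw.mono_measure hle
  rw [← integral_sub (integrable_mul_of_memLp m1 m3) (integrable_mul_of_memLp m2 m3)]
  simp only [← sub_mul]
  exact abs_integral_mul_le (m1.sub m2) m3

theorem memLp_coord {U : Set Plane} (hU : Bornology.IsBounded U) (c : Plane) (k : Fin 2) :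
    MemLp (fun x : Plane => (x - c) k) 2 (volume.restrict U) :=
  Continuous.memLp_of_isBounded (by fun_prop) hU

theorem contDiff_one {φ : Plane → ℝ} (hφ : ContDiff ℝ ∞ φ) : ContDiff ℝ 1 φ :=
  hφ.of_le (by exact_mod_cast le_top)

theorem segMean_affine (l : Plane →ᵃ[ℝ] ℝ) (a b : Plane) : segMean a b l = (l a + l b) / 2 := by
  unfold segMean
  simp only [segment_comp_affine]
  rw [intervalIntegral.integral_add (by simp) (by
    exact Continuous.intervalIntegrable (by fun_prop) _ _), intervalIntegral.integral_const,
    intervalIntegral.integral_mul_const, integral_id]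
  simp
  ring

namespace Quad

variable (Q : Quad)

/-- The average over the edge `eᵢ` of the trace of `v`, as an integral over the cell; `g` are the
derivatives of `v`. -/
def traceVal (i : Fin 4) (v : Plane → ℝ) (g : Fin 2 → Plane → ℝ) : ℝ :=
  |cross (Q.a i - Q.diagCross) (Q.a (i + 1) - Q.a i)|⁻¹ *
    ((∫ x in Q.tri i, v x * 2) + ∑ k, ∫ x in Q.tri i, g k x * (x - Q.diagCross) k)

theorem isBounded_tri (i : Fin 4) : Bornology.IsBounded (Q.tri i) :=
  Q.isBounded_inner.subset (Q.tri_subset i)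

theorem segMean_edge {φ : Plane → ℝ} (hφ : ContDiff ℝ 1 φ) (i : Fin 4) :
    segMean (Q.a i) (Q.a (i + 1)) φ = Q.traceVal i φ (fun k => pderiv k φ) := by
  rw [segMean_eq_integral hφ (Q.a i) (Q.a (i + 1)) Q.diagCross (Q.cross_tri_pos i).ne', traceVal]
  congr 1
  have hb := Q.isBounded_tri i
  have hfin : IsFiniteMeasure (volume.restrict (Q.tri i)) :=
    ⟨by rw [Measure.restrict_apply_univ]; exact hb.measure_lt_top⟩
  have m1 := Continuous.memLp_of_isBounded hφ.continuous hb
  have m2 : ∀ k, Integrable (fun x => pderiv k φ x * (x - Q.diagCross) k)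
      (volume.restrict (Q.tri i)) := fun k => integrable_mul_of_memLp
    (Continuous.memLp_of_isBounded (continuous_pderiv hφ k) hb) (memLp_coord hb _ k)
  have m3 := integrable_mul_of_memLp m1 (memLp_const 2)
  rw [← integral_finsetSum _ fun k _ => m2 k, ← integral_add m3 (integrable_finsetSum _
    fun k _ => m2 k)]
  simp only [mul_comm (2 : ℝ)]
  rfl

theorem traceVal_congr (i : Fin 4) {v v' : Plane → ℝ} {g g' : Fin 2 → Plane → ℝ}
    (hv : v =ᵐ[volume.restrict (Q.tri i)] v')
    (hg : ∀ k, g k =ᵐ[volume.restrict (Q.tri i)] g' k) :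
    Q.traceVal i v g = Q.traceVal i v' g' := by
  unfold traceVal
  congr 2
  · exact integral_congr_ae (hv.mono fun x hx => by simp only [hx])
  · exact Finset.sum_congr rfl fun k _ =>
      integral_congr_ae ((hg k).mono fun x hx => by simp only [hx])

/-- The limit is expressed through v alone, so it is the same for all approximating sequences. Hence
`HasTraceMean` determines its value, and any choice made in `traceMean` is correct. -/
theorem tendsto_segMean {v : Plane → ℝ} (hv : MemH1 Q.inner v) {φ : ℕ → Plane → ℝ}
    (hφ : ∀ n, ContDiff ℝ ∞ (φ n)) (h : H1Tendsto Q.inner φ v) (i : Fin 4) :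
    Tendsto (fun n => segMean (Q.a i) (Q.a (i + 1)) (φ n)) atTop
      (𝓝 (Q.traceVal i v fun k => wderiv Q.inner k v)) := by
  have hb := Q.isBounded_inner
  have hfin : IsFiniteMeasure (volume.restrict Q.inner) :=
    ⟨by rw [Measure.restrict_apply_univ]; exact hb.measure_lt_top⟩
  simp only [Q.segMean_edge (contDiff_one (hφ _)) i, traceVal]
  refine Tendsto.const_mul _ (Tendsto.add ?_ (tendsto_finsetSum _ fun k _ => ?_))
  · exact tendsto_setIntegral_mul (Q.tri_subset i)
      (fun n => Continuous.memLp_of_isBounded (hφ n).continuous hb) hv.1 (memLp_const 2) h.1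
  · exact tendsto_setIntegral_mul (Q.tri_subset i)
      (fun n => Continuous.memLp_of_isBounded (continuous_pderiv (contDiff_one (hφ n)) k) hb)
      (hv.wderiv_spec k).1 (memLp_coord hb _ k) (h.2 k)

theorem edgeMean_eq_traceVal {v : Plane → ℝ} {i : Fin 4} {t : ℝ}
    (h : HasTraceMean Q.inner (Q.a i) (Q.a (i + 1)) v t) :
    Q.edgeMean i v = Q.traceVal i v fun k => wderiv Q.inner k v := by
  have hex : ∃ t, HasTraceMean Q.inner (Q.a i) (Q.a (i + 1)) v t := ⟨t, h⟩
  unfold edgeMean traceMean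
  rw [dif_pos hex]
  obtain ⟨h1, φ, hφ, h2, h3⟩ := hex.choose_spec
  exact tendsto_nhds_unique h3 (Q.tendsto_segMean h1 hφ h2 i)

theorem edgeMean_eq {v : Plane → ℝ} {i : Fin 4} {t : ℝ}
    (h : HasTraceMean Q.inner (Q.a i) (Q.a (i + 1)) v t) : Q.edgeMean i v = t := by
  rw [Q.edgeMean_eq_traceVal h]
  obtain ⟨h1, φ, hφ, h2, h3⟩ := h
  exact tendsto_nhds_unique (Q.tendsto_segMean h1 hφ h2 i) h3

/-- The existence of a trace average is itself invariant under a.e. equality, so the default value 0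
is also taken simultaneously. -/
theorem edgeMean_congr {v v' : Plane → ℝ} (i : Fin 4) (h : v =ᵐ[volume.restrict Q.inner] v') :
    Q.edgeMean i v = Q.edgeMean i v' := by
  have key : ∀ v v' : Plane → ℝ, v =ᵐ[volume.restrict Q.inner] v' → ∀ t,
      HasTraceMean Q.inner (Q.a i) (Q.a (i + 1)) v t →
        HasTraceMean Q.inner (Q.a i) (Q.a (i + 1)) v' t := by
    rintro v v' h t ⟨h1, φ, hφ, h2, h3⟩
    exact ⟨h1.congr h, φ, hφ, h2.congr_right Q.isOpen_inner h1 h, h3⟩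
  by_cases hex : ∃ t, HasTraceMean Q.inner (Q.a i) (Q.a (i + 1)) v t
  · obtain ⟨t, ht⟩ := hex
    rw [Q.edgeMean_eq ht, Q.edgeMean_eq (key v v' h t ht)]
  · have hex' : ¬ ∃ t, HasTraceMean Q.inner (Q.a i) (Q.a (i + 1)) v' t :=
      fun ⟨t, ht⟩ => hex ⟨t, key v' v h.symm t ht⟩
    unfold edgeMean traceMean
    rw [dif_neg hex, dif_neg hex']

theorem edgeMean_of_contDiff {f : Plane → ℝ} (hf : ContDiff ℝ ∞ f) (i : Fin 4) :
    Q.edgeMean i f = segMean (Q.a i) (Q.a (i + 1)) f :=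
  Q.edgeMean_eq ⟨memH1_of_contDiff (contDiff_one hf) Q.isBounded_inner, fun _ => f, fun _ => hf,
    h1Tendsto_const (contDiff_one hf) Q.isOpen_inner Q.isBounded_inner, tendsto_const_nhds⟩

theorem edgeMean_affine (l : Plane →ᵃ[ℝ] ℝ) (i : Fin 4) : Q.edgeMean i l = l (Q.mid i) := by
  rw [Q.edgeMean_of_contDiff (contDiff_affine l), segMean_affine, mid, affine_midpoint]

theorem hasTraceMean_of_memH10 {Ω : Set Plane} (hΩ : Bornology.IsBounded Ω) (hQ : Q.inner ⊆ Ω)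
    {v : Plane → ℝ} (hv : MemH10 Ω v) : ∃ φ : ℕ → Plane → ℝ, (∀ n, IsTestFunction Ω (φ n)) ∧
      H1Tendsto Q.inner φ v ∧ ∀ i, Tendsto (fun n => segMean (Q.a i) (Q.a (i + 1)) (φ n)) atTop
        (𝓝 (Q.edgeMean i v)) := by
  obtain ⟨hv1, φ, hφ, ht⟩ := hv
  have h1 := ht.mono Q.isOpen_inner hQ hΩ (fun n => (hφ n).1) hv1
  have h2 := hv1.mono hQ
  refine ⟨φ, hφ, h1, fun i => ?_⟩
  have h3 := Q.tendsto_segMean h2 (fun n => (hφ n).1) h1 i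
  rwa [Q.edgeMean_eq ⟨h2, φ, fun n => (hφ n).1, h1, h3⟩]

/-- If a function in `H¹₀` is affine next to an edge, its edge average is that of the affine
function. -/
theorem edgeMean_of_affine_tri {Ω : Set Plane} (hΩ : Bornology.IsBounded Ω) (hQ : Q.inner ⊆ Ω)
    {v : Plane → ℝ} (hv : MemH10 Ω v) {i : Fin 4} {l : Plane →ᵃ[ℝ] ℝ}
    (hl : v =ᵐ[volume.restrict (Q.tri i)] l) : Q.edgeMean i v = l (Q.mid i) := by
  obtain ⟨φ, hφ, h1, h2⟩ := Q.hasTraceMean_of_memH10 hΩ hQ hv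
  have hv2 := hv.1.mono hQ
  rw [Q.edgeMean_eq_traceVal ⟨hv2, φ, fun n => (hφ n).1, h1, h2 i⟩,
    ← Q.edgeMean_affine l i, Q.edgeMean_of_contDiff (contDiff_affine l),
    Q.segMean_edge (contDiff_affine l)]
  -- The integral formula for the average over an edge involves only the triangle at that edge.
  refine Q.traceVal_congr i hl fun k => ?_
  have e1 := hv2.wderiv_mono (Q.isOpen_tri i) (Q.tri_subset i) k
  refine e1.symm.trans ?_
  have hb := Q.isBounded_tri i
  refine IsWeakDeriv.wderiv_ae_eq (Q.isOpen_tri i) ?_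
  exact (isWeakDeriv_of_contDiff (contDiff_affine l) hb k).congr hl.symm (ae_eq_refl _)

end Quad

/-! ### Shape functions -/

theorem segMean_add_const_mul_sq (l m n : Plane →ᵃ[ℝ] ℝ) (c : ℝ) (a b : Plane) :
    segMean a b (fun x => l x + c * (m x ^ 2 - n x ^ 2)) = (l a + l b) / 2 +
      c * ((m a ^ 2 + m a * m b + m b ^ 2) / 3 - (n a ^ 2 + n a * n b + n b ^ 2) / 3) := by
  unfold segMean
  simp only [segment_comp_affine]
  have h : ∀ t : ℝ, HasDerivAt (fun t : ℝ => l a * t + t ^ 2 / 2 * (l b - l a) +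
      c * ((m a ^ 2 * t + m a * (m b - m a) * t ^ 2 + (m b - m a) ^ 2 * (t ^ 3 / 3)) -
        (n a ^ 2 * t + n a * (n b - n a) * t ^ 2 + (n b - n a) ^ 2 * (t ^ 3 / 3))))
      (l a + t * (l b - l a) + c * ((m a + t * (m b - m a)) ^ 2 - (n a + t * (n b - n a)) ^ 2))
      t := by
    intro t
    have h1 := hasDerivAt_id t
    have h2 := hasDerivAt_pow 2 t
    have h3 := hasDerivAt_pow 3 t
    have k1 := (h1.const_mul (l a)).add ((h2.div_const 2).mul_const (l b - l a))
    have k2 := ((h1.const_mul (m a ^ 2)).add (h2.const_mul (m a * (m b - m a)))).add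
      ((h3.div_const 3).const_mul ((m b - m a) ^ 2))
    have k3 := ((h1.const_mul (n a ^ 2)).add (h2.const_mul (n a * (n b - n a)))).add
      ((h3.div_const 3).const_mul ((n b - n a) ^ 2))
    refine (k1.add ((k2.sub k3).const_mul c)).congr_deriv ?_
    norm_num only [Nat.cast_ofNat]
    ring
  rw [intervalIntegral.integral_eq_sub_of_hasDerivAt (fun t _ => h t)
    (Continuous.intervalIntegrable (by fun_prop) _ _)]
  ring

theorem abs_cross_le (u v : Plane) : |cross u v| ≤ ‖u‖ * ‖v‖ := by
  rw [EuclideanSpace.norm_eq, EuclideanSpace.norm_eq, ← Real.sqrt_mul (by positivity)]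
  refine Real.abs_le_sqrt ?_
  simp only [cross, Fin.sum_univ_two, Real.norm_eq_abs, sq_abs]
  nlinarith [sq_nonneg (u 0 * v 0 + u 1 * v 1)]

namespace Quad

variable (Q : Quad)

/-- The Jacobian of the cell coordinates. -/
def jac : ℝ := cross Q.r Q.s

theorem O_eq : Q.O = (4 : ℝ)⁻¹ • (Q.a 0 + Q.a 1 + Q.a 2 + Q.a 3) := by
  have : Q.mid 2 = midpoint ℝ (Q.a 2) (Q.a 3) := rfl
  have h0 : Q.mid 0 = midpoint ℝ (Q.a 0) (Q.a 1) := rfl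
  rw [O, this, h0, midpoint_eq_smul_add, midpoint_eq_smul_add, midpoint_eq_smul_add]
  simp only [invOf_eq_inv]
  module

theorem r_eq : Q.r = (4 : ℝ)⁻¹ • ((Q.a 2 - Q.a 0) + (Q.a 3 - Q.a 1)) := by
  have : Q.mid 2 = midpoint ℝ (Q.a 2) (Q.a 3) := rfl
  rw [r, this, O_eq, midpoint_eq_smul_add]
  simp only [invOf_eq_inv]
  module

theorem s_eq : Q.s = (4 : ℝ)⁻¹ • ((Q.a 3 - Q.a 1) - (Q.a 2 - Q.a 0)) := by
  have : Q.mid 3 = midpoint ℝ (Q.a 3) (Q.a 0) := rfl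
  rw [s, this, O_eq, midpoint_eq_smul_add]
  simp only [invOf_eq_inv]
  module

theorem jac_eq : Q.jac = Q.area2 / 8 := by
  have h := Q.cross_diag 0
  change cross (Q.a 2 - Q.a 0) (Q.a 3 - Q.a 1) = _ at h
  rw [jac, r_eq, s_eq, ← h]
  simp [cross]
  ring

theorem jac_pos : 0 < Q.jac := by rw [jac_eq]; linarith [Q.area2_pos]

/-- `ξ` as an affine function. -/
def xiAff : Plane →ᵃ[ℝ] ℝ := (-Q.jac⁻¹) • crossAffine Q.s Q.O

/-- `η` as an affine function. -/
def etaAff : Plane →ᵃ[ℝ] ℝ := Q.jac⁻¹ • crossAffine Q.r Q.O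

theorem xiAff_apply (x : Plane) : Q.xiAff x = Q.ξ x := by
  change -Q.jac⁻¹ * cross Q.s (x - Q.O) = _
  rw [ξ, cross_swap, div_eq_inv_mul]; simp [jac]

theorem etaAff_apply (x : Plane) : Q.etaAff x = Q.η x := by
  change Q.jac⁻¹ * cross Q.r (x - Q.O) = _
  rw [η, div_eq_inv_mul]; simp [jac]

theorem xiAff_linear (u : Plane) : Q.xiAff.linear u = cross u Q.s / Q.jac := by
  change -Q.jac⁻¹ * cross Q.s u = _
  rw [cross_swap, div_eq_inv_mul]; ring

theorem etaAff_linear (u : Plane) : Q.etaAff.linear u = cross Q.r u / Q.jac := by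
  change Q.jac⁻¹ * cross Q.r u = _
  rw [div_eq_inv_mul]

theorem sub_O_eq (x : Plane) : x = Q.O + Q.ξ x • Q.r + Q.η x • Q.s := by
  have h := cross_smul_eq Q.r Q.s (x - Q.O)
  have h2 := Q.jac_pos.ne'
  unfold jac at h2
  have h3 : x - Q.O = Q.ξ x • Q.r + Q.η x • Q.s := by
    refine smul_right_injective Plane h2 ?_
    beta_reduce
    rw [h, smul_add, smul_smul, smul_smul, ξ, η, mul_div_cancel₀ _ h2, mul_div_cancel₀ _ h2]
  rw [add_assoc, ← h3]; abel

theorem ξ_combo (a b : ℝ) : Q.ξ (Q.O + a • Q.r + b • Q.s) = a := by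
  have h2 := Q.jac_pos.ne'
  unfold jac at h2
  rw [ξ, add_assoc, add_sub_cancel_left, cross_add_left, cross_smul_left, cross_smul_left,
    cross_self]
  field_simp; ring

theorem η_combo (a b : ℝ) : Q.η (Q.O + a • Q.r + b • Q.s) = b := by
  have h2 := Q.jac_pos.ne'
  unfold jac at h2
  rw [η, add_assoc, add_sub_cancel_left, cross_add_right, cross_smul_right, cross_smul_right,
    cross_self]
  field_simp; ring

theorem mid_zero : Q.mid 0 = Q.O + (-1 : ℝ) • Q.r + (0 : ℝ) • Q.s := by
  have h0 : Q.mid 0 = midpoint ℝ (Q.a 0) (Q.a 1) := rfl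
  rw [O_eq, r_eq, h0, midpoint_eq_smul_add]; simp only [invOf_eq_inv]; module

theorem mid_one : Q.mid 1 = Q.O + (0 : ℝ) • Q.r + (-1 : ℝ) • Q.s := by
  have h0 : Q.mid 1 = midpoint ℝ (Q.a 1) (Q.a 2) := rfl
  rw [O_eq, s_eq, h0, midpoint_eq_smul_add]; simp only [invOf_eq_inv]; module

theorem mid_two : Q.mid 2 = Q.O + (1 : ℝ) • Q.r + (0 : ℝ) • Q.s := by
  simp [r]

theorem mid_three : Q.mid 3 = Q.O + (0 : ℝ) • Q.r + (1 : ℝ) • Q.s := by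
  simp [s]

theorem affine_expand (l : Plane →ᵃ[ℝ] ℝ) (x : Plane) :
    l x = (l (Q.mid 0) + l (Q.mid 2)) / 2 + (l (Q.mid 2) - l (Q.mid 0)) / 2 * Q.ξ x +
      (l (Q.mid 3) - l (Q.mid 1)) / 2 * Q.η x := by
  have h : ∀ u v : Plane, l (u + v) = l u + l.linear v := fun u v => by
    rw [add_comm u v, ← vadd_eq_add, l.map_vadd, vadd_eq_add, add_comm]
  have e : ∀ a b : ℝ, l (Q.O + a • Q.r + b • Q.s) = l Q.O + a * l.linear Q.r +
      b * l.linear Q.s := fun a b => by rw [h, h, map_smul, map_smul, smul_eq_mul, smul_eq_mul]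
  rw [mid_zero, mid_one, mid_two, mid_three, e, e, e, e]
  nth_rw 1 [Q.sub_O_eq x]
  rw [e]; ring

/-- The midpoints of the edges form a parallelogram. This is the single linear relation that keeps
four edge averages from being attained by affine functions. -/
theorem affine_mid_alternating (l : Plane →ᵃ[ℝ] ℝ) :
    l (Q.mid 0) - l (Q.mid 1) + l (Q.mid 2) - l (Q.mid 3) = 0 := by
  simp only [mid, affine_midpoint]
  change (l (Q.a 0) + l (Q.a 1)) / 2 - (l (Q.a 1) + l (Q.a 2)) / 2 +
    (l (Q.a 2) + l (Q.a 3)) / 2 - (l (Q.a 3) + l (Q.a 0)) / 2 = 0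
  ring

/-- The cell coordinates of the vertices. -/
theorem vertex_coords : ∃ α β : ℝ, |α| < 1 ∧ |β| < 1 ∧
    (Q.ξ (Q.a 0) = -1 + α ∧ Q.ξ (Q.a 1) = -1 - α ∧ Q.ξ (Q.a 2) = 1 + α ∧ Q.ξ (Q.a 3) = 1 - α) ∧
    (Q.η (Q.a 0) = 1 + β ∧ Q.η (Q.a 1) = -1 - β ∧ Q.η (Q.a 2) = -1 + β ∧ Q.η (Q.a 3) = 1 - β) := by
  have hm : ∀ (l : Plane →ᵃ[ℝ] ℝ), l (Q.mid 0) = (l (Q.a 0) + l (Q.a 1)) / 2 ∧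
      l (Q.mid 1) = (l (Q.a 1) + l (Q.a 2)) / 2 ∧ l (Q.mid 2) = (l (Q.a 2) + l (Q.a 3)) / 2 ∧
      l (Q.mid 3) = (l (Q.a 3) + l (Q.a 0)) / 2 := fun l =>
    ⟨affine_midpoint _ _ _, affine_midpoint _ _ _, affine_midpoint _ _ _, affine_midpoint _ _ _⟩
  obtain ⟨x0, x1, x2, x3⟩ := hm Q.xiAff
  obtain ⟨y0, y1, y2, y3⟩ := hm Q.etaAff
  simp only [xiAff_apply, etaAff_apply] at x0 x1 x2 x3 y0 y1 y2 y3
  rw [mid_zero, ξ_combo] at x0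
  rw [mid_one, ξ_combo] at x1
  rw [mid_two, ξ_combo] at x2
  rw [mid_three, ξ_combo] at x3
  rw [mid_zero, η_combo] at y0
  rw [mid_one, η_combo] at y1
  rw [mid_two, η_combo] at y2
  rw [mid_three, η_combo] at y3
  -- In cell coordinates the four turns are 4J(1 ± α ± β) with J the Jacobian and all sign
  -- combinations. Strict convexity therefore bounds α and β by one in absolute value.
  have hturn : ∀ u v w : Plane, cross (v - u) (w - v) = Q.jac *
      ((Q.ξ v - Q.ξ u) * (Q.η w - Q.η v) - (Q.η v - Q.η u) * (Q.ξ w - Q.ξ v)) := by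
    intro u v w
    have h2 := Q.jac_pos.ne'
    have h3 : Q.jac * cross (v - u) (w - v) = cross (v - u) Q.s * cross Q.r (w - v) -
        cross Q.r (v - u) * cross (w - v) Q.s := by
      unfold jac; simp [cross]; ring
    have e1 : ∀ u v : Plane, Q.jac * (Q.ξ v - Q.ξ u) = cross (v - u) Q.s := fun u v => by
      unfold ξ jac; unfold jac at h2
      rw [← sub_div, mul_div_cancel₀ _ h2, ← cross_sub_left, sub_sub_sub_cancel_right]
    have e2 : ∀ u v : Plane, Q.jac * (Q.η v - Q.η u) = cross Q.r (v - u) := fun u v => by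
      unfold η jac; unfold jac at h2
      rw [← sub_div, mul_div_cancel₀ _ h2, ← cross_sub_right, sub_sub_sub_cancel_right]
    rw [← e1, ← e1, ← e2, ← e2] at h3
    refine mul_left_cancel₀ h2 ?_
    rw [h3]; ring
  have t0 : 0 < cross (Q.a 1 - Q.a 0) (Q.a 2 - Q.a 1) := Q.convex 0
  have t1 : 0 < cross (Q.a 2 - Q.a 1) (Q.a 3 - Q.a 2) := Q.convex 1
  have t2 : 0 < cross (Q.a 3 - Q.a 2) (Q.a 0 - Q.a 3) := Q.convex 2
  have t3 : 0 < cross (Q.a 0 - Q.a 3) (Q.a 1 - Q.a 0) := Q.convex 3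
  rw [hturn] at t0 t1 t2 t3
  have t0 := pos_of_mul_pos_right t0 Q.jac_pos.le
  have t1 := pos_of_mul_pos_right t1 Q.jac_pos.le
  have t2 := pos_of_mul_pos_right t2 Q.jac_pos.le
  have t3 := pos_of_mul_pos_right t3 Q.jac_pos.le
  set α := Q.ξ (Q.a 2) - 1 with hα
  set β := Q.η (Q.a 2) + 1 with hβ
  have a0 : Q.ξ (Q.a 0) = -1 + α := by linarith
  have a1 : Q.ξ (Q.a 1) = -1 - α := by linarith
  have a2 : Q.ξ (Q.a 2) = 1 + α := by linarith
  have a3 : Q.ξ (Q.a 3) = 1 - α := by linarith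
  have b0 : Q.η (Q.a 0) = 1 + β := by linarith
  have b1 : Q.η (Q.a 1) = -1 - β := by linarith
  have b2 : Q.η (Q.a 2) = -1 + β := by linarith
  have b3 : Q.η (Q.a 3) = 1 - β := by linarith
  rw [a0, a1, a2, b0, b1, b2] at t0
  rw [a1, a2, a3, b1, b2, b3] at t1
  rw [a2, a3, a0, b2, b3, b0] at t2
  rw [a3, a0, a1, b3, b0, b1] at t3
  refine ⟨α, β, abs_lt.2 ⟨by nlinarith, by nlinarith⟩, abs_lt.2 ⟨by nlinarith, by nlinarith⟩,
    ⟨a0, a1, a2, a3⟩, ⟨b0, b1, b2, b3⟩⟩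

theorem abs_coord_vertex_le (i : Fin 4) : |Q.ξ (Q.a i)| ≤ 2 ∧ |Q.η (Q.a i)| ≤ 2 := by
  obtain ⟨α, β, hα, hβ, ⟨a0, a1, a2, a3⟩, b0, b1, b2, b3⟩ := Q.vertex_coords
  have hα := abs_lt.1 hα
  have hβ := abs_lt.1 hβ
  simp only [abs_le]
  fin_cases i <;> simp only [Fin.zero_eta, Fin.mk_one, Fin.reduceFinMk, a0, a1, a2, a3, b0, b1,
    b2, b3] <;> refine ⟨⟨?_, ?_⟩, ⟨?_, ?_⟩⟩ <;> linarith

theorem abs_coord_le {x : Plane} (hx : x ∈ Q.carrier) : |Q.ξ x| ≤ 2 ∧ |Q.η x| ≤ 2 := by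
  have key : ∀ l : Plane →ᵃ[ℝ] ℝ, (∀ i, |l (Q.a i)| ≤ 2) → |l x| ≤ 2 := by
    intro l hl
    have hconv : Convex ℝ (l ⁻¹' Set.Icc (-2) 2) := (convex_Icc (-2 : ℝ) 2).affine_preimage l
    have hsub : Q.carrier ⊆ l ⁻¹' Set.Icc (-2) 2 := by
      refine convexHull_min ?_ hconv
      rintro _ ⟨i, rfl⟩
      exact abs_le.1 (hl i)
    exact abs_le.2 (hsub hx)
  have h1 := key Q.xiAff fun i => by rw [xiAff_apply]; exact (Q.abs_coord_vertex_le i).1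
  have h2 := key Q.etaAff fun i => by rw [etaAff_apply]; exact (Q.abs_coord_vertex_le i).2
  rw [xiAff_apply] at h1
  rw [etaAff_apply] at h2
  exact ⟨h1, h2⟩

/-- The average of `ξ² - η²` over the edge `eᵢ`. -/
def quadMean (i : Fin 4) : ℝ :=
  (Q.ξ (Q.a i) ^ 2 + Q.ξ (Q.a i) * Q.ξ (Q.a (i + 1)) + Q.ξ (Q.a (i + 1)) ^ 2) / 3 -
    (Q.η (Q.a i) ^ 2 + Q.η (Q.a i) * Q.η (Q.a (i + 1)) + Q.η (Q.a (i + 1)) ^ 2) / 3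

/-- The alternating sum annihilates affine functions but not ξ² − η², and its value there does not
depend on the shape of the cell. This gives unisolvence, and the factor 3 / 8 in `shapeCoef`. -/
theorem quadMean_alternating :
    Q.quadMean 0 - Q.quadMean 1 + Q.quadMean 2 - Q.quadMean 3 = 8 / 3 := by
  obtain ⟨α, β, -, -, ⟨a0, a1, a2, a3⟩, b0, b1, b2, b3⟩ := Q.vertex_coords
  unfold quadMean
  simp only [zero_add, Fin.reduceAdd, a0, a1, a2, a3, b0, b1, b2, b3]
  ring

theorem abs_quadMean_le (i : Fin 4) : |Q.quadMean i| ≤ 4 := by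
  obtain ⟨h1, h2⟩ := Q.abs_coord_vertex_le i
  obtain ⟨h3, h4⟩ := Q.abs_coord_vertex_le (i + 1)
  have key : ∀ a b : ℝ, |a| ≤ 2 → |b| ≤ 2 → 0 ≤ (a ^ 2 + a * b + b ^ 2) / 3 ∧
      (a ^ 2 + a * b + b ^ 2) / 3 ≤ 4 := by
    intro a b ha hb
    have ha := abs_le.1 ha
    have hb := abs_le.1 hb
    constructor
    · nlinarith [sq_nonneg (a + b), sq_nonneg a, sq_nonneg b]
    · nlinarith [sq_nonneg (a - b), mul_nonneg (sub_nonneg.2 ha.2) (neg_le_iff_add_nonneg.1 ha.1),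
        mul_nonneg (sub_nonneg.2 hb.2) (neg_le_iff_add_nonneg.1 hb.1)]
  have k1 := key _ _ h1 h3
  have k2 := key _ _ h2 h4
  unfold quadMean
  rw [abs_le]; constructor <;> linarith

theorem edgeMean_shapeFn (l : Plane →ᵃ[ℝ] ℝ) (c : ℝ) (i : Fin 4) :
    Q.edgeMean i (fun x => l x + c * (Q.ξ x ^ 2 - Q.η x ^ 2)) = l (Q.mid i) + c * Q.quadMean i := by
  have h : (fun x => l x + c * (Q.ξ x ^ 2 - Q.η x ^ 2)) =
      fun x => l x + c * (Q.xiAff x ^ 2 - Q.etaAff x ^ 2) := by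
    ext x; rw [xiAff_apply, etaAff_apply]
  have hs : ContDiff ℝ ∞ (fun x => l x + c * (Q.xiAff x ^ 2 - Q.etaAff x ^ 2)) :=
    (contDiff_affine l).add (contDiff_const.mul (((contDiff_affine Q.xiAff).pow 2).sub
      ((contDiff_affine Q.etaAff).pow 2)))
  rw [h, Q.edgeMean_of_contDiff hs, segMean_add_const_mul_sq, mid, affine_midpoint]
  simp only [xiAff_apply, etaAff_apply]
  rfl

/-- The quadratic coefficient of the shape function with edge averages `μ`. -/
def shapeCoef (μ : Fin 4 → ℝ) : ℝ := 3 / 8 * (μ 0 - μ 1 + μ 2 - μ 3)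

/-- The edge averages of the affine part of the shape function with edge averages `μ`. -/
def shapeRest (μ : Fin 4 → ℝ) (i : Fin 4) : ℝ := μ i - shapeCoef μ * Q.quadMean i

/-- The affine part of the shape function with edge averages `μ`. -/
def shapeAff (μ : Fin 4 → ℝ) : Plane →ᵃ[ℝ] ℝ :=
  AffineMap.const ℝ Plane ((Q.shapeRest μ 0 + Q.shapeRest μ 2) / 2) +
    ((Q.shapeRest μ 2 - Q.shapeRest μ 0) / 2) • Q.xiAff +
      ((Q.shapeRest μ 3 - Q.shapeRest μ 1) / 2) • Q.etaAff

theorem shapeAff_apply (μ : Fin 4 → ℝ) (x : Plane) :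
    Q.shapeAff μ x = (Q.shapeRest μ 0 + Q.shapeRest μ 2) / 2 +
      (Q.shapeRest μ 2 - Q.shapeRest μ 0) / 2 * Q.ξ x +
      (Q.shapeRest μ 3 - Q.shapeRest μ 1) / 2 * Q.η x := by
  simp [shapeAff, xiAff_apply, etaAff_apply]

theorem shapeRest_alternating (μ : Fin 4 → ℝ) :
    Q.shapeRest μ 0 - Q.shapeRest μ 1 + Q.shapeRest μ 2 - Q.shapeRest μ 3 = 0 := by
  have h := Q.quadMean_alternating
  unfold shapeRest shapeCoef
  linear_combination -(3 / 8 * (μ 0 - μ 1 + μ 2 - μ 3)) * h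

theorem shapeAff_mid (μ : Fin 4 → ℝ) (i : Fin 4) : Q.shapeAff μ (Q.mid i) = Q.shapeRest μ i := by
  have h := Q.shapeRest_alternating μ
  rw [shapeAff_apply]
  fin_cases i
  · simp only [Fin.zero_eta, mid_zero, ξ_combo, η_combo]; ring
  · simp only [Fin.mk_one, mid_one, ξ_combo, η_combo]; linarith
  · simp only [Fin.reduceFinMk, mid_two, ξ_combo, η_combo]; ring
  · simp only [Fin.reduceFinMk, mid_three, ξ_combo, η_combo]; linarith

/-- The shape function with edge averages `μ`. -/
def shape (μ : Fin 4 → ℝ) (x : Plane) : ℝ :=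
  Q.shapeAff μ x + shapeCoef μ * (Q.ξ x ^ 2 - Q.η x ^ 2)

theorem edgeMean_shape (μ : Fin 4 → ℝ) (i : Fin 4) : Q.edgeMean i (Q.shape μ) = μ i := by
  have := Q.edgeMean_shapeFn (Q.shapeAff μ) (shapeCoef μ) i
  rw [shapeAff_mid, shapeRest] at this
  unfold shape
  rw [this]; ring

theorem eq_shape {p : Plane → ℝ} (hp : Q.IsShapeFn p) {μ : Fin 4 → ℝ}
    (h : ∀ i, Q.edgeMean i p = μ i) : p = Q.shape μ := by
  obtain ⟨l, c, hl⟩ := hp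
  have hl' : p = fun x => l x + c * (Q.ξ x ^ 2 - Q.η x ^ 2) := funext hl
  have h1 : ∀ i, l (Q.mid i) + c * Q.quadMean i = μ i := fun i => by
    rw [← h i, hl', edgeMean_shapeFn]
  have hc : c = shapeCoef μ := by
    have e1 := Q.quadMean_alternating
    have e2 := Q.affine_mid_alternating l
    unfold shapeCoef
    rw [← h1 0, ← h1 1, ← h1 2, ← h1 3]
    linear_combination (-3 / 8) * e2 - 3 / 8 * c * e1
  have hr : ∀ i, l (Q.mid i) = Q.shapeRest μ i := fun i => by
    have := h1 i
    rw [hc] at this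
    unfold shapeRest; linarith
  ext x
  rw [hl, shape, hc, shapeAff_apply, Q.affine_expand l x, hr, hr, hr, hr]

theorem interp_eq_shape (v : Plane → ℝ) : Q.interp v = Q.shape fun i => Q.edgeMean i v := by
  have h : ∃ p, Q.IsShapeFn p ∧ ∀ i, Q.edgeMean i p = Q.edgeMean i v :=
    ⟨Q.shape fun i => Q.edgeMean i v, ⟨_, _, fun x => rfl⟩, fun i => Q.edgeMean_shape _ i⟩
  unfold interp
  rw [dif_pos h]
  exact Q.eq_shape h.choose_spec.1 h.choose_spec.2

theorem shape_of_affine (l : Plane →ᵃ[ℝ] ℝ) : Q.shape (fun i => l (Q.mid i)) = l := by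
  refine (Q.eq_shape ⟨l, 0, fun x => by simp⟩ fun i => ?_).symm
  exact Q.edgeMean_affine l i

theorem shape_sub (μ ν : Fin 4 → ℝ) (x : Plane) :
    Q.shape (fun i => μ i - ν i) x = Q.shape μ x - Q.shape ν x := by
  unfold shape
  rw [shapeAff_apply, shapeAff_apply, shapeAff_apply]
  unfold shapeRest shapeCoef
  ring

theorem contDiff_shape (μ : Fin 4 → ℝ) : ContDiff ℝ ∞ (Q.shape μ) := by
  have h : Q.shape μ = fun x => Q.shapeAff μ x +
      shapeCoef μ * (Q.xiAff x ^ 2 - Q.etaAff x ^ 2) := by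
    ext x; rw [xiAff_apply, etaAff_apply]; rfl
  rw [h]
  exact (contDiff_affine _).add (contDiff_const.mul (((contDiff_affine Q.xiAff).pow 2).sub
      ((contDiff_affine Q.etaAff).pow 2)))

theorem hasFDerivAt_affine (l : Plane →ᵃ[ℝ] ℝ) (x : Plane) :
    HasFDerivAt l l.linear.toContinuousLinearMap x := by
  have : (l : Plane → ℝ) = fun x => l.linear.toContinuousLinearMap x + l 0 := by
    ext x
    simpa using congrFun (AffineMap.decomp l) x
  rw [this]
  exact (ContinuousLinearMap.hasFDerivAt _).add_const _

theorem pderiv_shape (μ : Fin 4 → ℝ) (k : Fin 2) (x : Plane) :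
    pderiv k (Q.shape μ) x =
      ((Q.shapeRest μ 2 - Q.shapeRest μ 0) / 2 + 2 * shapeCoef μ * Q.ξ x) *
        (cross (unitVec k) Q.s / Q.jac) +
      ((Q.shapeRest μ 3 - Q.shapeRest μ 1) / 2 - 2 * shapeCoef μ * Q.η x) *
        (cross Q.r (unitVec k) / Q.jac) := by
  have h : Q.shape μ = fun x => (Q.shapeRest μ 0 + Q.shapeRest μ 2) / 2 +
      ((Q.shapeRest μ 2 - Q.shapeRest μ 0) / 2 * Q.xiAff x +
      (Q.shapeRest μ 3 - Q.shapeRest μ 1) / 2 * Q.etaAff x +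
      shapeCoef μ * (Q.xiAff x ^ 2 - Q.etaAff x ^ 2)) := by
    ext x; rw [xiAff_apply, etaAff_apply, shape, shapeAff_apply]; ring
  have hx := hasFDerivAt_affine Q.xiAff x
  have hy := hasFDerivAt_affine Q.etaAff x
  have hd := (((hx.const_mul ((Q.shapeRest μ 2 - Q.shapeRest μ 0) / 2)).add
    (hy.const_mul ((Q.shapeRest μ 3 - Q.shapeRest μ 1) / 2))).add
    (((hx.pow 2).sub (hy.pow 2)).const_mul (shapeCoef μ))).const_add
      ((Q.shapeRest μ 0 + Q.shapeRest μ 2) / 2)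
  have e1 : Q.xiAff.linear (EuclideanSpace.single k (1 : ℝ)) = cross (unitVec k) Q.s / Q.jac :=
    Q.xiAff_linear _
  have e2 : Q.etaAff.linear (EuclideanSpace.single k (1 : ℝ)) = cross Q.r (unitVec k) / Q.jac :=
    Q.etaAff_linear _
  rw [pderiv, h]
  erw [hd.fderiv]
  simp [xiAff_apply, etaAff_apply, e1, e2]
  ring

/-- Averages bounded by M force a quadratic coefficient of at most 3M/2, and averages of the affine
part of at most M + 4 · 3M/2 = 7M. With |ξ|, |η| ≤ 2 the derivatives with respect to ξ and η are at
most 7M + 6M = 13M. The gradients of ξ and η have length |s| / J and |r| / J. -/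
theorem abs_pderiv_shape_le {μ : Fin 4 → ℝ} {M : ℝ} (hμ : ∀ i, |μ i| ≤ M) (k : Fin 2) {x : Plane}
    (hx : x ∈ Q.carrier) : |pderiv k (Q.shape μ) x| ≤ 13 * M * ((‖Q.r‖ + ‖Q.s‖) / Q.jac) := by
  have hJ := Q.jac_pos
  have hM : 0 ≤ M := (abs_nonneg _).trans (hμ 0)
  obtain ⟨hξ, hη⟩ := Q.abs_coord_le hx
  have hc : |shapeCoef μ| ≤ 3 / 2 * M := by
    have h0 := abs_le.1 (hμ 0)
    have h1 := abs_le.1 (hμ 1)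
    have h2 := abs_le.1 (hμ 2)
    have h3 := abs_le.1 (hμ 3)
    unfold shapeCoef
    rw [abs_le]; constructor <;> linarith
  have hr : ∀ i, |Q.shapeRest μ i| ≤ 7 * M := fun i => by
    unfold shapeRest
    have h1 := abs_mul (shapeCoef μ) (Q.quadMean i)
    have h2 : |shapeCoef μ| * |Q.quadMean i| ≤ 3 / 2 * M * 4 := by
      gcongr; exact Q.abs_quadMean_le i
    have h3 := abs_sub (μ i) (shapeCoef μ * Q.quadMean i)
    have h4 := hμ i
    linarith
  have hcξ : |shapeCoef μ * Q.ξ x| ≤ 3 / 2 * M * 2 := by rw [abs_mul]; gcongr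
  have hcη : |shapeCoef μ * Q.η x| ≤ 3 / 2 * M * 2 := by rw [abs_mul]; gcongr
  have hcξ := abs_le.1 hcξ
  have hcη := abs_le.1 hcη
  have r0 := abs_le.1 (hr 0)
  have r1 := abs_le.1 (hr 1)
  have r2 := abs_le.1 (hr 2)
  have r3 := abs_le.1 (hr 3)
  have e1 : |(Q.shapeRest μ 2 - Q.shapeRest μ 0) / 2 + 2 * shapeCoef μ * Q.ξ x| ≤ 13 * M := by
    rw [abs_le]; constructor <;> linarith
  have e2 : |(Q.shapeRest μ 3 - Q.shapeRest μ 1) / 2 - 2 * shapeCoef μ * Q.η x| ≤ 13 * M := by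
    rw [abs_le]; constructor <;> linarith
  have n1 : ‖unitVec k‖ = 1 := by simp
  have c1 : |cross (unitVec k) Q.s / Q.jac| ≤ ‖Q.s‖ / Q.jac := by
    rw [abs_div, abs_of_pos hJ]
    gcongr
    have := abs_cross_le (unitVec k) Q.s
    rwa [n1, one_mul] at this
  have c2 : |cross Q.r (unitVec k) / Q.jac| ≤ ‖Q.r‖ / Q.jac := by
    rw [abs_div, abs_of_pos hJ]
    gcongr
    have := abs_cross_le Q.r (unitVec k)
    rwa [n1, mul_one] at this
  rw [pderiv_shape]
  refine (abs_add_le _ _).trans ?_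
  rw [abs_mul, abs_mul, add_div, mul_add, add_comm]
  gcongr

end Quad

/-! ### Mollification -/

/-- The mollification of `f` by the normalised bump function `φ`. -/
def mollify (φ : ContDiffBump (0 : Plane)) (f : Plane → ℝ) : Plane → ℝ :=
  convolution (φ.normed volume) f (ContinuousLinearMap.lsmul ℝ ℝ) volume

variable (φ : ContDiffBump (0 : Plane))

theorem mollify_apply (f : Plane → ℝ) (x : Plane) :
    mollify φ f x = ∫ t, f t * φ.normed volume (x - t) := by
  rw [mollify, convolution_lsmul_swap]
  simp only [smul_eq_mul, mul_comm]

theorem mollify_apply' (f : Plane → ℝ) (x : Plane) :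
    mollify φ f x = ∫ t, φ.normed volume t * f (x - t) := by
  rw [mollify, convolution_lsmul]
  simp only [smul_eq_mul]

variable {f g : Plane → ℝ}

theorem contDiff_mollify (hf : LocallyIntegrable f) : ContDiff ℝ ∞ (mollify φ f) :=
  φ.hasCompactSupport_normed.contDiff_convolution_left _ φ.contDiff_normed hf

theorem integrable_normed_mul (hf : LocallyIntegrable f) (x : Plane) :
    Integrable (fun t => φ.normed volume t * f (x - t)) := by
  have := φ.hasCompactSupport_normed.convolutionExists_left (ContinuousLinearMap.lsmul ℝ ℝ)
    (φ.continuous_normed (μ := volume)) hf x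
  exact this.integrable

/-- By Jensen's inequality the square of a mollification is at most the mollification of the square,
which has the same integral as the square. Jensen is obtained from the nonnegative variance of f(x −
·) under the kernel. -/
theorem integral_sq_mollify_le (hf : MemLp f 2 volume) :
    Integrable (fun x => mollify φ f x ^ 2) ∧ ∫ x, mollify φ f x ^ 2 ≤ ∫ x, f x ^ 2 := by
  have hl : LocallyIntegrable f := hf.locallyIntegrable (by norm_num)
  have hi : Integrable (fun x => f x ^ 2) := hf.integrable_sq
  have hp : ∀ x, mollify φ f x ^ 2 ≤ mollify φ (fun x => f x ^ 2) x := by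
    intro x
    set m := mollify φ f x with hm
    have i1 := integrable_normed_mul φ hl x
    have i2 := integrable_normed_mul φ hi.locallyIntegrable x
    have i3 : Integrable (fun t => φ.normed volume t) := φ.integrable_normed
    have h0 : 0 ≤ ∫ t, φ.normed volume t * (f (x - t) - m) ^ 2 :=
      integral_nonneg fun t => mul_nonneg (φ.nonneg_normed _) (sq_nonneg _)
    have he : ∀ t, φ.normed volume t * (f (x - t) - m) ^ 2 = φ.normed volume t * f (x - t) ^ 2 -
        (2 * m * (φ.normed volume t * f (x - t)) - m ^ 2 * φ.normed volume t) := fun t => by ring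
    simp only [he] at h0
    have i4 : Integrable (fun t => 2 * m * (φ.normed volume t * f (x - t)) -
      m ^ 2 * φ.normed volume t) := (i1.const_mul _).sub (i3.const_mul _)
    rw [integral_sub i2 i4, integral_sub (i1.const_mul _) (i3.const_mul _), integral_const_mul,
      integral_const_mul, φ.integral_normed, ← mollify_apply', ← hm] at h0
    rw [mollify_apply' φ (fun x => f x ^ 2)]
    linarith
  have hinteg : Integrable (mollify φ (fun x => f x ^ 2)) :=
    Integrable.integrable_convolution (ContinuousLinearMap.lsmul ℝ ℝ) φ.integrable_normed hi
  have heq : ∫ x, mollify φ (fun x => f x ^ 2) x = ∫ x, f x ^ 2 := by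
    have := integral_convolution (ContinuousLinearMap.lsmul ℝ ℝ) (μ := volume) (ν := volume)
      (φ.integrable_normed (μ := volume)) hi
    rw [φ.integral_normed] at this
    simpa [mollify] using this
  have hc := (contDiff_mollify φ hl).continuous
  have hinteg2 : Integrable (fun x => mollify φ f x ^ 2) := by
    refine hinteg.mono' (by fun_prop) (Eventually.of_forall fun x => ?_)
    rw [Real.norm_of_nonneg (sq_nonneg _)]; exact hp x
  exact ⟨hinteg2, heq ▸ integral_mono hinteg2 hinteg hp⟩

theorem mollify_sub (hf : LocallyIntegrable f) (hg : LocallyIntegrable g) (x : Plane) :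
    mollify φ (fun x => f x - g x) x = mollify φ f x - mollify φ g x := by
  rw [mollify_apply', mollify_apply', mollify_apply', ← integral_sub
    (integrable_normed_mul φ hf x) (integrable_normed_mul φ hg x)]
  simp only [mul_sub]

theorem pderiv_normed_sub (k : Fin 2) (x t : Plane) :
    pderiv k (fun t => φ.normed volume (x - t)) t = -pderiv k (φ.normed volume) (x - t) := by
  have hd : DifferentiableAt ℝ (φ.normed volume) (x - t) :=
    (φ.contDiff_normed (n := 1)).differentiable (by norm_num) _
  have h2 : HasFDerivAt (fun t : Plane => x - t) (-ContinuousLinearMap.id ℝ Plane) t :=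
    (hasFDerivAt_id t).const_sub x
  have := (hd.hasFDerivAt.comp t h2).fderiv
  unfold pderiv
  change fderiv ℝ (φ.normed volume ∘ fun t => x - t) t _ = _
  rw [this]; simp

theorem isTestFunction_normed_sub {U : Set Plane} {x : Plane}
    (hx : Metric.closedBall x φ.rOut ⊆ U) :
    IsTestFunction U fun t => φ.normed volume (x - t) := by
  have hs : tsupport (fun t => φ.normed volume (x - t)) ⊆ Metric.closedBall x φ.rOut := by
    refine closure_minimal (fun t ht => ?_) Metric.isClosed_closedBall
    have h1 : x - t ∈ Function.support (φ.normed volume) := ht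
    rw [φ.support_normed_eq, Metric.mem_ball, dist_zero_right] at h1
    rw [Metric.mem_closedBall, dist_comm, dist_eq_norm]; exact h1.le
  exact ⟨φ.contDiff_normed.comp (contDiff_const.sub contDiff_id),
    HasCompactSupport.of_support_subset_isCompact (isCompact_closedBall x φ.rOut)
      (subset_closure.trans hs), hs.trans hx⟩

/-- The translated kernel is a legitimate test function when its support lies in U, so the
derivative can be moved from the kernel to f. -/
theorem pderiv_mollify {U : Set Plane} {k : Fin 2} (hf : LocallyIntegrable f)
    (h : IsWeakDeriv U k f g) {x : Plane} (hx : Metric.closedBall x φ.rOut ⊆ U) :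
    pderiv k (mollify φ f) x = mollify φ g x := by
  have h1 : HasFDerivAt (mollify φ f) _ x :=
    φ.hasCompactSupport_normed.hasFDerivAt_convolution_left (ContinuousLinearMap.lsmul ℝ ℝ)
      φ.contDiff_normed hf x
  have hT := isTestFunction_normed_sub φ hx
  have h2 := h.2 _ hT
  rw [(hT.pderiv k).setIntegral_mul, hT.setIntegral_mul, ← mollify_apply] at h2
  have hcs : HasCompactSupport (fderiv ℝ (φ.normed volume)) :=
    φ.hasCompactSupport_normed.fderiv ℝ
  have hi := hcs.convolutionExists_left
    ((ContinuousLinearMap.lsmul ℝ ℝ : ℝ →L[ℝ] ℝ →L[ℝ] ℝ).precompL Plane)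
    ((φ.contDiff_normed (n := 1)).continuous_fderiv one_ne_zero) hf (μ := volume) x
  rw [pderiv, h1.fderiv, convolution, ContinuousLinearMap.integral_apply hi.integrable]
  have h3 : ∫ t, f t * pderiv k (fun t => φ.normed volume (x - t)) t =
      -∫ t, pderiv k (φ.normed volume) t * f (x - t) := by
    simp only [pderiv_normed_sub, mul_neg, integral_neg]
    rw [← integral_sub_left_eq_self _ volume x]
    simp only [sub_sub_cancel, mul_comm]
  rw [h3] at h2
  rw [← neg_inj, ← h2]
  simp [pderiv, mul_comm]

theorem abs_mollify_sub_le (hf : Continuous f) {x : Plane} {a ε : ℝ}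
    (h : ∀ y ∈ Metric.ball x φ.rOut, |f y - a| ≤ ε) : |mollify φ f x - a| ≤ ε :=
  dist_convolution_le ((abs_nonneg _).trans (h x (Metric.mem_ball_self φ.rOut_pos)))
    φ.support_normed_eq.subset φ.nonneg_normed φ.integral_normed hf.aestronglyMeasurable h

theorem l2norm_dilate_le (hi : Integrable (fun x => f x ^ 2)) (U : Set Plane)
    (c : Plane) {s : ℝ} (hs : 0 < s) :
    l2norm (volume.restrict U) (fun x => f (c + s • (x - c))) ≤ s⁻¹ * l2norm volume f := by
  have e : ∀ x : Plane, c + s • (x - c) = s • x + (c - s • c) := fun x => by module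
  have hi2 : Integrable (fun x => f (c + s • (x - c)) ^ 2) := by
    simp only [e]
    exact (hi.comp_add_right (c - s • c)).comp_smul hs.ne'
  have h1 : ∫ x, f (c + s • (x - c)) ^ 2 = (s⁻¹) ^ 2 * ∫ x, f x ^ 2 := by
    simp only [e]
    have := Measure.integral_comp_smul (volume : Measure Plane)
      (fun x => f (x + (c - s • c)) ^ 2) s
    rw [this, integral_add_right_eq_self (fun x => f x ^ 2)]
    simp
  unfold l2norm
  rw [← Real.sqrt_sq (inv_nonneg.2 hs.le), ← Real.sqrt_mul (sq_nonneg _), ← h1]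
  exact Real.sqrt_le_sqrt (setIntegral_le_integral hi2 (Eventually.of_forall fun x => sq_nonneg _))

/-- Mollification combined with a dilation converges to the identity in `L²`. -/
theorem tendsto_mollify_dilate {U : Set Plane} (hU : Bornology.IsBounded U) (hf : MemLp f 2 volume)
    {φ : ℕ → ContDiffBump (0 : Plane)} (hφ : Tendsto (fun n => (φ n).rOut) atTop (𝓝 0))
    {s : ℕ → ℝ} (hs : Tendsto s atTop (𝓝 1)) (c : Plane) :
    Tendsto (fun n => l2norm (volume.restrict U)
      (fun x => mollify (φ n) f (c + s n • (x - c)) - f x)) atTop (𝓝 0) := by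
  have hfin : IsFiniteMeasure (volume.restrict U) := ⟨by
    rw [Measure.restrict_apply_univ]; exact hU.measure_lt_top⟩
  set V := Real.sqrt ((volume.restrict U).real Set.univ)
  have hV : 0 ≤ V := Real.sqrt_nonneg _
  obtain ⟨R, hR0, hR⟩ := hU.subset_closedBall_lt 0 c
  rw [Metric.tendsto_atTop]
  intro ε hε
  -- For continuous g with compact support the convergence is uniform. The dilation factor exceeds
  -- 1/2, so replacing f by g under the mollification costs at most 2 · ε/8; the other two terms
  -- cost ε/8 each.
  obtain ⟨g, hgc, hg, hgcont, hgm⟩ := hf.exists_hasCompactSupport_eLpNorm_sub_le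
    (by norm_num) (ε := ENNReal.ofReal (ε / 8)) (by simpa using hε)
  have hfg : l2norm volume (fun x => f x - g x) ≤ ε / 8 := by
    have h1 : MemLp (f - g) 2 volume := hf.sub hgm
    rw [MemLp.eLpNorm_eq_integral_rpow_norm two_ne_zero ENNReal.ofNat_ne_top h1] at hg
    have := (ENNReal.ofReal_le_ofReal_iff (by positivity)).1 hg
    rw [l2norm, Real.sqrt_eq_rpow]
    simpa using this
  set η := ε / (8 * (V + 1))
  have hη : 0 < η := by positivity
  have huc : UniformContinuous g := hgc.uniformContinuous_of_continuous hgcont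
  obtain ⟨δ, hδ, hgδ⟩ := Metric.uniformContinuous_iff.1 huc η hη
  have ev1 : ∀ᶠ n in atTop, (φ n).rOut < δ / 2 := hφ.eventually_lt_const (by linarith)
  have ev2 : ∀ᶠ n in atTop, |s n - 1| < δ / (2 * R) := by
    have : Tendsto (fun n => |s n - 1|) atTop (𝓝 0) := by
      simpa using (hs.sub_const 1).abs
    exact this.eventually_lt_const (by positivity)
  have ev3 : ∀ᶠ n in atTop, 1 / 2 < s n := hs.eventually_const_lt (by norm_num)
  obtain ⟨N, hN⟩ := eventually_atTop.1 (ev1.and (ev2.and ev3))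
  refine ⟨N, fun n hn => ?_⟩
  obtain ⟨h1, h2, h3⟩ := hN n hn
  rw [Real.dist_eq, sub_zero, abs_of_nonneg (l2norm_nonneg _ _)]
  have hlf : LocallyIntegrable f := hf.locallyIntegrable (by norm_num)
  have hlg : LocallyIntegrable g := hgcont.locallyIntegrable
  have hlfg : LocallyIntegrable (fun x => f x - g x) :=
    (hf.sub hgm).locallyIntegrable (by norm_num)
  have hcont : ∀ h, LocallyIntegrable h → Continuous fun x => mollify (φ n) h (c + s n • (x - c)) :=
    fun h hh => (contDiff_mollify (φ n) hh).continuous.comp (by fun_prop)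
  have m1 := Continuous.memLp_of_isBounded (hcont _ hlf) hU
  have m2 := Continuous.memLp_of_isBounded (hcont _ hlg) hU
  have m3 := hf.restrict U
  have m4 := hgm.restrict U
  have t1 := l2norm_triangle m1 m2 m3
  have t2 := l2norm_triangle m2 m4 m3
  have b1 : l2norm (volume.restrict U) (fun x => mollify (φ n) f (c + s n • (x - c)) -
      mollify (φ n) g (c + s n • (x - c))) ≤ ε / 4 := by
    simp only [← mollify_sub (φ n) hlf hlg]
    obtain ⟨hi, hle⟩ := integral_sq_mollify_le (φ n) (hf.sub hgm)
    refine (l2norm_dilate_le hi U c (by linarith)).trans ?_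
    have h5 : l2norm volume (mollify (φ n) fun x => f x - g x) ≤ ε / 8 :=
      (Real.sqrt_le_sqrt hle).trans hfg
    have h6 : (s n)⁻¹ ≤ 2 := by
      rw [inv_le_comm₀ (by linarith) (by norm_num)]; linarith
    calc _ ≤ 2 * (ε / 8) := mul_le_mul h6 h5 (l2norm_nonneg _ _) (by norm_num)
      _ = _ := by ring
  have b2 : l2norm (volume.restrict U) (fun x => mollify (φ n) g (c + s n • (x - c)) - g x) ≤
      ε / 8 := by
    have hb : ∀ᵐ x ∂(volume.restrict U), |mollify (φ n) g (c + s n • (x - c)) - g x| ≤ η := by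
      have hsub : U ⊆ Metric.closedBall c R := hR
      have hae : ∀ᵐ x ∂(volume.restrict U), x ∈ Metric.closedBall c R :=
        ae_mono (Measure.restrict_mono hsub le_rfl) (ae_restrict_mem measurableSet_closedBall)
      filter_upwards [hae] with x hx
      refine abs_mollify_sub_le (φ n) hgcont fun y hy => (hgδ ?_).le
      have hx2 : ‖x - c‖ ≤ R := by rwa [← dist_eq_norm]
      have hd : dist (c + s n • (x - c)) x ≤ δ / 2 := by
        rw [dist_eq_norm, show c + s n • (x - c) - x = (s n - 1) • (x - c) by module, norm_smul,
          Real.norm_eq_abs]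
        calc _ ≤ δ / (2 * R) * R := by gcongr
          _ = δ / 2 := by field_simp
      have := dist_triangle y (c + s n • (x - c)) x
      rw [Metric.mem_ball] at hy
      linarith
    refine (l2norm_le_of_bound hη.le hb).trans ?_
    change η * V ≤ _
    calc η * V ≤ η * (V + 1) := by gcongr; linarith
      _ = ε / 8 := by simp only [η]; field_simp
  have b3 : l2norm (volume.restrict U) (fun x => g x - f x) ≤ ε / 8 := by
    rw [l2norm_sub_comm]
    refine le_trans (Real.sqrt_le_sqrt ?_) hfg
    exact setIntegral_le_integral (hf.sub hgm).integrable_sq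
      (Eventually.of_forall fun x => sq_nonneg _)
  linarith

theorem MemLp.indicator_restrict {U : Set Plane} (hU : MeasurableSet U)
    (hf : MemLp f 2 (volume.restrict U)) : MemLp (U.indicator f) 2 volume :=
  (memLp_indicator_iff_restrict hU).2 hf

theorem IsWeakDeriv.indicator {U : Set Plane} (hU : MeasurableSet U) {k : Fin 2}
    (h : IsWeakDeriv U k f g) : IsWeakDeriv U k (U.indicator f) (U.indicator g) :=
  h.congr (indicator_ae_eq_restrict hU).symm (indicator_ae_eq_restrict hU).symm

theorem pderiv_comp_dilate (hf : ContDiff ℝ 1 f) (c : Plane) (s : ℝ) (k : Fin 2) (x : Plane) :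
    pderiv k (fun x => f (c + s • (x - c))) x = s * pderiv k f (c + s • (x - c)) := by
  have h1 : HasFDerivAt (fun x : Plane => c + s • (x - c)) (s • ContinuousLinearMap.id ℝ Plane) x :=
    (((hasFDerivAt_id x).sub_const c).const_smul s).const_add c
  have h2 := (hf.differentiable one_ne_zero (c + s • (x - c))).hasFDerivAt
  have := (h2.comp x h1).fderiv
  unfold pderiv
  change fderiv ℝ (f ∘ fun x => c + s • (x - c)) x _ = _
  rw [this]; simp

theorem tendsto_l2norm_smul_sub {U : Set Plane} {F : ℕ → Plane → ℝ} {s : ℕ → ℝ}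
    (hF : ∀ n, MemLp (F n) 2 (volume.restrict U)) (hf : MemLp f 2 (volume.restrict U))
    (hs : Tendsto s atTop (𝓝 1))
    (h : Tendsto (fun n => l2norm (volume.restrict U) (fun x => F n x - f x)) atTop (𝓝 0)) :
    Tendsto (fun n => l2norm (volume.restrict U) (fun x => s n * F n x - f x)) atTop (𝓝 0) := by
  have hb : Tendsto (fun n => |s n| * l2norm (volume.restrict U) (fun x => F n x - f x) +
      |s n - 1| * l2norm (volume.restrict U) f) atTop (𝓝 0) := by
    have h1 := hs.abs.mul h
    have h2 := (hs.sub_const 1).abs.mul_const (l2norm (volume.restrict U) f)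
    simpa using h1.add h2
  refine squeeze_zero (fun n => l2norm_nonneg _ _) (fun n => ?_) hb
  rw [← l2norm_const_mul, ← l2norm_const_mul]
  have := l2norm_add_le (((hF n).sub hf).const_mul (s n)) (hf.const_mul (s n - 1))
  refine le_trans (le_of_eq ?_) this
  congr 1; ext x
  simp only [Pi.sub_apply]; ring

/-- Contraction towards an interior point carries the closure onto a compact subset of U, which
keeps a positive distance from the complement. -/
theorem exists_closedBall_dilate_subset {U : Set Plane} (hU : IsOpen U) (hc : Convex ℝ U)
    (hb : Bornology.IsBounded U) {c : Plane} (hcU : c ∈ U) {s : ℝ} (h0 : 0 < s) (h1 : s < 1) :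
    ∃ δ > 0, ∀ x ∈ U, Metric.closedBall (c + s • (x - c)) δ ⊆ U := by
  have hK : IsCompact ((fun x : Plane => c + s • (x - c)) '' closure U) :=
    hb.isCompact_closure.image (by fun_prop)
  have hKU : (fun x : Plane => c + s • (x - c)) '' closure U ⊆ U := by
    rintro _ ⟨x, hx, rfl⟩
    have := hc.combo_interior_closure_mem_interior (hU.interior_eq.symm ▸ hcU) hx
      (a := 1 - s) (b := s) (by linarith) h0.le (by ring)
    rw [hU.interior_eq] at this
    beta_reduce
    rwa [show c + s • (x - c) = (1 - s) • c + s • x by module]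
  obtain ⟨δ, hδ, hsub⟩ := hK.exists_cthickening_subset_open hU hKU
  refine ⟨δ, hδ, fun x hx => ?_⟩
  have hmem : c + s • (x - c) ∈ (fun x : Plane => c + s • (x - c)) '' closure U :=
    ⟨x, subset_closure hx, rfl⟩
  exact (Metric.closedBall_subset_cthickening hmem δ).trans hsub

/-- On a bounded convex open set the smooth functions are dense in `H²`. -/
theorem exists_smooth_approx {U : Set Plane} (hU : IsOpen U) (hc : Convex ℝ U)
    (hb : Bornology.IsBounded U) (hne : U.Nonempty) {v : Plane → ℝ} (hv : MemH2 U v) :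
    ∃ φ : ℕ → Plane → ℝ, (∀ n, ContDiff ℝ ∞ (φ n)) ∧ H1Tendsto U φ v ∧
      ∀ k l, Tendsto (fun n => l2norm (volume.restrict U)
        (fun x => pderiv l (pderiv k (φ n)) x - wderiv U l (wderiv U k v) x)) atTop (𝓝 0) := by
  obtain ⟨c, hcU⟩ := hne
  have hm := hU.measurableSet
  -- Evaluating the mollification at a point contracted towards c keeps the kernel inside U. The
  -- approximation is therefore valid up to the boundary without extending v beyond U.
  set s : ℕ → ℝ := fun n => 1 - 1 / ((n : ℝ) + 2) with hsdef
  have hinv : Tendsto (fun n : ℕ => 1 / ((n : ℝ) + 2)) atTop (𝓝 0) := by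
    have := (tendsto_add_atTop_iff_nat 1).2 (tendsto_one_div_add_atTop_nhds_zero_nat (𝕜 := ℝ))
    refine this.congr fun n => ?_
    push_cast; ring
  have hs : Tendsto s atTop (𝓝 1) := by
    have := hinv.const_sub 1
    rwa [sub_zero] at this
  have hs0 : ∀ n, 0 < s n ∧ s n < 1 := fun n => by
    have h2 : (1 : ℝ) < (n : ℝ) + 2 := by have := n.cast_nonneg (α := ℝ); linarith
    have h3 : 1 / ((n : ℝ) + 2) < 1 := by rw [div_lt_one (by linarith)]; exact h2
    have h4 : 0 < 1 / ((n : ℝ) + 2) := by positivity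
    exact ⟨by simp only [hsdef]; linarith, by simp only [hsdef]; linarith⟩
  have hδ : ∀ n, ∃ δ > 0, ∀ x ∈ U, Metric.closedBall (c + s n • (x - c)) δ ⊆ U := fun n =>
    exists_closedBall_dilate_subset hU hc hb hcU (hs0 n).1 (hs0 n).2
  choose δ hδ0 hδU using hδ
  set φ : ℕ → ContDiffBump (0 : Plane) := fun n =>
    ⟨min (δ n) (1 / ((n : ℝ) + 2)) / 2, min (δ n) (1 / ((n : ℝ) + 2)),
      half_pos (lt_min (hδ0 n) (by positivity)), half_lt_self (lt_min (hδ0 n) (by positivity))⟩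
  have hφ : Tendsto (fun n => (φ n).rOut) atTop (𝓝 0) :=
    squeeze_zero (fun n => (φ n).rOut_pos.le) (fun n => min_le_right _ _) hinv
  have hball : ∀ n, ∀ x ∈ U, Metric.closedBall (c + s n • (x - c)) (φ n).rOut ⊆ U := fun n x hx =>
    (Metric.closedBall_subset_closedBall (min_le_left _ _)).trans (hδU n x hx)
  have hmem : ∀ f, MemLp f 2 (volume.restrict U) → LocallyIntegrable (U.indicator f) := fun f hf =>
    (MemLp.indicator_restrict hm hf).locallyIntegrable (by norm_num)
  set A : ℕ → (Plane → ℝ) → Plane → ℝ := fun n f x =>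
    mollify (φ n) (U.indicator f) (c + s n • (x - c)) with hA
  have hAs : ∀ n f, MemLp f 2 (volume.restrict U) → ContDiff ℝ ∞ (A n f) := fun n f hf =>
    (contDiff_mollify (φ n) (hmem f hf)).comp (by fun_prop)
  have hAd : ∀ n k f g, MemLp f 2 (volume.restrict U) → IsWeakDeriv U k f g → ∀ x ∈ U,
      pderiv k (A n f) x = s n * A n g x := by
    intro n k f g hf h x hx
    simp only [hA]
    rw [pderiv_comp_dilate (contDiff_one (contDiff_mollify (φ n) (hmem f hf))),
      pderiv_mollify (φ n) (hmem f hf) (h.indicator hm) (hball n x hx)]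
  have hAt : ∀ f, MemLp f 2 (volume.restrict U) → Tendsto (fun n => l2norm (volume.restrict U)
      (fun x => A n f x - f x)) atTop (𝓝 0) := by
    intro f hf
    refine (tendsto_mollify_dilate hb (MemLp.indicator_restrict hm hf) hφ hs c).congr fun n => ?_
    refine l2norm_congr ((indicator_ae_eq_restrict (f := f) hm).mono fun x hx => ?_)
    simp only [hA, hx]
  have hAm : ∀ n f, MemLp f 2 (volume.restrict U) → MemLp (A n f) 2 (volume.restrict U) :=
    fun n f hf => Continuous.memLp_of_isBounded (hAs n f hf).continuous hb
  have hv0 := hv.1.1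
  have hv1 : ∀ k, MemLp (wderiv U k v) 2 (volume.restrict U) := fun k => (hv.2 k).1
  have hv2 : ∀ k l, MemLp (wderiv U l (wderiv U k v)) 2 (volume.restrict U) := fun k l =>
    ((hv.2 k).wderiv_spec l).1
  refine ⟨fun n => A n v, fun n => hAs n v hv0, ⟨?_, fun k => ?_⟩, fun k l => ?_⟩
  · exact tendsto_l2norm_iff.1 (hAt v hv0)
  · refine tendsto_l2norm_iff.1 ?_
    refine (tendsto_l2norm_smul_sub (fun n => hAm n _ (hv1 k)) (hv1 k) hs (hAt _ (hv1 k))).congr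
      fun n => l2norm_congr ?_
    filter_upwards [ae_restrict_mem hm] with x hx
    rw [hAd n k v _ hv0 (hv.1.wderiv_spec k) x hx]
  · have h1 := tendsto_l2norm_smul_sub (fun n => hAm n _ (hv2 k l)) (hv2 k l) (s := fun n => s n * s n)
      (by simpa using hs.mul hs) (hAt _ (hv2 k l))
    refine h1.congr fun n => l2norm_congr ?_
    filter_upwards [ae_restrict_mem hm] with x hx
    -- The formula for the first derivative holds on the open set U, so it may be differentiated
    -- again; each differentiation contributes one factor s n.
    have he : pderiv k (A n v) =ᶠ[𝓝 x] fun x => s n * A n (wderiv U k v) x := by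
      filter_upwards [hU.mem_nhds hx] with y hy
      exact hAd n k v _ hv0 (hv.1.wderiv_spec k) y hy
    have hd : DifferentiableAt ℝ (A n (wderiv U k v)) x :=
      (contDiff_one (hAs n _ (hv1 k))).differentiable one_ne_zero x
    have h2 : pderiv l (pderiv k (A n v)) x = s n * pderiv l (A n (wderiv U k v)) x := by
      rw [pderiv, he.fderiv_eq, fderiv_const_mul hd]; rfl
    rw [h2, hAd n l _ _ (hv1 k) ((hv.2 k).wderiv_spec l) x hx, mul_assoc]

/-! ### Averaged Taylor polynomials on convex sets -/

/-- A homothety centred at x ∈ U with factor t ≤ 1 maps the convex set U into itself, with Jacobian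
t². -/
theorem lintegral_homothety_le {U : Set Plane} (hU : IsOpen U) (hc : Convex ℝ U) {x : Plane}
    (hx : x ∈ U) {t : ℝ} (h0 : 0 < t) (h1 : t ≤ 1) {h : Plane → ENNReal} (hh : Measurable h) :
    ENNReal.ofReal (t ^ 2) * ∫⁻ y in U, h (x + t • (y - x)) ≤ ∫⁻ z in U, h z := by
  have hm := hU.measurableSet
  have hD : Measurable fun y : Plane => x + t • (y - x) := by fun_prop
  have hmap : Measure.map (fun y : Plane => x + t • (y - x)) volume =
      ENNReal.ofReal ((t ^ 2)⁻¹) • volume := by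
    have e : (fun y : Plane => x + t • (y - x)) = (fun y => y + (x - t • x)) ∘ fun y => t • y := by
      ext1 y; simp only [Function.comp]; module
    rw [e, ← Measure.map_map (by fun_prop) (by fun_prop),
      Measure.map_addHaar_smul volume h0.ne', Measure.map_smul,
      (measurePreserving_add_right volume (x - t • x)).map_eq]
    simp [abs_of_pos h0]
  have h2 : ∫⁻ y in U, h (x + t • (y - x)) ≤ ∫⁻ y, U.indicator h (x + t • (y - x)) := by
    rw [← lintegral_indicator hm]
    refine lintegral_mono fun y => ?_
    by_cases hy : y ∈ U
    · have : x + t • (y - x) ∈ U := hc.add_smul_sub_mem hx hy ⟨h0.le, h1⟩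
      rw [Set.indicator_of_mem hy, Set.indicator_of_mem this]
    · rw [Set.indicator_of_notMem hy]; exact zero_le
  have h3 : ∫⁻ y, U.indicator h (x + t • (y - x)) = ENNReal.ofReal ((t ^ 2)⁻¹) * ∫⁻ z in U, h z := by
    rw [← lintegral_map (hh.indicator hm) hD, hmap, lintegral_smul_measure,
      lintegral_indicator hm, smul_eq_mul]
  calc _ ≤ ENNReal.ofReal (t ^ 2) * (ENNReal.ofReal ((t ^ 2)⁻¹) * ∫⁻ z in U, h z) := by
        rw [← h3]; gcongr
    _ = _ := by
        rw [← mul_assoc, ← ENNReal.ofReal_mul (by positivity), mul_inv_cancel₀ (by positivity),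
          ENNReal.ofReal_one, one_mul]

theorem lintegral_homothety_le_of_half {U : Set Plane} (hU : IsOpen U) (hc : Convex ℝ U) {x : Plane}
    (hx : x ∈ U) {t : ℝ} (h0 : 1 / 2 ≤ t) (h1 : t ≤ 1) {h : Plane → ENNReal} (hh : Measurable h) :
    ∫⁻ y in U, h (x + t • (y - x)) ≤ 4 * ∫⁻ z in U, h z := by
  have := lintegral_homothety_le hU hc hx (by linarith) h1 hh
  have h4 : (1 : ENNReal) ≤ 4 * ENNReal.ofReal (t ^ 2) := by
    rw [show (4 : ENNReal) = ENNReal.ofReal 4 by simp, ← ENNReal.ofReal_mul (by norm_num),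
      ENNReal.one_le_ofReal]
    nlinarith
  calc ∫⁻ y in U, h (x + t • (y - x)) = 1 * ∫⁻ y in U, h (x + t • (y - x)) := (one_mul _).symm
    _ ≤ 4 * ENNReal.ofReal (t ^ 2) * ∫⁻ y in U, h (x + t • (y - x)) := by gcongr
    _ ≤ _ := by rw [mul_assoc]; gcongr

/-- The Jacobian t² degenerates as t tends to zero. For t ≤ 1/2 exchanging x and y replaces t by 1 −
t, so the loss is never more than a factor 4. -/
theorem lintegral_lintegral_homothety_le {U : Set Plane} (hU : IsOpen U) (hc : Convex ℝ U) {t : ℝ}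
    (h0 : 0 ≤ t) (h1 : t ≤ 1) {h : Plane → ENNReal} (hh : Measurable h) :
    ∫⁻ x in U, ∫⁻ y in U, h (x + t • (y - x)) ≤ 4 * volume U * ∫⁻ z in U, h z := by
  have key : ∀ t : ℝ, 1 / 2 ≤ t → t ≤ 1 →
      ∫⁻ x in U, ∫⁻ y in U, h (x + t • (y - x)) ≤ 4 * volume U * ∫⁻ z in U, h z := by
    intro t h0 h1
    calc _ ≤ ∫⁻ x in U, 4 * ∫⁻ z in U, h z :=
          setLIntegral_mono measurable_const fun x hx =>
            lintegral_homothety_le_of_half hU hc hx h0 h1 hh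
      _ = _ := by rw [setLIntegral_const]; ring
  rcases le_total (1 / 2) t with ht | ht
  · exact key t ht h1
  · have := key (1 - t) (by linarith) (by linarith)
    rw [lintegral_lintegral_swap (by fun_prop)]
    refine le_trans (le_of_eq ?_) this
    refine lintegral_congr fun x => lintegral_congr fun y => ?_
    congr 1; module

theorem sq_intervalIntegral_le {f : ℝ → ℝ} (hf : Continuous f) :
    (∫ t in (0 : ℝ)..1, f t) ^ 2 ≤ ∫ t in Set.Ioc (0 : ℝ) 1, f t ^ 2 := by
  have hb : MemLp f 2 (volume.restrict (Set.Ioc (0 : ℝ) 1)) := by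
    refine MemLp.mono_measure (Measure.restrict_mono Set.Ioc_subset_Icc_self le_rfl) ?_
    have : IsFiniteMeasure (volume.restrict (Set.Icc (0 : ℝ) 1)) := ⟨by simp⟩
    obtain ⟨C, hC⟩ := isCompact_Icc.exists_bound_of_continuousOn (hf.continuousOn (s := Set.Icc 0 1))
    refine MemLp.of_bound hf.aestronglyMeasurable C ?_
    filter_upwards [ae_restrict_mem measurableSet_Icc] with t ht using hC t ht
  have h1 : MemLp (fun _ : ℝ => (1 : ℝ)) 2 (volume.restrict (Set.Ioc (0 : ℝ) 1)) := by
    have : IsFiniteMeasure (volume.restrict (Set.Ioc (0 : ℝ) 1)) := ⟨by simp⟩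
    exact memLp_const 1
  have := integral_mul_sq_le hb h1
  rw [intervalIntegral.integral_of_le zero_le_one]
  simpa using this

theorem sq_average_le {U : Set Plane} (hb : Bornology.IsBounded U) {f : Plane → ℝ}
    (hf : Continuous f) :
    (∫ y in U, f y) ^ 2 ≤ volume.real U * ∫ y in U, f y ^ 2 := by
  have := integral_mul_sq_le (Continuous.memLp_of_isBounded hf hb)
    (Continuous.memLp_of_isBounded (continuous_const (y := (1 : ℝ))) hb)
  simpa [mul_comm] using this

theorem ofReal_setIntegral_sq {U : Set Plane} (hb : Bornology.IsBounded U) {f : Plane → ℝ}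
    (hf : Continuous f) :
    ENNReal.ofReal (∫ y in U, f y ^ 2) = ∫⁻ y in U, ENNReal.ofReal (f y ^ 2) :=
  ofReal_integral_eq_lintegral_ofReal (Continuous.memLp_of_isBounded hf hb).integrable_sq
    (Eventually.of_forall fun _ => sq_nonneg _)

theorem hasDerivAt_comp_segment {g : Plane → ℝ} (hg : ContDiff ℝ 1 g) (x u : Plane) (t : ℝ) :
    HasDerivAt (fun t : ℝ => g (x + t • u)) (∑ k, pderiv k g (x + t • u) * u k) t := by
  have h1 : HasDerivAt (fun t : ℝ => x + t • u) u t := by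
    simpa using ((hasDerivAt_id t).smul_const u).const_add x
  have h2 := (hg.differentiable one_ne_zero (x + t • u)).hasFDerivAt.comp_hasDerivAt t h1
  rw [fderiv_apply_eq] at h2
  exact h2

theorem norm_sq_eq (u : Plane) : ‖u‖ ^ 2 = ∑ k, u k ^ 2 := by
  rw [EuclideanSpace.norm_eq, Real.sq_sqrt (by positivity)]
  simp

theorem sq_sub_le {g : Plane → ℝ} (hg : ContDiff ℝ 1 g) (x y : Plane) :
    (g x - g y) ^ 2 ≤ ‖y - x‖ ^ 2 *
      ∫ t in Set.Ioc (0 : ℝ) 1, ∑ k, pderiv k g (x + t • (y - x)) ^ 2 := by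
  have hcd : ∀ k, Continuous (pderiv k g) := continuous_pderiv hg
  have hcont : Continuous fun t : ℝ => ∑ k, pderiv k g (x + t • (y - x)) * (y - x) k := by fun_prop
  have h1 := intervalIntegral.integral_eq_sub_of_hasDerivAt
    (fun t _ => hasDerivAt_comp_segment hg x (y - x) t) (hcont.intervalIntegrable 0 1)
  have h2 : g x - g y = -∫ t in (0 : ℝ)..1, ∑ k, pderiv k g (x + t • (y - x)) * (y - x) k := by
    rw [h1]; simp
  rw [h2, neg_sq]
  refine (sq_intervalIntegral_le hcont).trans ?_
  rw [← integral_const_mul]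
  refine setIntegral_mono_on ?_ ?_ measurableSet_Ioc fun t _ => ?_
  · exact (Continuous.integrableOn_Icc (by fun_prop)).mono_set Set.Ioc_subset_Icc_self
  · exact (Continuous.integrableOn_Icc (by fun_prop)).mono_set Set.Ioc_subset_Icc_self
  · rw [norm_sq_eq, mul_comm]
    exact Finset.sum_mul_sq_le_sq_mul_sq _ _ _

/-- With u = y − x, the derivative of t ∇φ(x + t u) · u − φ(x + t u) is t times the second
directional derivative, and its integral over [0, 1] is the Taylor remainder at x, expanded about y.
The factor t survives the Cauchy–Schwarz inequality as t². -/
theorem sq_taylor_le {φ : Plane → ℝ} (hφ : ContDiff ℝ ∞ φ) (x y : Plane) :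
    (φ x - φ y - ∑ k, pderiv k φ y * (x - y) k) ^ 2 ≤ ‖y - x‖ ^ 4 *
      ∫ t in Set.Ioc (0 : ℝ) 1, t ^ 2 * ∑ k, ∑ l, pderiv l (pderiv k φ) (x + t • (y - x)) ^ 2 := by
  set u := y - x with hu
  have hc1 : ∀ k, Continuous (pderiv k φ) := continuous_pderiv (contDiff_one hφ)
  have hc2 : ∀ k l, Continuous (pderiv l (pderiv k φ)) := fun k l =>
    continuous_pderiv (contDiff_one (contDiff_pderiv hφ k)) l
  have hd1 := hasDerivAt_comp_segment (contDiff_one hφ) x u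
  have hd2 : ∀ t : ℝ, HasDerivAt (fun t : ℝ => ∑ k, pderiv k φ (x + t • u) * u k)
      (∑ k, (∑ l, pderiv l (pderiv k φ) (x + t • u) * u l) * u k) t := fun t =>
    HasDerivAt.fun_sum fun k _ =>
      (hasDerivAt_comp_segment (contDiff_one (contDiff_pderiv hφ k)) x u t).mul_const (u k)
  have hd : ∀ t : ℝ, HasDerivAt (fun t : ℝ => t * (∑ k, pderiv k φ (x + t • u) * u k) -
      φ (x + t • u)) (t * ∑ k, (∑ l, pderiv l (pderiv k φ) (x + t • u) * u l) * u k) t := fun t => by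
    refine (((hasDerivAt_id t).mul (hd2 t)).sub (hd1 t)).congr_deriv ?_
    simp
  have hcont : Continuous fun t : ℝ =>
      t * ∑ k, (∑ l, pderiv l (pderiv k φ) (x + t • u) * u l) * u k := by fun_prop
  have h1 := intervalIntegral.integral_eq_sub_of_hasDerivAt (fun t _ => hd t)
    (hcont.intervalIntegrable 0 1)
  have h2 : φ x - φ y - ∑ k, pderiv k φ y * (x - y) k =
      ∫ t in (0 : ℝ)..1, t * ∑ k, (∑ l, pderiv l (pderiv k φ) (x + t • u) * u l) * u k := by
    rw [h1]
    have e1 : x + (1 : ℝ) • u = y := by rw [hu]; module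
    have e2 : x - y = -u := by rw [hu]; abel
    rw [e1, e2]
    simp; ring
  rw [h2]
  refine (sq_intervalIntegral_le hcont).trans ?_
  rw [← integral_const_mul]
  refine setIntegral_mono_on ?_ ?_ measurableSet_Ioc fun t _ => ?_
  · exact (Continuous.integrableOn_Icc (by fun_prop)).mono_set Set.Ioc_subset_Icc_self
  · exact (Continuous.integrableOn_Icc (by fun_prop)).mono_set Set.Ioc_subset_Icc_self
  · have i1 := Finset.sum_mul_sq_le_sq_mul_sq Finset.univ
      (fun k => ∑ l, pderiv l (pderiv k φ) (x + t • u) * u l) (fun k => u k)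
    have i2 : ∀ k, (∑ l, pderiv l (pderiv k φ) (x + t • u) * u l) ^ 2 ≤
        (∑ l, pderiv l (pderiv k φ) (x + t • u) ^ 2) * ‖u‖ ^ 2 := fun k => by
      rw [norm_sq_eq]
      exact Finset.sum_mul_sq_le_sq_mul_sq _ _ _
    rw [← norm_sq_eq] at i1
    have i3 := Finset.sum_le_sum fun k (_ : k ∈ Finset.univ) => i2 k
    rw [← Finset.sum_mul] at i3
    rw [mul_pow]
    calc t ^ 2 * (∑ k, (∑ l, pderiv l (pderiv k φ) (x + t • u) * u l) * u k) ^ 2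
        ≤ t ^ 2 * (((∑ k, ∑ l, pderiv l (pderiv k φ) (x + t • u) ^ 2) * ‖u‖ ^ 2) * ‖u‖ ^ 2) := by
          gcongr
          exact i1.trans (by gcongr)
      _ = _ := by ring

theorem lintegral_segments_le {U : Set Plane} (hU : IsOpen U) (hc : Convex ℝ U)
    {h : Plane → ENNReal} (hh : Measurable h) :
    ∫⁻ x in U, ∫⁻ y in U, ∫⁻ t in Set.Ioc (0 : ℝ) 1, h (x + t • (y - x)) ≤
      4 * volume U * ∫⁻ z in U, h z := by
  have h1 : ∀ x, ∫⁻ y in U, ∫⁻ t in Set.Ioc (0 : ℝ) 1, h (x + t • (y - x)) =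
      ∫⁻ t in Set.Ioc (0 : ℝ) 1, ∫⁻ y in U, h (x + t • (y - x)) := fun x =>
    lintegral_lintegral_swap (by fun_prop)
  simp only [h1]
  have hmeas : Measurable fun p : Plane × ℝ => ∫⁻ y in U, h (p.1 + p.2 • (y - p.1)) :=
    Measurable.lintegral_prod_right' (f := fun q : (Plane × ℝ) × Plane =>
      h (q.1.1 + q.1.2 • (q.2 - q.1.1))) (by fun_prop)
  rw [lintegral_lintegral_swap hmeas.aemeasurable]
  calc _ ≤ ∫⁻ t in Set.Ioc (0 : ℝ) 1, 4 * volume U * ∫⁻ z in U, h z :=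
        setLIntegral_mono measurable_const fun t ht =>
          lintegral_lintegral_homothety_le hU hc ht.1.le ht.2 hh
    _ = _ := by rw [setLIntegral_const]; simp

/-- The weight t² cancels the Jacobian of the homothety. Thus the bound holds for each fixed x,
which is what turns the Taylor estimate into a uniform one. -/
theorem lintegral_weighted_segments_le {U : Set Plane} (hU : IsOpen U) (hc : Convex ℝ U)
    {h : Plane → ENNReal} (hh : Measurable h) {x : Plane} (hx : x ∈ U) :
    ∫⁻ y in U, ∫⁻ t in Set.Ioc (0 : ℝ) 1, ENNReal.ofReal (t ^ 2) * h (x + t • (y - x)) ≤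
      ∫⁻ z in U, h z := by
  rw [lintegral_lintegral_swap (by fun_prop)]
  calc _ ≤ ∫⁻ t in Set.Ioc (0 : ℝ) 1, ∫⁻ z in U, h z := by
        refine setLIntegral_mono measurable_const fun t ht => ?_
        rw [lintegral_const_mul _ (by fun_prop)]
        exact lintegral_homothety_le hU hc hx ht.1 ht.2 hh
    _ = _ := by rw [setLIntegral_const]; simp

theorem ofReal_setIntegral_Ioc {f : ℝ → ℝ} (hf : Continuous f) (h0 : ∀ t, 0 ≤ f t) :
    ENNReal.ofReal (∫ t in Set.Ioc (0 : ℝ) 1, f t) =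
      ∫⁻ t in Set.Ioc (0 : ℝ) 1, ENNReal.ofReal (f t) :=
  ofReal_integral_eq_lintegral_ofReal (hf.integrableOn_Icc.mono_set Set.Ioc_subset_Icc_self)
    (Eventually.of_forall h0)

section

variable {U : Set Plane}

theorem volume_real_pos (hU : IsOpen U) (hb : Bornology.IsBounded U) (hne : U.Nonempty) :
    0 < volume.real U :=
  ENNReal.toReal_pos (hU.measure_pos volume hne).ne' hb.measure_lt_top.ne

theorem continuous_integrableOn (hb : Bornology.IsBounded U) {f : Plane → ℝ} (hf : Continuous f) :
    IntegrableOn f U := by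
  have : IsFiniteMeasure (volume.restrict U) := ⟨by
    rw [Measure.restrict_apply_univ]; exact hb.measure_lt_top⟩
  exact (Continuous.memLp_of_isBounded hf hb).integrable (by norm_num)

theorem setIntegral_sum_sq (hb : Bornology.IsBounded U) {ι : Type*} [Fintype ι] {f : ι → Plane → ℝ}
    (hf : ∀ i, Continuous (f i)) :
    ∫ y in U, ∑ i, f i y ^ 2 = ∑ i, ∫ y in U, f i y ^ 2 :=
  integral_finsetSum _ fun i _ => continuous_integrableOn hb ((hf i).pow 2)

theorem sub_average_sq_le (hU : IsOpen U) (hb : Bornology.IsBounded U) (hne : U.Nonempty)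
    {f : Plane → ℝ} (hf : Continuous f) (a : ℝ) :
    volume.real U * (a - (volume.real U)⁻¹ * ∫ y in U, f y) ^ 2 ≤ ∫ y in U, (a - f y) ^ 2 := by
  have hm := volume_real_pos hU hb hne
  have h1 := sq_average_le hb (f := fun y => a - f y) (by fun_prop)
  rw [integral_sub (continuous_integrableOn hb continuous_const) (continuous_integrableOn hb hf),
    setIntegral_const, smul_eq_mul] at h1
  rw [← mul_le_mul_iff_right₀ hm]
  refine le_trans (le_of_eq ?_) h1
  field_simp

/-- The Poincaré inequality on a convex set. -/
theorem integral_sub_average_sq_le (hU : IsOpen U) (hc : Convex ℝ U) (hb : Bornology.IsBounded U)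
    (hne : U.Nonempty) {d : ℝ} (hd : ∀ x ∈ U, ∀ y ∈ U, dist x y ≤ d) {g : Plane → ℝ}
    (hg : ContDiff ℝ 1 g) :
    ∫ x in U, (g x - (volume.real U)⁻¹ * ∫ y in U, g y) ^ 2 ≤
      4 * d ^ 2 * ∑ k, ∫ x in U, pderiv k g x ^ 2 := by
  have hm := volume_real_pos hU hb hne
  have hcd : ∀ k, Continuous (pderiv k g) := continuous_pderiv hg
  have hgc := hg.continuous
  set A := (volume.real U)⁻¹ * ∫ y in U, g y
  set G : Plane → ℝ := fun x => ∑ k, pderiv k g x ^ 2 with hG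
  have hGc : Continuous G := by fun_prop
  have hG0 : ∀ x, 0 ≤ G x := fun x => Finset.sum_nonneg fun k _ => sq_nonneg _
  have hpt : ∀ x ∈ U, ENNReal.ofReal (volume.real U * (g x - A) ^ 2) ≤
      ∫⁻ y in U, ENNReal.ofReal (d ^ 2) *
        ∫⁻ t in Set.Ioc (0 : ℝ) 1, ENNReal.ofReal (G (x + t • (y - x))) := by
    intro x hx
    refine (ENNReal.ofReal_le_ofReal (sub_average_sq_le hU hb hne hgc (g x))).trans ?_
    rw [ofReal_setIntegral_sq hb (by fun_prop)]
    refine setLIntegral_mono' hU.measurableSet fun y hy => ?_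
    rw [← ofReal_setIntegral_Ioc (f := fun t => G (x + t • (y - x))) (by fun_prop)
      (fun t => hG0 _), ← ENNReal.ofReal_mul (sq_nonneg d)]
    refine ENNReal.ofReal_le_ofReal ((sq_sub_le hg x y).trans ?_)
    have : ‖y - x‖ ≤ d := by rw [← dist_eq_norm]; exact hd y hy x hx
    have h0 : 0 ≤ ∫ t in Set.Ioc (0 : ℝ) 1, G (x + t • (y - x)) := integral_nonneg fun t => hG0 _
    gcongr
  have hmeasG : Measurable fun x => ENNReal.ofReal (G x) := by fun_prop
  have hI : ENNReal.ofReal (volume.real U * ∫ x in U, (g x - A) ^ 2) ≤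
      ENNReal.ofReal (volume.real U * (4 * d ^ 2 * ∫ x in U, G x)) := by
    rw [ENNReal.ofReal_mul hm.le, ofReal_setIntegral_sq hb (by fun_prop),
      ← lintegral_const_mul _ (by fun_prop)]
    simp only [← ENNReal.ofReal_mul hm.le]
    refine (setLIntegral_mono' hU.measurableSet hpt).trans ?_
    have e1 : ∀ x, ∫⁻ y in U, ENNReal.ofReal (d ^ 2) *
        ∫⁻ t in Set.Ioc (0 : ℝ) 1, ENNReal.ofReal (G (x + t • (y - x))) =
        ENNReal.ofReal (d ^ 2) * ∫⁻ y in U,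
        ∫⁻ t in Set.Ioc (0 : ℝ) 1, ENNReal.ofReal (G (x + t • (y - x))) := fun x =>
      lintegral_const_mul' _ _ ENNReal.ofReal_ne_top
    simp only [e1]
    rw [lintegral_const_mul' _ _ ENNReal.ofReal_ne_top]
    calc _ ≤ ENNReal.ofReal (d ^ 2) * (4 * volume U * ∫⁻ z in U, ENNReal.ofReal (G z)) := by
          gcongr
          exact lintegral_segments_le hU hc hmeasG
      _ = _ := by
          rw [← ofReal_integral_eq_lintegral_ofReal (continuous_integrableOn hb hGc)
            (Eventually.of_forall hG0), show (4 : ENNReal) = ENNReal.ofReal 4 by simp,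
            ← ENNReal.ofReal_toReal hb.measure_lt_top.ne, ← ENNReal.ofReal_mul (by norm_num),
            ← ENNReal.ofReal_mul (by positivity), ← ENNReal.ofReal_mul (by positivity)]
          congr 1
          rw [measureReal_def]; ring
  have hG1 : ∫ x in U, G x = ∑ k, ∫ x in U, pderiv k g x ^ 2 := setIntegral_sum_sq hb hcd
  have hG2 : 0 ≤ ∫ x in U, G x := integral_nonneg hG0
  rw [ENNReal.ofReal_le_ofReal_iff (by positivity), mul_le_mul_iff_right₀ hm, hG1] at hI
  exact hI

/-- A smooth function on a bounded convex set is close to its averaged Taylor polynomial. -/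
theorem exists_affine_approx (hU : IsOpen U) (hc : Convex ℝ U) (hb : Bornology.IsBounded U)
    (hne : U.Nonempty) {d : ℝ} (hd : ∀ x ∈ U, ∀ y ∈ U, dist x y ≤ d) {φ : Plane → ℝ}
    (hφ : ContDiff ℝ ∞ φ) : ∃ T : Plane →ᵃ[ℝ] ℝ,
      (∀ x ∈ U, volume.real U * (φ x - T x) ^ 2 ≤
        d ^ 4 * ∑ k, ∑ l, ∫ x in U, pderiv l (pderiv k φ) x ^ 2) ∧
      ∀ k, ∫ x in U, (pderiv k φ x - pderiv k T x) ^ 2 ≤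
        4 * d ^ 2 * ∑ l, ∫ x in U, pderiv l (pderiv k φ) x ^ 2 := by
  have hm := volume_real_pos hU hb hne
  have hφc := hφ.continuous
  have hc1 : ∀ k, Continuous (pderiv k φ) := continuous_pderiv (contDiff_one hφ)
  have hc2 : ∀ k l, Continuous (pderiv l (pderiv k φ)) := fun k l =>
    continuous_pderiv (contDiff_one (contDiff_pderiv hφ k)) l
  set m := volume.real U with hmdef
  set b : Fin 2 → ℝ := fun k => m⁻¹ * ∫ y in U, pderiv k φ y with hbdef
  -- T is the mean over y of the first-order Taylor polynomials about y. Its gradient b is the mean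
  -- of ∇φ, so the gradient estimate is the Poincaré inequality for each partial derivative.
  set a : ℝ := m⁻¹ * ∫ y in U, (φ y - ∑ k, pderiv k φ y * y k) with hadef
  set T : Plane →ᵃ[ℝ] ℝ := AffineMap.const ℝ Plane a +
    (∑ k, b k • (EuclideanSpace.proj (𝕜 := ℝ) k : Plane →L[ℝ] ℝ)).toLinearMap.toAffineMap
  have hT : ∀ x, T x = a + ∑ k, b k * x k := fun x => by simp [T]
  have hTd : ∀ k x, pderiv k T x = b k := fun k x => by
    rw [pderiv_affine]
    fin_cases k <;> simp [T]
  set S : Plane → ℝ := fun x => ∑ k, ∑ l, pderiv l (pderiv k φ) x ^ 2 with hS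
  have hSc : Continuous S := by fun_prop
  have hS0 : ∀ x, 0 ≤ S x := fun x => Finset.sum_nonneg fun k _ =>
    Finset.sum_nonneg fun l _ => sq_nonneg _
  have hS1 : ∫ x in U, S x = ∑ k, ∑ l, ∫ x in U, pderiv l (pderiv k φ) x ^ 2 := by
    rw [integral_finsetSum _ fun k _ => continuous_integrableOn hb (by fun_prop)]
    exact Finset.sum_congr rfl fun k _ => setIntegral_sum_sq hb (hc2 k)
  refine ⟨T, fun x hx => ?_, fun k => ?_⟩
  · have hTx : T x = m⁻¹ * ∫ y in U, (φ y + ∑ k, pderiv k φ y * (x - y) k) := by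
      have e : ∀ y, φ y + ∑ k, pderiv k φ y * (x - y) k =
          (φ y - ∑ k, pderiv k φ y * y k) + ∑ k, pderiv k φ y * x k := fun y => by
        simp only [PiLp.sub_apply, mul_sub, Finset.sum_sub_distrib]; ring
      simp only [e]
      rw [integral_add (continuous_integrableOn hb (by fun_prop))
        (continuous_integrableOn hb (by fun_prop)),
        integral_finsetSum _ fun k _ => continuous_integrableOn hb (by fun_prop), mul_add, hT,
        Finset.mul_sum]
      congr 1
      refine Finset.sum_congr rfl fun k _ => ?_
      rw [integral_mul_const, ← mul_assoc]
    rw [hTx, ← hS1]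
    refine (sub_average_sq_le hU hb hne (f := fun y => φ y + ∑ k, pderiv k φ y * (x - y) k)
      (by fun_prop) (φ x)).trans ?_
    have hI2 : 0 ≤ ∫ x in U, S x := integral_nonneg hS0
    rw [← ENNReal.ofReal_le_ofReal_iff (by positivity), ofReal_setIntegral_sq hb (by fun_prop)]
    have hmeas : Measurable fun x => ENNReal.ofReal (S x) := by fun_prop
    calc _ ≤ ∫⁻ y in U, ENNReal.ofReal (d ^ 4) * ∫⁻ t in Set.Ioc (0 : ℝ) 1,
          ENNReal.ofReal (t ^ 2) * ENNReal.ofReal (S (x + t • (y - x))) := by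
          refine setLIntegral_mono' hU.measurableSet fun y hy => ?_
          have hn : ‖y - x‖ ≤ d := by rw [← dist_eq_norm]; exact hd y hy x hx
          have hd0 : 0 ≤ d := (norm_nonneg _).trans hn
          simp only [← ENNReal.ofReal_mul (sq_nonneg _)]
          rw [← ofReal_setIntegral_Ioc (f := fun t => t ^ 2 * S (x + t • (y - x))) (by fun_prop)
            (fun t => mul_nonneg (sq_nonneg _) (hS0 _)), ← ENNReal.ofReal_mul (by positivity)]
          rw [← sub_sub]
          refine ENNReal.ofReal_le_ofReal ((sq_taylor_le hφ x y).trans ?_)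
          have h0 : 0 ≤ ∫ t in Set.Ioc (0 : ℝ) 1, t ^ 2 * S (x + t • (y - x)) :=
            integral_nonneg fun t => mul_nonneg (sq_nonneg _) (hS0 _)
          gcongr
      _ ≤ ENNReal.ofReal (d ^ 4) * ∫⁻ z in U, ENNReal.ofReal (S z) := by
          rw [lintegral_const_mul' _ _ ENNReal.ofReal_ne_top]
          exact mul_le_mul_right (lintegral_weighted_segments_le hU hc hmeas hx) _
      _ = _ := by
          rw [← ofReal_integral_eq_lintegral_ofReal (continuous_integrableOn hb hSc)
            (Eventually.of_forall hS0), ← ENNReal.ofReal_mul (by positivity)]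
  · simp only [hTd]
    exact integral_sub_average_sq_le hU hc hb hne hd (contDiff_one (contDiff_pderiv hφ k))

end

/-! ### The interpolation error -/

theorem segMean_sub {f g : Plane → ℝ} (hf : Continuous f) (hg : Continuous g) (a b : Plane) :
    segMean a b (fun x => f x - g x) = segMean a b f - segMean a b g :=
  intervalIntegral.integral_sub
    (Continuous.intervalIntegrable (hf.comp (by fun_prop)) _ _)
    (Continuous.intervalIntegrable (hg.comp (by fun_prop)) _ _)

theorem abs_segMean_le {f : Plane → ℝ} {a b : Plane} {M : ℝ}
    (h : ∀ x ∈ segment ℝ a b, |f x| ≤ M) : |segMean a b f| ≤ M := by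
  have := intervalIntegral.norm_integral_le_of_norm_le_const (a := (0 : ℝ)) (b := 1) (C := M)
    (f := fun t : ℝ => f (AffineMap.lineMap a b t)) fun t ht => by
      rw [Set.uIoc_of_le zero_le_one] at ht
      refine h _ ?_
      rw [segment_eq_image_lineMap]
      exact ⟨t, ⟨ht.1.le, ht.2⟩, rfl⟩
  simpa [segMean] using this

theorem pderiv_sub {f g : Plane → ℝ} (hf : ContDiff ℝ ∞ f) (hg : ContDiff ℝ ∞ g) (k : Fin 2)
    (x : Plane) : pderiv k (fun x => f x - g x) x = pderiv k f x - pderiv k g x := by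
  unfold pderiv
  rw [fderiv_fun_sub ((contDiff_one hf).differentiable one_ne_zero x)
    ((contDiff_one hg).differentiable one_ne_zero x)]
  rfl

theorem abs_l2norm_sub_le {X : Type*} [MeasurableSpace X] {μ : Measure X} {f g : X → ℝ}
    (hf : MemLp f 2 μ) (hg : MemLp g 2 μ) :
    |l2norm μ f - l2norm μ g| ≤ l2norm μ (fun x => f x - g x) := by
  have h1 := l2norm_add_le (hf.sub hg) hg
  have h2 := l2norm_add_le (hg.sub hf) hf
  simp only [Pi.sub_apply, sub_add_cancel] at h1 h2
  have h3 : l2norm μ (f - g) = l2norm μ (fun x => f x - g x) := rfl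
  have h4 : l2norm μ (g - f) = l2norm μ (fun x => f x - g x) := l2norm_sub_comm
  rw [h3] at h1
  rw [h4] at h2
  rw [abs_le]; constructor <;> linarith

namespace Quad

variable (Q : Quad)

theorem diam_le : Metric.diam Q.carrier ≤ 4 * (‖Q.r‖ + ‖Q.s‖) := by
  refine Metric.diam_le_of_forall_dist_le (by positivity) fun x hx y hy => ?_
  obtain ⟨x1, x2⟩ := Q.abs_coord_le hx
  obtain ⟨y1, y2⟩ := Q.abs_coord_le hy
  have e : x - y = (Q.ξ x - Q.ξ y) • Q.r + (Q.η x - Q.η y) • Q.s := by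
    nth_rw 1 [Q.sub_O_eq x, Q.sub_O_eq y]
    module
  rw [dist_eq_norm, e]
  refine (norm_add_le _ _).trans ?_
  rw [norm_smul, norm_smul, mul_add, Real.norm_eq_abs, Real.norm_eq_abs]
  have h1 := abs_sub (Q.ξ x) (Q.ξ y)
  have h2 := abs_sub (Q.η x) (Q.η y)
  gcongr <;> linarith

/-- A side ratio of at most ρ gives |r|² ≤ ρ|r||s|, and |r||s| ≤ ρJ; the same holds for |s|². -/
theorem norm_add_sq_le {ρ : ℝ} (h : Q.regularity ≤ ρ) :
    (‖Q.r‖ + ‖Q.s‖) ^ 2 ≤ 4 * ρ ^ 2 * Q.jac := by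
  have hJ := Q.jac_pos
  have h1 : ‖Q.r‖ * ‖Q.s‖ / Q.jac ≤ ρ := (le_max_left _ _).trans h
  have h2 : ‖Q.r‖ / ‖Q.s‖ ≤ ρ := (le_max_left _ _).trans ((le_max_right _ _).trans h)
  have h3 : ‖Q.s‖ / ‖Q.r‖ ≤ ρ := (le_max_right _ _).trans ((le_max_right _ _).trans h)
  have h4 : 0 < ‖Q.r‖ * ‖Q.s‖ := hJ.trans_le ((le_abs_self _).trans (abs_cross_le _ _))
  have hr : 0 < ‖Q.r‖ := pos_of_mul_pos_left h4 (norm_nonneg _)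
  have hs : 0 < ‖Q.s‖ := pos_of_mul_pos_right h4 (norm_nonneg _)
  rw [div_le_iff₀ hJ] at h1
  rw [div_le_iff₀ hs] at h2
  rw [div_le_iff₀ hr] at h3
  have hρ : 0 < ρ := pos_of_mul_pos_left (hr.trans_le h2) hs.le
  have k1 : ‖Q.r‖ ^ 2 ≤ ρ * (ρ * Q.jac) := by nlinarith
  have k2 : ‖Q.s‖ ^ 2 ≤ ρ * (ρ * Q.jac) := by nlinarith
  nlinarith [sq_nonneg (‖Q.r‖ - ‖Q.s‖)]

theorem memLp_inner {f : Plane → ℝ} (hf : Continuous f) : MemLp f 2 (volume.restrict Q.inner) :=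
  Continuous.memLp_of_isBounded hf Q.isBounded_inner

theorem continuous_pderiv_shape (μ : Fin 4 → ℝ) (k : Fin 2) : Continuous (pderiv k (Q.shape μ)) :=
  continuous_pderiv (contDiff_one (Q.contDiff_shape μ)) k

theorem l2norm_pderiv_shape_le {μ : Fin 4 → ℝ} {M : ℝ} (hμ : ∀ i, |μ i| ≤ M) (k : Fin 2) :
    l2norm (volume.restrict Q.inner) (pderiv k (Q.shape μ)) ≤
      13 * M * ((‖Q.r‖ + ‖Q.s‖) / Q.jac) * Real.sqrt (volume.real Q.inner) := by
  have hfin : IsFiniteMeasure (volume.restrict Q.inner) := ⟨by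
    rw [Measure.restrict_apply_univ]; exact Q.isBounded_inner.measure_lt_top⟩
  have hM : 0 ≤ M := (abs_nonneg _).trans (hμ 0)
  have hJ := Q.jac_pos
  have := l2norm_le_of_bound (μ := volume.restrict Q.inner) (f := pderiv k (Q.shape μ))
    (B := 13 * M * ((‖Q.r‖ + ‖Q.s‖) / Q.jac)) (by positivity) (by
      filter_upwards [ae_restrict_mem Q.isOpen_inner.measurableSet] with x hx
      exact Q.abs_pderiv_shape_le hμ k (Q.inner_subset hx))
  simpa [measureReal_def] using this

/-- The affine T is subtracted from φ and from its interpolant. The Poincaré inequality gives the 2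
in the constant. The uniform bound M on φ − T passes to the edge averages and, through the shape
function bound, gives the 208ρ². -/
theorem l2norm_interp_error_le_of_contDiff {ρ : ℝ} (h : Q.regularity ≤ ρ) {φ : Plane → ℝ}
    (hφ : ContDiff ℝ ∞ φ) (k : Fin 2) :
    l2norm (volume.restrict Q.inner) (fun x => pderiv k φ x -
      pderiv k (Q.shape fun i => segMean (Q.a i) (Q.a (i + 1)) φ) x) ≤
      (2 + 208 * ρ ^ 2) * Metric.diam Q.carrier *
        Real.sqrt (∑ k, ∑ l, ∫ x in Q.inner, pderiv l (pderiv k φ) x ^ 2) := by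
  have hbc := Q.isCompact_carrier.isBounded
  have hd : ∀ x ∈ Q.inner, ∀ y ∈ Q.inner, dist x y ≤ Metric.diam Q.carrier := fun x hx y hy =>
    Metric.dist_le_diam_of_mem hbc (Q.inner_subset hx) (Q.inner_subset hy)
  obtain ⟨T, hT1, hT2⟩ := exists_affine_approx Q.isOpen_inner Q.convex_inner Q.isBounded_inner
    ⟨_, Q.center_mem_inner⟩ hd hφ
  have hm := volume_real_pos Q.isOpen_inner Q.isBounded_inner ⟨_, Q.center_mem_inner⟩
  set d := Metric.diam Q.carrier with hdd
  have hd0 : 0 ≤ d := Metric.diam_nonneg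
  set E := ∑ k, ∑ l, ∫ x in Q.inner, pderiv l (pderiv k φ) x ^ 2 with hE
  have hE0 : 0 ≤ E := Finset.sum_nonneg fun k _ => Finset.sum_nonneg fun l _ =>
    integral_sq_nonneg _ _
  set m := volume.real Q.inner
  set M := d ^ 2 * (Real.sqrt E / Real.sqrt m) with hM
  have hsm : 0 < Real.sqrt m := Real.sqrt_pos.2 hm
  have hM0 : 0 ≤ M := by positivity
  have hMm : M * Real.sqrt m = d ^ 2 * Real.sqrt E := by rw [hM]; field_simp
  have hTc : Continuous T := (contDiff_affine T (n := 1)).continuous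
  have hsup : ∀ x ∈ Q.carrier, |φ x - T x| ≤ M := by
    have h1 : Q.carrier ⊆ {x | |φ x - T x| ≤ M} := by
      rw [← Q.closure_inner]
      refine closure_minimal (fun x hx => ?_)
        (isClosed_le (by have := hφ.continuous; fun_prop) continuous_const)
      refine abs_le_of_sq_le_sq ?_ hM0
      have h2 := hT1 x hx
      have h3 : M ^ 2 = d ^ 4 * E / m := by
        rw [hM, mul_pow, div_pow, Real.sq_sqrt hE0, Real.sq_sqrt hm.le]; ring
      rw [h3, le_div_iff₀ hm, mul_comm]; exact h2
    exact h1
  set μ : Fin 4 → ℝ := fun i => segMean (Q.a i) (Q.a (i + 1)) φ with hμ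
  have hν : ∀ i, |μ i - T (Q.mid i)| ≤ M := fun i => by
    have e : T (Q.mid i) = segMean (Q.a i) (Q.a (i + 1)) T := by
      rw [segMean_affine, mid, affine_midpoint]
    rw [e, hμ, ← segMean_sub hφ.continuous hTc]
    exact abs_segMean_le fun x hx => hsup x (Q.edge_subset i hx)
  have hshape : ∀ x, pderiv k (Q.shape fun i => μ i - T (Q.mid i)) x =
      pderiv k (Q.shape μ) x - pderiv k T x := fun x => by
    have : (Q.shape fun i => μ i - T (Q.mid i)) = fun x => Q.shape μ x - T x := by
      ext x; rw [Q.shape_sub, Q.shape_of_affine]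
    rw [this, pderiv_sub (Q.contDiff_shape μ) (contDiff_affine T)]
  have hc1 : Continuous (pderiv k φ) := continuous_pderiv (contDiff_one hφ) k
  have hc2 : Continuous (pderiv k T) := continuous_pderiv (contDiff_affine T) k
  have t := l2norm_triangle (Q.memLp_inner hc1) (Q.memLp_inner hc2)
    (Q.memLp_inner (Q.continuous_pderiv_shape μ k))
  have t1 : l2norm (volume.restrict Q.inner) (fun x => pderiv k φ x - pderiv k T x) ≤
      2 * d * Real.sqrt E := by
    refine Real.sqrt_le_iff.2 ⟨by positivity, (hT2 k).trans ?_⟩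
    rw [mul_pow, Real.sq_sqrt hE0, show (2 * d) ^ 2 = 4 * d ^ 2 by ring]
    gcongr
    exact Finset.single_le_sum (f := fun k => ∑ l, ∫ x in Q.inner, pderiv l (pderiv k φ) x ^ 2)
      (fun k _ => Finset.sum_nonneg fun l _ => integral_sq_nonneg _ _) (Finset.mem_univ k)
  have t2 : l2norm (volume.restrict Q.inner) (fun x => pderiv k T x - pderiv k (Q.shape μ) x) ≤
      208 * ρ ^ 2 * d * Real.sqrt E := by
    rw [l2norm_sub_comm]
    simp only [← hshape]
    refine (Q.l2norm_pderiv_shape_le hν k).trans ?_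
    have hJ := Q.jac_pos
    have e : 13 * M * ((‖Q.r‖ + ‖Q.s‖) / Q.jac) * Real.sqrt m =
        13 * (d * ((‖Q.r‖ + ‖Q.s‖) / Q.jac)) * (d * Real.sqrt E) := by
      linear_combination 13 * ((‖Q.r‖ + ‖Q.s‖) / Q.jac) * hMm
    -- The diameter is at most 4(|r| + |s|), and (|r| + |s|)² ≤ 4ρ²J. Together with the 13 of the
    -- shape function bound this makes 13 · 16 = 208.
    have e2 : d * ((‖Q.r‖ + ‖Q.s‖) / Q.jac) ≤ 16 * ρ ^ 2 := by
      rw [← mul_div_assoc, div_le_iff₀ hJ]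
      have := Q.norm_add_sq_le h
      have h2 := mul_le_mul_of_nonneg_right Q.diam_le (add_nonneg (norm_nonneg Q.r) (norm_nonneg Q.s))
      rw [← hdd] at h2
      linarith
    rw [e]
    calc _ ≤ 13 * (16 * ρ ^ 2) * (d * Real.sqrt E) := by gcongr
      _ = _ := by ring
  calc _ ≤ 2 * d * Real.sqrt E + 208 * ρ ^ 2 * d * Real.sqrt E := t.trans (add_le_add t1 t2)
    _ = _ := by ring

/-- Limit passage along smooth functions converging in H². The interpolants converge because the
edge averages do, and there are only four of them. -/
theorem l2norm_interp_error_le {ρ : ℝ} (h : Q.regularity ≤ ρ) {v : Plane → ℝ}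
    (hv : MemH2 Q.inner v) (k : Fin 2) :
    l2norm (volume.restrict Q.inner) (fun x => wderiv Q.inner k v x - pderiv k (Q.interp v) x) ≤
      (2 + 208 * ρ ^ 2) * Metric.diam Q.carrier * semiH2 Q.inner v := by
  obtain ⟨φ, hφ, hφ1, hφ2⟩ := exists_smooth_approx Q.isOpen_inner Q.convex_inner Q.isBounded_inner
    ⟨_, Q.center_mem_inner⟩ hv
  have hmean : ∀ i, Tendsto (fun n => segMean (Q.a i) (Q.a (i + 1)) (φ n)) atTop
      (𝓝 (Q.edgeMean i v)) := fun i => by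
    have := Q.tendsto_segMean hv.1 hφ hφ1 i
    rwa [Q.edgeMean_eq ⟨hv.1, φ, hφ, hφ1, this⟩]
  set μ : Fin 4 → ℝ := fun i => Q.edgeMean i v with hμ
  set ν : ℕ → Fin 4 → ℝ := fun n i => segMean (Q.a i) (Q.a (i + 1)) (φ n) with hν
  rw [Q.interp_eq_shape]
  have hc1 : ∀ n, Continuous (pderiv k (φ n)) := fun n => continuous_pderiv (contDiff_one (hφ n)) k
  have hm0 := ((hv.1.wderiv_spec k).1)
  have hm1 := fun n => Q.memLp_inner (hc1 n)
  have hm2 := fun n => Q.memLp_inner (Q.continuous_pderiv_shape (ν n) k)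
  have hm3 := Q.memLp_inner (Q.continuous_pderiv_shape μ k)
  set S : ℕ → ℝ := fun n =>
    Real.sqrt (∑ k, ∑ l, ∫ x in Q.inner, pderiv l (pderiv k (φ n)) x ^ 2) with hS
  set M : ℕ → ℝ := fun n => ∑ i, |ν n i - μ i| with hM
  have hbound : ∀ n, l2norm (volume.restrict Q.inner)
      (fun x => wderiv Q.inner k v x - pderiv k (Q.shape μ) x) ≤
      l2norm (volume.restrict Q.inner) (fun x => pderiv k (φ n) x - wderiv Q.inner k v x) +
      ((2 + 208 * ρ ^ 2) * Metric.diam Q.carrier * S n +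
      13 * M n * ((‖Q.r‖ + ‖Q.s‖) / Q.jac) * Real.sqrt (volume.real Q.inner)) := by
    intro n
    have t1 := l2norm_triangle hm0 (hm1 n) hm3
    have t2 := l2norm_triangle (hm1 n) (hm2 n) hm3
    have b1 := Q.l2norm_interp_error_le_of_contDiff h (hφ n) k
    have b2 : l2norm (volume.restrict Q.inner) (fun x => pderiv k (Q.shape (ν n)) x -
        pderiv k (Q.shape μ) x) ≤
        13 * M n * ((‖Q.r‖ + ‖Q.s‖) / Q.jac) * Real.sqrt (volume.real Q.inner) := by
      have e : ∀ x, pderiv k (Q.shape (ν n)) x - pderiv k (Q.shape μ) x =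
          pderiv k (Q.shape fun i => ν n i - μ i) x := fun x => by
        have : (Q.shape fun i => ν n i - μ i) = fun x => Q.shape (ν n) x - Q.shape μ x :=
          funext fun x => Q.shape_sub _ _ x
        rw [this, pderiv_sub (Q.contDiff_shape _) (Q.contDiff_shape _)]
      simp only [e]
      exact Q.l2norm_pderiv_shape_le (fun i => Finset.single_le_sum
        (f := fun i => |ν n i - μ i|) (fun i _ => abs_nonneg _) (Finset.mem_univ i)) k
    rw [l2norm_sub_comm] at t1
    rw [l2norm_sub_comm (f := wderiv Q.inner k v)] at t1
    rw [l2norm_sub_comm (f := wderiv Q.inner k v) (g := pderiv k (Q.shape μ))]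
    linarith
  have hStend : Tendsto S atTop (𝓝 (semiH2 Q.inner v)) := by
    refine (Real.continuous_sqrt.tendsto _).comp ?_
    refine tendsto_finsetSum _ fun k _ => tendsto_finsetSum _ fun l _ => ?_
    simp only [← l2norm_sq]
    refine Tendsto.pow ?_ 2
    rw [tendsto_iff_dist_tendsto_zero]
    refine squeeze_zero (fun n => dist_nonneg) (fun n => ?_) (hφ2 k l)
    exact abs_l2norm_sub_le
      (Q.memLp_inner (continuous_pderiv (contDiff_one (contDiff_pderiv (hφ n) k)) l))
      ((hv.2 k).wderiv_spec l).1
  have hMtend : Tendsto M atTop (𝓝 0) := by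
    have : Tendsto M atTop (𝓝 (∑ i, |μ i - μ i|)) :=
      tendsto_finsetSum _ fun i _ => ((hmean i).sub_const (μ i)).abs
    simpa using this
  have hlim := (tendsto_l2norm_iff.2 (hφ1.2 k)).add
    ((hStend.const_mul ((2 + 208 * ρ ^ 2) * Metric.diam Q.carrier)).add
      (((hMtend.const_mul 13).mul_const ((‖Q.r‖ + ‖Q.s‖) / Q.jac)).mul_const
        (Real.sqrt (volume.real Q.inner))))
  have := ge_of_tendsto' hlim hbound
  simpa using this

end Quad

/-! ### Summation of the local errors over the cells. -/

namespace Subdivision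

variable {Ω : Set Plane} (G : Subdivision Ω)

theorem interp_eq {Q : Quad} (hQ : Q ∈ G.cells) (v : Plane → ℝ) {x : Plane} (hx : x ∈ Q.inner) :
    G.interp v x = Q.interp v x := by
  unfold interp
  rw [Finset.sum_eq_single_of_mem Q hQ, Set.indicator_of_mem hx]
  intro Q' hQ' hne
  refine Set.indicator_of_notMem (fun hx' => hne ?_) _
  exact (G.eq_of_mem_inner hQ hQ' hx (Q'.inner_subset hx')).symm

theorem interp_ae_eq {Q : Quad} (hQ : Q ∈ G.cells) (v : Plane → ℝ) :
    G.interp v =ᵐ[volume.restrict Q.inner] Q.interp v := by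
  filter_upwards [ae_restrict_mem Q.isOpen_inner.measurableSet] with x hx using G.interp_eq hQ v hx

theorem diam_le_meshSize {Q : Quad} (hQ : Q ∈ G.cells) : Metric.diam Q.carrier ≤ G.meshSize :=
  le_csSup (G.cells.finite_toSet.image _).bddAbove ⟨Q, hQ, rfl⟩

theorem sum_setIntegral_le (ho : IsOpen Ω) (hL : IsLipschitzDomain Ω) {f : Plane → ℝ}
    (hf : MemLp f 2 (volume.restrict Ω)) :
    ∑ Q ∈ G.cells, ∫ x in Q.inner, f x ^ 2 ≤ ∫ x in Ω, f x ^ 2 := by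
  have hsub : ⋃ Q ∈ G.cells, Q.inner ⊆ Ω := Set.iUnion₂_subset fun Q hQ =>
    G.inner_subset_domain ho hL hQ
  have hi : IntegrableOn (fun x => f x ^ 2) Ω := hf.integrable_sq
  rw [← integral_biUnion_finset _ (fun Q _ => Q.isOpen_inner.measurableSet) ?_
    fun Q hQ => hi.mono_set (G.inner_subset_domain ho hL hQ)]
  · exact setIntegral_mono_set hi (Eventually.of_forall fun _ => sq_nonneg _)
      (LE.le.eventuallyLE hsub)
  · intro Q hQ Q' hQ' hne
    exact Set.disjoint_left.2 fun x hx hx' =>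
      hne (G.eq_of_mem_inner hQ hQ' hx (Q'.inner_subset hx'))

theorem semiH1_interp_error_sq_le (ho : IsOpen Ω) (hL : IsLipschitzDomain Ω) {Q : Quad}
    (hQ : Q ∈ G.cells) {ρ : ℝ} (h : Q.regularity ≤ ρ) {v : Plane → ℝ} (hv : MemH2 Ω v) :
    semiH1 Q.inner (fun x => G.interp v x - v x) ^ 2 ≤
      2 * ((2 + 208 * ρ ^ 2) * G.meshSize) ^ 2 *
        ∑ k, ∑ l, ∫ x in Q.inner, wderiv Ω l (wderiv Ω k v) x ^ 2 := by
  have hsub := G.inner_subset_domain ho hL hQ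
  have hvQ := hv.mono Q.isOpen_inner hsub
  have hinteg : ContDiff ℝ ∞ (Q.interp v) := by rw [Q.interp_eq_shape]; exact Q.contDiff_shape _
  have hcont := hinteg.continuous
  have hd : ∀ k, wderiv Q.inner k (fun x => G.interp v x - v x) =ᵐ[volume.restrict Q.inner]
      fun x => pderiv k (Q.interp v) x - wderiv Q.inner k v x := fun k => by
    refine IsWeakDeriv.wderiv_ae_eq Q.isOpen_inner ?_
    have h1 := isWeakDeriv_of_contDiff (contDiff_one hinteg) Q.isBounded_inner k
    have h2 := h1.sub (hvQ.1.wderiv_spec k) (Q.memLp_inner hcont) hvQ.1.1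
    refine h2.congr ?_ (ae_eq_refl _)
    filter_upwards [G.interp_ae_eq hQ v] with x hx
    rw [hx]
  have hE0 : semiH2 Q.inner v ^ 2 =
      ∑ k, ∑ l, ∫ x in Q.inner, wderiv Ω l (wderiv Ω k v) x ^ 2 := by
    rw [semiH2, Real.sq_sqrt (Finset.sum_nonneg fun k _ => Finset.sum_nonneg fun l _ =>
      integral_sq_nonneg _ _)]
    refine Finset.sum_congr rfl fun k _ => Finset.sum_congr rfl fun l _ => ?_
    refine integral_congr_ae ?_
    filter_upwards [hv.wderiv_mono Q.isOpen_inner hsub k l] with x hx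
    rw [hx]
  rw [semiH1, Real.sq_sqrt (Finset.sum_nonneg fun k _ => integral_sq_nonneg _ _), ← hE0]
  have hk : ∀ k, ∫ x in Q.inner, wderiv Q.inner k (fun x => G.interp v x - v x) x ^ 2 ≤
      ((2 + 208 * ρ ^ 2) * G.meshSize) ^ 2 * semiH2 Q.inner v ^ 2 := fun k => by
    rw [← l2norm_sq, l2norm_congr (hd k), l2norm_sub_comm, ← mul_pow]
    refine pow_le_pow_left₀ (l2norm_nonneg _ _) ((Q.l2norm_interp_error_le h hvQ k).trans ?_) 2
    have h0 : 0 ≤ semiH2 Q.inner v := Real.sqrt_nonneg _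
    have := G.diam_le_meshSize hQ
    gcongr
  rw [Fin.sum_univ_two]
  linarith [hk 0, hk 1]

/-- The interpolation error bound. -/
theorem brokenSemiH1_interp_error_le (ho : IsOpen Ω) (hL : IsLipschitzDomain Ω) {ρ : ℝ}
    (h : ∀ Q ∈ G.cells, Q.regularity ≤ ρ) {v : Plane → ℝ} (hv : MemH2 Ω v) :
    G.brokenSemiH1 (fun x => G.interp v x - v x) ≤
      2 * (2 + 208 * ρ ^ 2) * G.meshSize * semiH2 Ω v := by
  have hh : 0 ≤ G.meshSize := by
    refine Real.sSup_nonneg ?_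
    rintro _ ⟨Q, -, rfl⟩
    exact Metric.diam_nonneg
  have h0 : 0 ≤ semiH2 Ω v := Real.sqrt_nonneg _
  have hsq : semiH2 Ω v ^ 2 = ∑ k, ∑ l, ∫ x in Ω, wderiv Ω l (wderiv Ω k v) x ^ 2 :=
    Real.sq_sqrt (Finset.sum_nonneg fun k _ => Finset.sum_nonneg fun l _ => integral_sq_nonneg _ _)
  refine Real.sqrt_le_iff.2 ⟨by positivity, ?_⟩
  have h1 : ∑ Q ∈ G.cells, ∑ k, ∑ l, ∫ x in Q.inner, wderiv Ω l (wderiv Ω k v) x ^ 2 ≤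
      semiH2 Ω v ^ 2 := by
    rw [hsq, Finset.sum_comm]
    refine Finset.sum_le_sum fun k _ => ?_
    rw [Finset.sum_comm]
    exact Finset.sum_le_sum fun l _ =>
      G.sum_setIntegral_le ho hL ((hv.2 k).wderiv_spec l).1
  -- The factor 2 stems from adding the two partial derivatives; it is relaxed to 4, a perfect
  -- square.
  calc _ ≤ ∑ Q ∈ G.cells, 2 * ((2 + 208 * ρ ^ 2) * G.meshSize) ^ 2 *
        ∑ k, ∑ l, ∫ x in Q.inner, wderiv Ω l (wderiv Ω k v) x ^ 2 :=
        Finset.sum_le_sum fun Q hQ => G.semiH1_interp_error_sq_le ho hL hQ (h Q hQ) hv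
    _ ≤ 4 * ((2 + 208 * ρ ^ 2) * G.meshSize) ^ 2 * semiH2 Ω v ^ 2 := by
        rw [← Finset.mul_sum]
        gcongr
        norm_num
    _ = _ := by ring

end Subdivision

/-! ### Lipschitz functions in `H¹₀` -/

section

variable {f : Plane → ℝ} {K : NNReal}

theorem measurable_pderiv (f : Plane → ℝ) (k : Fin 2) : Measurable (pderiv k f) :=
  measurable_fderiv_apply_const ℝ f _

theorem abs_pderiv_le_of_lipschitz (hf : LipschitzWith K f) (k : Fin 2) (x : Plane) :
    |pderiv k f x| ≤ K := by
  have h1 := norm_fderiv_le_of_lipschitz ℝ hf (x₀ := x)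
  have h2 := (fderiv ℝ f x).le_opNorm (unitVec k)
  have n1 : ‖unitVec k‖ = 1 := by simp
  rw [n1, mul_one] at h2
  exact h2.trans h1

/-- By Rademacher's theorem the classical derivative exists a.e., and integration by parts for
Lipschitz functions makes it the weak one. -/
theorem integral_mul_pderiv_of_lipschitz (hf : LipschitzWith K f) {φ : Plane → ℝ}
    {U : Set Plane} (hφ : IsTestFunction U φ) (k : Fin 2) :
    ∫ x, f x * pderiv k φ x = -∫ x, pderiv k f x * φ x := by
  have h1 := contDiff_one hφ.1
  obtain ⟨D, hD⟩ := h1.lipschitzWith_of_hasCompactSupport hφ.2.1 one_ne_zero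
  have h2 := hf.integral_lineDeriv_mul_eq (μ := volume) hD hφ.2.1 (unitVec k)
  have e1 : ∫ x, lineDeriv ℝ f x (unitVec k) * φ x = ∫ x, pderiv k f x * φ x := by
    refine integral_congr_ae ?_
    filter_upwards [hf.ae_differentiableAt (μ := volume)] with x hx
    rw [hx.lineDeriv_eq_fderiv]; rfl
  have e2 : ∀ x, lineDeriv ℝ φ x (-unitVec k) * f x = -(f x * pderiv k φ x) := fun x => by
    rw [(h1.differentiable one_ne_zero x).lineDeriv_eq_fderiv, map_neg, mul_comm, mul_neg]; rfl
  rw [e1] at h2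
  simp only [e2, integral_neg] at h2
  rw [h2, neg_neg]

theorem memLp_pderiv_of_lipschitz (hf : LipschitzWith K f) {U : Set Plane}
    (hU : Bornology.IsBounded U) (k : Fin 2) : MemLp (pderiv k f) 2 (volume.restrict U) := by
  have : IsFiniteMeasure (volume.restrict U) := ⟨by
    rw [Measure.restrict_apply_univ]; exact hU.measure_lt_top⟩
  exact MemLp.of_bound (measurable_pderiv f k).aestronglyMeasurable K
    (Eventually.of_forall fun x => abs_pderiv_le_of_lipschitz hf k x)

theorem isWeakDeriv_of_lipschitz (hf : LipschitzWith K f) {U : Set Plane}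
    (hU : Bornology.IsBounded U) (k : Fin 2) : IsWeakDeriv U k f (pderiv k f) := by
  refine ⟨memLp_pderiv_of_lipschitz hf hU k, fun φ hφ => ?_⟩
  rw [hφ.setIntegral_mul, (hφ.pderiv k).setIntegral_mul]
  exact integral_mul_pderiv_of_lipschitz hf hφ k

theorem pderiv_eq_zero_of_eventuallyEq {c : ℝ} {k : Fin 2} {x : Plane}
    (h : f =ᶠ[𝓝 x] fun _ => c) : pderiv k f x = 0 := by
  rw [pderiv, h.fderiv_eq]; simp

/-- A compactly supported Lipschitz function is a limit of test functions. -/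
theorem exists_isTestFunction_of_hasCompactSupport (hf : LipschitzWith K f) {U : Set Plane}
    (hU : IsOpen U) (hb : Bornology.IsBounded U) (hc : HasCompactSupport f) (hs : tsupport f ⊆ U)
    {ε : ℝ} (hε : 0 < ε) : ∃ φ, IsTestFunction U φ ∧
      l2norm (volume.restrict U) (fun x => φ x - f x) < ε ∧
      ∀ k, l2norm (volume.restrict U) (fun x => pderiv k φ x - pderiv k f x) < ε := by
  obtain ⟨δ, hδ, hδU⟩ := hc.isCompact.exists_cthickening_subset_open hU hs
  have hinv : Tendsto (fun n : ℕ => δ / ((n : ℝ) + 1)) atTop (𝓝 0) :=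
    tendsto_const_nhds.div_atTop
      (tendsto_atTop_add_const_right _ _ tendsto_natCast_atTop_atTop)
  set φ : ℕ → ContDiffBump (0 : Plane) := fun n =>
    ⟨δ / ((n : ℝ) + 1) / 2, δ / ((n : ℝ) + 1), by positivity, half_lt_self (by positivity)⟩
  have hm0 : MemLp f 2 volume := hf.continuous.memLp_of_hasCompactSupport hc
  have hloc : LocallyIntegrable f := hf.continuous.locallyIntegrable
  have hm1 : ∀ k, MemLp (pderiv k f) 2 volume := fun k => by
    have hz : ∀ x, x ∉ tsupport f → pderiv k f x = 0 := fun x hx =>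
      pderiv_eq_zero_of_eventuallyEq (c := 0) (notMem_tsupport_iff_eventuallyEq.1 hx)
    have e : pderiv k f = (tsupport f).indicator (pderiv k f) := by
      ext x
      by_cases hx : x ∈ tsupport f
      · rw [Set.indicator_of_mem hx]
      · rw [Set.indicator_of_notMem hx, hz x hx]
    rw [e]
    exact MemLp.indicator_restrict (isClosed_tsupport f).measurableSet
      (memLp_pderiv_of_lipschitz hf hc.isCompact.isBounded k)
  have hw : ∀ k, IsWeakDeriv Set.univ k f (pderiv k f) := fun k => by
    refine ⟨by rw [Measure.restrict_univ]; exact hm1 k, fun ψ hψ => ?_⟩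
    rw [Measure.restrict_univ]
    exact integral_mul_pderiv_of_lipschitz hf hψ k
  have hlim : ∀ g : Plane → ℝ, MemLp g 2 volume → Tendsto (fun n => l2norm (volume.restrict U)
      (fun x => mollify (φ n) g x - g x)) atTop (𝓝 0) := fun g hg => by
    have := tendsto_mollify_dilate hb hg (φ := φ) hinv (s := fun _ => 1) tendsto_const_nhds 0
    simpa using this
  have ev := ((hlim f hm0).eventually_lt_const hε).and (eventually_all.2 fun k =>
    (hlim _ (hm1 k)).eventually_lt_const hε)
  obtain ⟨n, hn1, hn2⟩ := ev.exists
  have hsupp : tsupport (mollify (φ n) f) ⊆ Metric.cthickening δ (tsupport f) := by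
    refine closure_minimal (fun x hx => ?_) Metric.isClosed_cthickening
    by_contra hxn
    refine hx ?_
    rw [mollify_apply']
    refine integral_eq_zero_of_ae (Eventually.of_forall fun t => ?_)
    by_cases ht : t ∈ Function.support ((φ n).normed volume)
    · rw [(φ n).support_normed_eq, Metric.mem_ball, dist_zero_right] at ht
      have hle : (φ n).rOut ≤ δ := div_le_self hδ.le (by linarith [n.cast_nonneg (α := ℝ)])
      have : f (x - t) = 0 := by
        by_contra hne
        refine hxn (Metric.mem_cthickening_of_dist_le x (x - t) δ _ (subset_closure hne) ?_)
        rw [dist_eq_norm, sub_sub_cancel]; linarith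
      simp [this]
    · simp [Function.notMem_support.1 ht]
  refine ⟨mollify (φ n) f, ⟨contDiff_mollify (φ n) hloc, ?_, hsupp.trans hδU⟩, hn1, fun k => ?_⟩
  · exact (hc.isCompact.cthickening (r := δ)).of_isClosed_subset (isClosed_tsupport _) hsupp
  · have := hn2 k
    simp only [← pderiv_mollify (φ n) hloc (hw k) (Set.subset_univ _)] at this
    exact this

/-- A Lipschitz function that vanishes off the bounded open set `U`, and that almost everywhere in
`U` either is nonzero or vanishes locally, belongs to `H¹₀(U)`. -/
theorem memH10_of_lipschitz (hf : LipschitzWith K f) {U : Set Plane} (hU : IsOpen U)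
    (hb : Bornology.IsBounded U) (hz : ∀ x ∉ U, f x = 0)
    (hloc : ∀ᵐ x ∂(volume.restrict U), f x ≠ 0 ∨ f =ᶠ[𝓝 x] fun _ => 0) : MemH10 U f := by
  have hfin : IsFiniteMeasure (volume.restrict U) := ⟨by
    rw [Measure.restrict_apply_univ]; exact hb.measure_lt_top⟩
  have hfc := hf.continuous
  have hm0 : MemLp f 2 (volume.restrict U) := Continuous.memLp_of_isBounded hfc hb
  have hm1 : ∀ k, MemLp (pderiv k f) 2 (volume.restrict U) := memLp_pderiv_of_lipschitz hf hb
  have hw := isWeakDeriv_of_lipschitz hf hb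
  set ε : ℕ → ℝ := fun n => 1 / ((n : ℝ) + 1)
  have hε : ∀ n, 0 < ε n := fun n => Nat.one_div_pos_of_nat
  have hε0 : Tendsto ε atTop (𝓝 0) := tendsto_one_div_add_atTop_nhds_zero_nat
  -- The truncation of f to [−ε, ε]. The remainder f − g is supported where |f| ≥ ε, a compact
  -- subset of U, so it can be mollified inside U. No regularity of the boundary is needed.
  set g : ℕ → Plane → ℝ := fun n x => max (-ε n) (min (ε n) (f x)) with hg
  have hgl : ∀ n, LipschitzWith K (g n) := fun n => (hf.const_min (ε n)).const_max (-ε n)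
  have hgb : ∀ n x, |g n x| ≤ ε n := fun n x => by
    rw [abs_le]
    exact ⟨le_max_left _ _, max_le (by linarith [hε n]) (min_le_left _ _)⟩
  set h : ℕ → Plane → ℝ := fun n x => f x - g n x with hh
  have hhl : ∀ n, LipschitzWith (K + K) (h n) := fun n => hf.sub (hgl n)
  have hhs : ∀ n, tsupport (h n) ⊆ {x | ε n ≤ |f x|} := fun n => by
    refine closure_minimal (fun x hx => ?_) (isClosed_le continuous_const hfc.abs)
    by_contra hlt
    have hlt : |f x| < ε n := not_le.1 hlt
    have := abs_lt.1 hlt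
    refine hx ?_
    simp only [hh, hg]
    rw [min_eq_right this.2.le, max_eq_right this.1.le, sub_self]
  have hsU : ∀ n, {x | ε n ≤ |f x|} ⊆ U := fun n x hx => by
    by_contra hxU
    have hx : ε n ≤ |f x| := hx
    rw [hz x hxU, abs_zero] at hx
    exact absurd hx (not_le.2 (hε n))
  have hhc : ∀ n, HasCompactSupport (h n) := fun n =>
    Metric.isCompact_of_isClosed_isBounded (isClosed_tsupport _)
      (hb.subset ((hhs n).trans (hsU n)))
  choose φ hφt hφ0 hφ1 using fun n => exists_isTestFunction_of_hasCompactSupport (hhl n) hU hb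
    (hhc n) ((hhs n).trans (hsU n)) (hε n)
  refine ⟨⟨hm0, fun k => ⟨_, hw k⟩⟩, φ, hφt, ?_, fun k => ?_⟩
  · refine tendsto_l2norm_iff.1 ?_
    have hlim : Tendsto (fun n => ε n + ε n * Real.sqrt ((volume.restrict U).real Set.univ)) atTop
        (𝓝 0) := by simpa using hε0.add (hε0.mul_const _)
    refine squeeze_zero (fun n => l2norm_nonneg _ _) (fun n => ?_) hlim
    have t := l2norm_triangle ((hφt n).memLp (volume.restrict U))
      (Continuous.memLp_of_isBounded (hhl n).continuous hb) hm0
    refine t.trans (add_le_add (hφ0 n).le (l2norm_le_of_bound (hε n).le ?_))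
    refine Eventually.of_forall fun x => ?_
    simp only [hh, sub_sub_cancel_left, abs_neg]
    exact hgb n x
  · refine tendsto_l2norm_iff.1 ?_
    -- Where f ≠ 0 the truncation is locally constant once ε < |f|; where f vanishes locally it is
    -- zero. So its gradient tends to zero a.e., dominated by the Lipschitz constant.
    have hgt : Tendsto (fun n => l2norm (volume.restrict U) (pderiv k (g n))) atTop (𝓝 0) := by
      rw [tendsto_l2norm_iff]
      have := tendsto_integral_of_dominated_convergence (μ := volume.restrict U)
        (F := fun n x => pderiv k (g n) x ^ 2) (f := fun _ => 0) (fun _ => (K : ℝ) ^ 2)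
        (fun n => ((measurable_pderiv (g n) k).pow_const 2).aestronglyMeasurable)
        (integrable_const _) (fun n => Eventually.of_forall fun x => by
          rw [norm_pow, Real.norm_eq_abs]
          gcongr
          exact abs_pderiv_le_of_lipschitz (hgl n) k x) ?_
      · simpa using this
      filter_upwards [hloc] with x hx
      refine tendsto_const_nhds.congr' ?_
      rcases hx with hx | hx
      · have hpos : 0 < |f x| := abs_pos.2 hx
        filter_upwards [hε0.eventually_lt_const hpos] with n hn
        have : pderiv k (g n) x = 0 := by
          rcases lt_abs.1 hn with h1 | h1
          · refine pderiv_eq_zero_of_eventuallyEq (c := ε n) ?_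
            filter_upwards [hfc.continuousAt.eventually_const_lt h1] with y hy
            simp only [hg]
            rw [min_eq_left hy.le, max_eq_right (by linarith [hε n])]
          · refine pderiv_eq_zero_of_eventuallyEq (c := -ε n) ?_
            filter_upwards [hfc.continuousAt.eventually_lt_const (show f x < -ε n by linarith)]
              with y hy
            simp only [hg]
            rw [min_eq_right (by linarith [hε n]), max_eq_left hy.le]
        rw [this]; norm_num
      · refine Eventually.of_forall fun n => ?_
        have : pderiv k (g n) x = 0 := by
          refine pderiv_eq_zero_of_eventuallyEq (c := 0) ?_
          filter_upwards [hx] with y hy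
          simp only [hg, hy]
          rw [min_eq_right (hε n).le, max_eq_right (by linarith [hε n])]
        beta_reduce
        rw [this]; norm_num
    have hlim : Tendsto (fun n => ε n + l2norm (volume.restrict U) (pderiv k (g n))) atTop
        (𝓝 0) := by simpa using hε0.add hgt
    refine squeeze_zero (fun n => l2norm_nonneg _ _) (fun n => ?_) hlim
    have hwe := (hw k).wderiv_ae_eq hU
    have e1 : l2norm (volume.restrict U) (fun x => pderiv k (φ n) x - wderiv U k f x) =
        l2norm (volume.restrict U) (fun x => pderiv k (φ n) x - pderiv k f x) :=
      l2norm_congr (hwe.mono fun x hx => by simp only [hx])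
    rw [e1]
    have t := l2norm_triangle (((hφt n).pderiv k).memLp (volume.restrict U))
      (memLp_pderiv_of_lipschitz (hhl n) hb k) (hm1 k)
    refine t.trans (add_le_add (hφ1 n k).le (le_of_eq ?_))
    rw [← l2norm_neg]
    refine l2norm_congr ?_
    filter_upwards [ae_restrict_of_ae (hf.ae_differentiableAt (μ := volume)),
      ae_restrict_of_ae ((hgl n).ae_differentiableAt (μ := volume))] with x h1 h2
    simp only [hh, pderiv]
    rw [fderiv_fun_sub h1 h2]
    simp

end

/-! ### Continuous piecewise linear functions -/

/-- Induction on the number of sets. Take a set containing a and its last point c in the interval;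
the increment up to c is controlled, and beyond c this set is no longer needed. -/
theorem abs_sub_le_of_closed_cover {ι : Type*} {C : ι → Set ℝ} (hC : ∀ i, IsClosed (C i))
    {g : ℝ → ℝ} {K : ℝ} (s : Finset ι) : ∀ a b : ℝ, a ≤ b → Set.Icc a b ⊆ ⋃ i ∈ s, C i →
      (∀ i ∈ s, ∀ t ∈ C i, ∀ t' ∈ C i, |g t - g t'| ≤ K * |t - t'|) →
        |g b - g a| ≤ K * (b - a) := by
  classical
  induction s using Finset.strongInduction with
  | H s ih =>
    intro a b hab hcov hg
    obtain ⟨i, hi, hai⟩ : ∃ i ∈ s, a ∈ C i := by simpa using hcov ⟨le_rfl, hab⟩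
    have hK : IsCompact (C i ∩ Set.Icc a b) := isCompact_Icc.inter_left (hC i)
    obtain ⟨c, ⟨hci, hac, hcb⟩, hmax⟩ := hK.exists_isGreatest ⟨a, hai, le_rfl, hab⟩
    have h1 := hg i hi c hci a hai
    rw [abs_of_nonneg (sub_nonneg.2 hac)] at h1
    rcases hcb.eq_or_lt with rfl | hlt
    · exact h1
    -- The remaining sets cover the half-open interval beyond c. Their finite union is closed, so it
    -- also contains c.
    have hcov' : Set.Icc c b ⊆ ⋃ j ∈ s.erase i, C j := by
      rw [← closure_Ioc hlt.ne]
      refine closure_minimal (fun t ht => ?_) (isClosed_biUnion_finset fun j _ => hC j)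
      obtain ⟨j, hj, htj⟩ : ∃ j ∈ s, t ∈ C j := by
        simpa using hcov ⟨hac.trans ht.1.le, ht.2⟩
      have hne : j ≠ i := by
        rintro rfl
        exact absurd (hmax ⟨htj, hac.trans ht.1.le, ht.2⟩) (not_le.2 ht.1)
      simp only [Set.mem_iUnion]
      exact ⟨j, Finset.mem_erase.2 ⟨hne, hj⟩, htj⟩
    have h2 := ih (s.erase i) (Finset.erase_ssubset hi) c b hcb hcov' fun j hj =>
      hg j (Finset.mem_of_mem_erase hj)
    have h3 := abs_sub_le (g b) (g c) (g a)
    linarith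

/-- A function on the plane that is Lipschitz on each set of a finite closed cover is Lipschitz. -/
theorem lipschitzWith_of_closed_cover {ι : Type*} {C : ι → Set Plane} (hC : ∀ i, IsClosed (C i))
    (s : Finset ι) (hcov : ∀ x, ∃ i ∈ s, x ∈ C i) {f : Plane → ℝ} {K : NNReal}
    (hf : ∀ i ∈ s, LipschitzOnWith K f (C i)) : LipschitzWith K f := by
  refine LipschitzWith.of_dist_le_mul fun x y => ?_
  have h := abs_sub_le_of_closed_cover (C := fun i => AffineMap.lineMap y x ⁻¹' C i)
    (g := fun t : ℝ => f (AffineMap.lineMap y x t)) (K := K * dist x y)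
    (fun i => (hC i).preimage (by fun_prop)) s 0 1 zero_le_one (fun t _ => by
      obtain ⟨i, hi, h⟩ := hcov (AffineMap.lineMap y x t)
      simp only [Set.mem_iUnion]
      exact ⟨i, hi, h⟩) (fun i hi t ht t' ht' => by
      have := (hf i hi).dist_le_mul _ ht _ ht'
      rw [dist_lineMap_lineMap, Real.dist_eq, Real.dist_eq, dist_comm y x] at this
      linarith)
  simpa [Real.dist_eq] using h

theorem exists_lipschitzWith_affine (l : Plane →ᵃ[ℝ] ℝ) : ∃ K, LipschitzWith K l := by
  have : (l : Plane → ℝ) = fun x => l.linear.toContinuousLinearMap x + l 0 := by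
    ext x
    simpa using congrFun (AffineMap.decomp l) x
  rw [this]
  exact ⟨_, l.linear.toContinuousLinearMap.lipschitz.add (LipschitzWith.const (l 0))⟩

namespace Quad

variable (Q : Quad) (f : Fin 4 → ℝ) (z : ℝ)

/-- The function with values `f` at the vertices and `z` at the centre that is linear on the four
triangles of the cell. -/
def pl (x : Plane) : ℝ := z + ∑ i, Q.bary i x * (f i - z)

/-- The affine function that `Q.pl f z` agrees with on the triangle at the edge `eᵢ`. -/
def plAff (i : Fin 4) : Plane →ᵃ[ℝ] ℝ :=
  AffineMap.const ℝ Plane z + (f i - z) • Q.baryAff i + (f (i + 1) - z) • Q.baryAff (i + 1)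

theorem plAff_apply (i : Fin 4) (x : Plane) : Q.plAff f z i x =
    z + Q.baryAff i x * (f i - z) + Q.baryAff (i + 1) x * (f (i + 1) - z) := by
  simp [plAff]; ring

theorem plAff_left (i : Fin 4) : Q.plAff f z i (Q.a i) = f i := by
  rw [plAff_apply, baryAff_self, baryAff_succ_left]; ring

theorem plAff_right (i : Fin 4) : Q.plAff f z i (Q.a (i + 1)) = f (i + 1) := by
  rw [plAff_apply, baryAff_self, baryAff_succ]; ring

theorem plAff_center (i : Fin 4) : Q.plAff f z i Q.diagCross = z := by
  rw [plAff_apply, baryAff_center, baryAff_center]; ring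

variable {Q}

theorem pl_eq_of_sector {i : Fin 4} {x : Plane} (h2 : Q.bary (i + 2) x = 0)
    (h3 : Q.bary (i + 3) x = 0) : Q.pl f z x = Q.plAff f z i x := by
  have e1 := Q.bary_eq_of_opp i x h2
  have e2 := Q.bary_eq_of_opp (i + 1) x (by rwa [show i + 1 + 2 = i + 3 by fin_cases i <;> rfl])
  have : ∑ j, Q.bary j x * (f j - z) = Q.bary i x * (f i - z) +
      Q.bary (i + 1) x * (f (i + 1) - z) + Q.bary (i + 2) x * (f (i + 2) - z) +
      Q.bary (i + 3) x * (f (i + 3) - z) := by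
    rw [Fin.sum_univ_four]; fin_cases i <;> simp <;> ring
  rw [pl, this, h2, h3, plAff_apply, e1, e2]; ring

theorem sector_of_mem_hull {i : Fin 4} {x : Plane}
    (hx : x ∈ convexHull ℝ (Set.range ![Q.diagCross, Q.a i, Q.a (i + 1)])) :
    Q.bary (i + 2) x = 0 ∧ Q.bary (i + 3) x = 0 := by
  have key : ∀ j, j ≠ i → j ≠ i + 1 → Q.bary j x = 0 := by
    intro j h1 h2
    have h : convexHull ℝ (Set.range ![Q.diagCross, Q.a i, Q.a (i + 1)]) ⊆
        {x ∈ Set.univ | Q.bary j x ≤ 0} := by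
      refine convexHull_min ?_ ((Q.convexOn_bary j).convex_le 0)
      rintro _ ⟨k, rfl⟩
      refine ⟨trivial, le_of_eq ?_⟩
      fin_cases k
      · exact Q.bary_center j
      · simp [bary_apply_vertex, h1]
      · simp [bary_apply_vertex, h2]
    exact le_antisymm (h hx).2 (Q.bary_nonneg j x)
  exact ⟨key _ (by fin_cases i <;> decide) (by fin_cases i <;> decide),
    key _ (by fin_cases i <;> decide) (by fin_cases i <;> decide)⟩

theorem pl_eq_of_mem_tri {i : Fin 4} {x : Plane} (hx : x ∈ Q.tri i) :
    Q.pl f z x = Q.plAff f z i x := by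
  obtain ⟨h2, h3, -⟩ := Q.bary_of_mem_tri hx
  exact pl_eq_of_sector f z h2 h3

theorem pl_edge (i : Fin 4) {s t : ℝ} (hs : 0 ≤ s) (ht : 0 ≤ t) (hst : s + t = 1) :
    Q.pl f z (s • Q.a i + t • Q.a (i + 1)) = s * f i + t * f (i + 1) := by
  obtain ⟨-, h2, h3⟩ := Q.mem_edge_iff.1 ⟨s, t, hs, ht, hst, rfl⟩
  rw [pl_eq_of_sector f z h2 h3, affine_combo _ _ _ hst, plAff_left, plAff_right]

theorem pl_vertex (i : Fin 4) : Q.pl f z (Q.a i) = f i := by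
  have := pl_edge (Q := Q) f z i zero_le_one le_rfl (add_zero 1)
  simpa using this

variable (Q)

theorem exists_lipschitzWith_pl : ∃ K, LipschitzWith K (Q.pl f z) := by
  have h : ∀ i, ∃ K, LipschitzWith K fun x => Q.bary i x * (f i - z) := fun i => by
    obtain ⟨K, hK⟩ := exists_lipschitzWith_affine (Q.baryAff i)
    have := (lipschitzWith_smul (f i - z) (β := ℝ)).comp (hK.const_max 0)
    refine ⟨‖f i - z‖₊ * K, ?_⟩
    have e : (fun x => Q.bary i x * (f i - z)) =
        (fun x => (f i - z) • x) ∘ fun x => max 0 (Q.baryAff i x) := by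
      ext x; simp [bary, mul_comm]
    rw [e]; exact this
  choose K hK using h
  have : Q.pl f z = fun x => z + (Q.bary 0 x * (f 0 - z) + Q.bary 1 x * (f 1 - z) +
      Q.bary 2 x * (f 2 - z) + Q.bary 3 x * (f 3 - z)) := by
    ext x; rw [pl, Fin.sum_univ_four]
  rw [this]
  exact ⟨_, (LipschitzWith.const z).add ((((hK 0).add (hK 1)).add (hK 2)).add (hK 3))⟩

end Quad

namespace Subdivision

variable {Ω : Set Plane} (G : Subdivision Ω) (W : Plane → ℝ) (Z : Quad → ℝ)

/-- Along a common edge both functions interpolate linearly between the same end values. The centre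
values play no part. -/
theorem pl_consistent {Q Q' : Quad} (hQ : Q ∈ G.cells) (hQ' : Q' ∈ G.cells) {x : Plane}
    (hx : x ∈ Q.carrier) (hx' : x ∈ Q'.carrier) :
    Q.pl (fun i => W (Q.a i)) (Z Q) x = Q'.pl (fun i => W (Q'.a i)) (Z Q') x := by
  by_cases hne : Q = Q'
  · rw [hne]
  rcases G.exists_common hQ hQ' hne hx hx' with ⟨⟨i, hi⟩, j, hj⟩ | ⟨i, j, hij, hxi, -⟩
  · rw [← hi, Quad.pl_vertex, hi, ← hj, Quad.pl_vertex]
  · obtain ⟨s, t, hs, ht, hst, rfl⟩ := hxi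
    rw [Quad.pl_edge _ _ i hs ht hst]
    rcases segment_eq_segment hij with ⟨h1, h2⟩ | ⟨h1, h2⟩
    · rw [h1, h2, Quad.pl_edge _ _ j hs ht hst]
    · rw [h1, h2, add_comm (s • _), Quad.pl_edge _ _ j ht hs (by linarith)]; ring

open Classical in
/-- The piecewise linear function with values `W` at the vertices and `Z` at the centres of the
cells, extended by zero. -/
def pl (x : Plane) : ℝ :=
  if h : ∃ Q ∈ G.cells, x ∈ Q.carrier then
    h.choose.pl (fun i => W (h.choose.a i)) (Z h.choose) x else 0

theorem pl_eq {Q : Quad} (hQ : Q ∈ G.cells) {x : Plane} (hx : x ∈ Q.carrier) :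
    G.pl W Z x = Q.pl (fun i => W (Q.a i)) (Z Q) x := by
  have h : ∃ Q ∈ G.cells, x ∈ Q.carrier := ⟨Q, hQ, hx⟩
  rw [pl, dif_pos h]
  exact G.pl_consistent W Z h.choose_spec.1 hQ h.choose_spec.2 hx

variable {W}

theorem pl_eq_zero (ho : IsOpen Ω) (hL : IsLipschitzDomain Ω)
    (hW : ∀ Q ∈ G.cells, ∀ i, Q.a i ∈ frontier Ω → W (Q.a i) = 0) {x : Plane} (hx : x ∉ Ω) :
    G.pl W Z x = 0 := by
  by_cases h : ∃ Q ∈ G.cells, x ∈ Q.carrier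
  swap
  · rw [pl, dif_neg h]
  obtain ⟨Q, hQ, hxQ⟩ := h
  have hxf : x ∈ frontier Ω := by
    rw [ho.frontier_eq]; exact ⟨G.carrier_subset hQ hxQ, hx⟩
  rw [G.pl_eq W Z hQ hxQ]
  obtain ⟨i, hi⟩ := Q.exists_edge_of_notMem_inner hxQ fun h =>
    hx (G.inner_subset_domain ho hL hQ h)
  by_cases hv : Q.IsVertex x
  · obtain ⟨j, rfl⟩ := hv
    rw [Quad.pl_vertex, hW Q hQ j hxf]
  · have hsub := G.edge_subset_frontier ho hL hQ hi hv hxf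
    obtain ⟨s, t, hs, ht, hst, rfl⟩ := hi
    rw [Quad.pl_edge _ _ i hs ht hst, hW Q hQ i (hsub (Q.left_mem_edge i)),
      hW Q hQ (i + 1) (hsub (Q.right_mem_edge i))]
    simp

theorem exists_lipschitzWith_pl (ho : IsOpen Ω) (hL : IsLipschitzDomain Ω)
    (hW : ∀ Q ∈ G.cells, ∀ i, Q.a i ∈ frontier Ω → W (Q.a i) = 0) :
    ∃ K, LipschitzWith K (G.pl W Z) := by
  choose K hK using fun Q : Quad => Q.exists_lipschitzWith_pl (fun i => W (Q.a i)) (Z Q)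
  -- The closed cover consists of the cells together with the complement of Ω, represented by
  -- `none`, on which the function is zero.
  refine ⟨G.cells.sup K, lipschitzWith_of_closed_cover
    (C := fun o : Option Quad => o.elim Ωᶜ fun Q => Q.carrier) ?_ (Finset.insertNone G.cells)
    ?_ ?_⟩
  · rintro (_ | Q)
    · exact ho.isClosed_compl
    · exact Q.isClosed_carrier
  · intro x
    by_cases hx : x ∈ Ω
    · obtain ⟨Q, hQ, h⟩ := G.exists_cell (subset_closure hx)
      exact ⟨some Q, Finset.some_mem_insertNone.2 hQ, h⟩
    · exact ⟨none, Finset.none_mem_insertNone, hx⟩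
  · rintro (_ | Q) hQ
    · refine LipschitzOnWith.of_dist_le_mul fun x hx y hy => ?_
      rw [G.pl_eq_zero Z ho hL hW hx, G.pl_eq_zero Z ho hL hW hy, dist_self]
      positivity
    · have hQ := Finset.some_mem_insertNone.1 hQ
      refine LipschitzOnWith.of_dist_le_mul fun x hx y hy => ?_
      rw [G.pl_eq W Z hQ hx, G.pl_eq W Z hQ hy]
      refine ((hK Q).dist_le_mul x y).trans ?_
      have : K Q ≤ G.cells.sup K := Finset.le_sup hQ
      gcongr

/-- The open cells cover the domain up to a null set. -/
theorem ae_mem_inner (ho : IsOpen Ω) : ∀ᵐ x ∂(volume.restrict Ω), ∃ Q ∈ G.cells, x ∈ Q.inner := by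
  have h : ∀ᵐ x ∂(volume : Measure Plane), ∀ Q ∈ G.cells, x ∉ frontier Q.carrier :=
    (ae_ball_iff G.cells.countable_toSet).2 fun Q _ =>
      measure_eq_zero_iff_ae_notMem.1 (Q.convex_carrier.addHaar_frontier volume)
  rw [ae_restrict_iff' ho.measurableSet]
  filter_upwards [h] with x hx hxΩ
  obtain ⟨Q, hQ, hxQ⟩ := G.exists_cell (subset_closure hxΩ)
  refine ⟨Q, hQ, ?_⟩
  by_contra hxi
  exact hx Q hQ ⟨subset_closure hxQ, hxi⟩

theorem ae_restrict_iff_cells (ho : IsOpen Ω) (hL : IsLipschitzDomain Ω) {p : Plane → Prop} :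
    (∀ᵐ x ∂(volume.restrict Ω), p x) ↔ ∀ Q ∈ G.cells, ∀ᵐ x ∂(volume.restrict Q.inner), p x := by
  constructor
  · intro h Q hQ
    exact ae_mono (Measure.restrict_mono (G.inner_subset_domain ho hL hQ) le_rfl) h
  · intro h
    have h2 : ∀ᵐ x ∂(volume : Measure Plane), ∀ Q ∈ G.cells, x ∈ Q.inner → p x :=
      (ae_ball_iff G.cells.countable_toSet).2 fun Q hQ =>
        (ae_restrict_iff' Q.isOpen_inner.measurableSet).1 (h Q hQ)
    filter_upwards [G.ae_mem_inner ho, ae_restrict_of_ae h2] with x ⟨Q, hQ, hx⟩ hp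
    exact hp Q hQ hx

/-- A piecewise linear function with zero boundary values is in the linear element space. -/
theorem pl_mem_linearElement0 (ho : IsOpen Ω) (hL : IsLipschitzDomain Ω)
    (hW : ∀ Q ∈ G.cells, ∀ i, Q.a i ∈ frontier Ω → W (Q.a i) = 0) :
    G.pl W Z ∈ linearElement0 Ω G.crissCross := by
  obtain ⟨K, hK⟩ := G.exists_lipschitzWith_pl Z ho hL hW
  refine ⟨⟨G.pl W Z, hK.continuous.continuousOn, ?_, Eventually.of_forall fun x => rfl⟩, ?_⟩
  · rintro _ ⟨Q, hQ, i, rfl⟩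
    refine ⟨Q.plAff (fun i => W (Q.a i)) (Z Q) i, fun x hx => ?_⟩
    have hxQ : x ∈ Q.carrier := by
      refine convexHull_min ?_ Q.convex_carrier hx
      rintro _ ⟨k, rfl⟩
      fin_cases k
      exacts [Q.center_mem, Q.vertex_mem i, Q.vertex_mem (i + 1)]
    obtain ⟨h2, h3⟩ := Quad.sector_of_mem_hull hx
    rw [G.pl_eq W Z hQ hxQ, Quad.pl_eq_of_sector _ _ h2 h3]
  · refine memH10_of_lipschitz hK ho G.isBounded (fun x hx => G.pl_eq_zero Z ho hL hW hx) ?_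
    rw [G.ae_restrict_iff_cells ho hL]
    intro Q hQ
    -- On each triangle the function is affine, hence either identically zero or nonzero off a null
    -- set. This is the dichotomy demanded by `memH10_of_lipschitz`.
    have hn : ∀ᵐ x ∂(volume : Measure Plane), ∀ i,
        (∃ y, Q.plAff (fun i => W (Q.a i)) (Z Q) i y ≠ 0) →
          Q.plAff (fun i => W (Q.a i)) (Z Q) i x ≠ 0 := by
      rw [ae_all_iff]
      intro i
      by_cases hi : ∃ y, Q.plAff (fun i => W (Q.a i)) (Z Q) i y ≠ 0
      · have := measure_eq_zero_iff_ae_notMem.1 (volume_affine_zero hi)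
        filter_upwards [this] with x hx _ using hx
      · exact Eventually.of_forall fun x h => absurd h hi
    filter_upwards [Q.ae_mem_tri, ae_restrict_of_ae hn] with x ⟨i, hi⟩ hx
    have hev : G.pl W Z =ᶠ[𝓝 x] Q.plAff (fun i => W (Q.a i)) (Z Q) i := by
      filter_upwards [(Q.isOpen_tri i).mem_nhds hi] with y hy
      rw [G.pl_eq W Z hQ (Q.inner_subset (Q.tri_subset i hy)), Quad.pl_eq_of_mem_tri _ _ hy]
    by_cases h0 : ∃ y, Q.plAff (fun i => W (Q.a i)) (Z Q) i y ≠ 0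
    · left
      rw [hev.eq_of_nhds]
      exact hx i h0
    · right
      push Not at h0
      filter_upwards [hev] with y hy
      rw [hy, h0]

end Subdivision

/-! ### Interpolation of piecewise linear functions -/

/-- Each vertex value enters two consecutive averages with opposite signs. This is why interpolating
a continuous piecewise linear function leaves no quadratic term. -/
theorem shapeCoef_eq_zero (W : Fin 4 → ℝ) :
    Quad.shapeCoef (fun i => (W i + W (i + 1)) / 2) = 0 := by
  unfold Quad.shapeCoef
  simp only [zero_add, Fin.reduceAdd]
  ring

namespace Quad

variable (Q : Quad)

theorem tri_subset_hull (i : Fin 4) :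
    Q.tri i ⊆ convexHull ℝ (Set.range ![Q.diagCross, Q.a i, Q.a (i + 1)]) := by
  rintro _ ⟨⟨s, t⟩, ⟨h1, h2, h3⟩, rfl⟩
  simp only at h1 h2 h3
  have h := (convex_convexHull ℝ (Set.range ![Q.diagCross, Q.a i, Q.a (i + 1)])).sum_mem
    (t := Finset.univ) (w := ![1 - s, s - t, t]) (z := ![Q.diagCross, Q.a i, Q.a (i + 1)])
    (fun j _ => by fin_cases j <;> simp <;> linarith) (by simp [Fin.sum_univ_three])
    (fun j _ => subset_convexHull ℝ _ ⟨j, rfl⟩)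
  convert h using 1
  simp [Fin.sum_univ_three, param]
  module

theorem tri_nonempty (i : Fin 4) : (Q.tri i).Nonempty :=
  ⟨_, (2 / 3, 1 / 3), by constructor <;> norm_num, rfl⟩

/-- The interpolant of a function whose edge averages come from vertex values is affine. -/
theorem shape_vertexMeans (W : Fin 4 → ℝ) :
    Q.shape (fun i => (W i + W (i + 1)) / 2) = Q.shapeAff fun i => (W i + W (i + 1)) / 2 := by
  ext x
  rw [shape, shapeCoef_eq_zero, zero_mul, add_zero]

theorem shapeAff_vertexMeans_mid (W : Fin 4 → ℝ) (i : Fin 4) :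
    Q.shapeAff (fun i => (W i + W (i + 1)) / 2) (Q.mid i) = (W i + W (i + 1)) / 2 := by
  rw [shapeAff_mid, shapeRest, shapeCoef_eq_zero, zero_mul, sub_zero]

end Quad

namespace Subdivision

variable {Ω : Set Plane} (G : Subdivision Ω)

theorem memLp_interp (v : Plane → ℝ) : MemLp (G.interp v) 2 volume := by
  have : G.interp v = fun x => ∑ Q ∈ G.cells, Q.inner.indicator (Q.interp v) x := rfl
  rw [this]
  refine memLp_finsetSum _ fun Q _ => MemLp.indicator_restrict Q.isOpen_inner.measurableSet ?_
  rw [Q.interp_eq_shape]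
  exact Q.memLp_inner (Q.contDiff_shape _).continuous

/-- The local data of a function in the linear element space. -/
theorem exists_nodal_values {w : Plane → ℝ} (ho : IsOpen Ω) (hL : IsLipschitzDomain Ω)
    (hw : w ∈ linearElement0 Ω G.crissCross) : ∃ f : Plane → ℝ, ∀ Q ∈ G.cells, ∀ i,
      ∃ l : Plane →ᵃ[ℝ] ℝ, w =ᵐ[volume.restrict (Q.tri i)] l ∧ l (Q.a i) = f (Q.a i) ∧
        l (Q.a (i + 1)) = f (Q.a (i + 1)) ∧ l Q.diagCross = f Q.diagCross := by
  obtain ⟨⟨f, -, hf, hwf⟩, -⟩ := hw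
  refine ⟨f, fun Q hQ i => ?_⟩
  obtain ⟨l, hl⟩ := hf _ ⟨Q, hQ, i, rfl⟩
  refine ⟨l, ?_, ?_, ?_, ?_⟩
  · have h1 := (G.ae_restrict_iff_cells ho hL).1 hwf Q hQ
    filter_upwards [ae_mono (Measure.restrict_mono (Q.tri_subset i) le_rfl) h1,
      ae_restrict_mem (Q.isOpen_tri i).measurableSet] with x hx hxt
    rw [hx, hl x (Q.tri_subset_hull i hxt)]
  · exact (hl _ (subset_convexHull ℝ _ ⟨1, rfl⟩)).symm
  · exact (hl _ (subset_convexHull ℝ _ ⟨2, rfl⟩)).symm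
  · exact (hl _ (subset_convexHull ℝ _ ⟨0, rfl⟩)).symm

theorem edgeMean_eq_vertexMean {w : Plane → ℝ} (ho : IsOpen Ω) (hL : IsLipschitzDomain Ω)
    (hw : MemH10 Ω w) {Q : Quad} (hQ : Q ∈ G.cells) {i : Fin 4} {l : Plane →ᵃ[ℝ] ℝ}
    (hl : w =ᵐ[volume.restrict (Q.tri i)] l) {f : Plane → ℝ} (h1 : l (Q.a i) = f (Q.a i))
    (h2 : l (Q.a (i + 1)) = f (Q.a (i + 1))) :
    Q.edgeMean i w = (f (Q.a i) + f (Q.a (i + 1))) / 2 := by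
  rw [Q.edgeMean_of_affine_tri G.isBounded (G.inner_subset_domain ho hL hQ) hw hl, Quad.mid,
    affine_midpoint, h1, h2]

/-- The approximating test functions vanish on the boundary edge, and their averages converge to
that of w. -/
theorem edgeMean_boundary {w : Plane → ℝ} (ho : IsOpen Ω) (hL : IsLipschitzDomain Ω)
    (hw : MemH10 Ω w) {Q : Quad} (hQ : Q ∈ G.cells) {i : Fin 4} (hi : Q.edge i ⊆ frontier Ω) :
    Q.edgeMean i w = 0 := by
  obtain ⟨φ, hφ, -, ht⟩ := Q.hasTraceMean_of_memH10 G.isBounded (G.inner_subset_domain ho hL hQ) hw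
  refine tendsto_nhds_unique (ht i) (tendsto_const_nhds.congr fun n => ?_)
  have : |segMean (Q.a i) (Q.a (i + 1)) (φ n)| ≤ 0 := abs_segMean_le fun x hx => by
    have hxf := hi hx
    rw [ho.frontier_eq] at hxf
    rw [(hφ n).eq_zero hxf.2, abs_zero]
  exact (abs_nonpos_iff.1 this).symm

/-- The edge averages of w depend on the two end values only. This makes the interpolant affine on
each cell and its averages equal from both sides of an edge. -/
theorem mem_parkSheen_of_interp {u w : Plane → ℝ} (ho : IsOpen Ω) (hL : IsLipschitzDomain Ω)
    (hw : w ∈ linearElement0 Ω G.crissCross)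
    (hu : ∀ᵐ x ∂(volume.restrict Ω), u x = G.interp w x) : u ∈ G.parkSheen := by
  obtain ⟨f, hf⟩ := G.exists_nodal_values ho hL hw
  have hmean : ∀ Q ∈ G.cells, ∀ i, Q.edgeMean i w = (f (Q.a i) + f (Q.a (i + 1))) / 2 := by
    intro Q hQ i
    obtain ⟨l, h0, h1, h2, -⟩ := hf Q hQ i
    exact G.edgeMean_eq_vertexMean ho hL hw.2 hQ h0 h1 h2
  have huQ : ∀ Q ∈ G.cells, u =ᵐ[volume.restrict Q.inner]
      Q.shapeAff fun i => (f (Q.a i) + f (Q.a (i + 1))) / 2 := by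
    intro Q hQ
    have h1 := (G.ae_restrict_iff_cells ho hL).1 hu Q hQ
    filter_upwards [h1, G.interp_ae_eq hQ w] with x hx hx2
    rw [hx, hx2, Q.interp_eq_shape, ← Q.shape_vertexMeans fun i => f (Q.a i)]
    congr 1
    ext i
    exact hmean Q hQ i
  have hue : ∀ Q ∈ G.cells, ∀ i, Q.edgeMean i u = Q.edgeMean i w := by
    intro Q hQ i
    rw [Q.edgeMean_congr i (huQ Q hQ), Q.edgeMean_affine,
      Q.shapeAff_vertexMeans_mid fun i => f (Q.a i), hmean Q hQ i]
  refine ⟨?_, fun Q hQ => ⟨_, huQ Q hQ⟩, fun Q hQ Q' hQ' i j hij => ?_, fun Q hQ i hi => ?_⟩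
  · exact (memLp_congr_ae hu).2 ((G.memLp_interp w).restrict Ω)
  · rw [hue Q hQ, hue Q' hQ', hmean Q hQ, hmean Q' hQ']
    rcases segment_eq_segment hij with ⟨h1, h2⟩ | ⟨h1, h2⟩
    · rw [h1, h2]
    · rw [h1, h2, add_comm]
  · rw [hue Q hQ, G.edgeMean_boundary ho hL hw.2 hQ hi]

theorem interp_pl_ae_eq (ho : IsOpen Ω) (hL : IsLipschitzDomain Ω) {W : Plane → ℝ} (Z : Quad → ℝ)
    (hW : ∀ Q ∈ G.cells, ∀ i, Q.a i ∈ frontier Ω → W (Q.a i) = 0) {u : Plane → ℝ}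
    {l : Quad → Plane →ᵃ[ℝ] ℝ} (hl : ∀ Q ∈ G.cells, u =ᵐ[volume.restrict Q.inner] l Q)
    (hWl : ∀ Q ∈ G.cells, ∀ i, (W (Q.a i) + W (Q.a (i + 1))) / 2 = l Q (Q.mid i)) :
    ∀ᵐ x ∂(volume.restrict Ω), u x = G.interp (G.pl W Z) x := by
  have hmem := G.pl_mem_linearElement0 Z ho hL hW
  rw [G.ae_restrict_iff_cells ho hL]
  intro Q hQ
  filter_upwards [hl Q hQ, G.interp_ae_eq hQ (G.pl W Z)] with x h1 h2
  rw [h1, h2, Q.interp_eq_shape]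
  nth_rw 1 [← Q.shape_of_affine (l Q)]
  congr 1
  ext i
  rw [← hWl Q hQ i]
  refine (G.edgeMean_eq_vertexMean ho hL hmem.2 hQ (i := i)
    (l := Q.plAff (fun i => W (Q.a i)) (Z Q) i) ?_ (Q.plAff_left _ _ i) (Q.plAff_right _ _ i)).symm
  filter_upwards [ae_restrict_mem (Q.isOpen_tri i).measurableSet] with y hy
  rw [G.pl_eq W Z hQ (Q.inner_subset (Q.tri_subset i hy)), Quad.pl_eq_of_mem_tri _ _ hy]

/-- The vertex values of a continuous piecewise linear function that interpolates to a given
Park–Sheen function. -/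
theorem exists_vertex_values_of_mem_parkSheen {u : Plane → ℝ} (ho : IsOpen Ω)
    (hs : IsSimplyConnected Ω) (hL : IsLipschitzDomain Ω) (hu : u ∈ G.parkSheen) :
    ∃ (W : Plane → ℝ) (l : Quad → Plane →ᵃ[ℝ] ℝ),
      (∀ Q ∈ G.cells, ∀ i, Q.a i ∈ frontier Ω → W (Q.a i) = 0) ∧
      (∀ Q ∈ G.cells, u =ᵐ[volume.restrict Q.inner] l Q) ∧
      ∀ Q ∈ G.cells, ∀ i, (W (Q.a i) + W (Q.a (i + 1))) / 2 = l Q (Q.mid i) := by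
  obtain ⟨-, h1, h2, h3⟩ := hu
  choose! l hl using h1
  have hmean : ∀ Q ∈ G.cells, ∀ i, Q.edgeMean i u = l Q (Q.mid i) := fun Q hQ i => by
    rw [Q.edgeMean_congr i (hl Q hQ), Q.edgeMean_affine]
  have hmatch : G.EdgeMatching l := fun Q hQ Q' hQ' i j hij => by
    rw [← hmean Q hQ, ← hmean Q' hQ', h2 Q hQ Q' hQ' i j hij]
  obtain ⟨W, hW1, hW2⟩ := exists_vertex_values hmatch ho hs hL fun Q hQ i hi => by
    rw [← hmean Q hQ, h3 Q hQ i hi]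
  exact ⟨W, l, hW2, hl, hW1⟩

/-- The interpolation operator maps the linear element space onto the Park–Sheen space. -/
theorem mem_parkSheen_iff (ho : IsOpen Ω) (hs : IsSimplyConnected Ω) (hL : IsLipschitzDomain Ω)
    (u : Plane → ℝ) : u ∈ G.parkSheen ↔ ∃ w ∈ linearElement0 Ω G.crissCross,
      ∀ᵐ x ∂(volume.restrict Ω), u x = G.interp w x := by
  constructor
  · intro hu
    obtain ⟨W, l, hW, hl, hWl⟩ := G.exists_vertex_values_of_mem_parkSheen ho hs hL hu
    -- Centre values do not influence edge averages, so zero is as good as any here; the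
    -- divergence-free case uses this freedom.
    exact ⟨G.pl W 0, G.pl_mem_linearElement0 0 ho hL hW, G.interp_pl_ae_eq ho hL 0 hW hl hWl⟩
  · rintro ⟨w, hw, hu⟩
    exact G.mem_parkSheen_of_interp ho hL hw hu

end Subdivision

/-! ### Divergence-free functions -/

/-- The divergence of an affine vector field. -/
def affineDiv (A : Fin 2 → Plane →ᵃ[ℝ] ℝ) : ℝ := ∑ k, (A k).linear (unitVec k)

/-- The two increments of the field along the sides at c determine its gradient; multiplying by the
determinant of these sides gives the trace without division. -/
theorem affineDiv_mul_cross (A : Fin 2 → Plane →ᵃ[ℝ] ℝ) (a b c : Plane) :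
    affineDiv A * cross (a - c) (b - c) =
      (A 0 a - A 0 c) * (b - c) 1 - (A 1 a - A 1 c) * (b - c) 0 +
        ((a - c) 0 * (A 1 b - A 1 c) - (a - c) 1 * (A 0 b - A 0 c)) := by
  have h : ∀ k (x : Plane), A k x - A k c =
      (x - c) 0 * (A k).linear (unitVec 0) + (x - c) 1 * (A k).linear (unitVec 1) := by
    intro k x
    have e : x - c = (x - c) 0 • unitVec 0 + (x - c) 1 • unitVec 1 := by
      ext j; fin_cases j <;> simp
    rw [← smul_eq_mul, ← smul_eq_mul, ← map_smul, ← map_smul, ← map_add, ← e, ← vsub_eq_sub x c,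
      AffineMap.linearMap_vsub, vsub_eq_sub]
  rw [h, h, h, h, affineDiv, Fin.sum_univ_two, cross]
  ring

theorem wderiv_ae_eq_of_affine {U V : Set Plane} (hV : IsOpen V) (hVU : V ⊆ U)
    (hb : Bornology.IsBounded V) {w : Plane → ℝ} (hw : MemH1 U w) {l : Plane →ᵃ[ℝ] ℝ}
    (hl : w =ᵐ[volume.restrict V] l) (k : Fin 2) :
    ∀ᵐ x ∂(volume.restrict V), wderiv U k w x = l.linear (unitVec k) := by
  have h1 := ((hw.wderiv_spec k).mono hVU).ae_eq hV
    ((isWeakDeriv_of_contDiff (contDiff_affine l) hb k).congr hl.symm (ae_eq_refl _))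
  filter_upwards [h1] with x hx
  rw [hx, pderiv_affine]

theorem sum_wderiv_ae_eq {U V : Set Plane} (hV : IsOpen V) (hVU : V ⊆ U)
    (hb : Bornology.IsBounded V) {w : Fin 2 → Plane → ℝ} (hw : ∀ k, MemH1 U (w k))
    {A : Fin 2 → Plane →ᵃ[ℝ] ℝ} (hA : ∀ k, w k =ᵐ[volume.restrict V] A k) :
    ∀ᵐ x ∂(volume.restrict V), ∑ k, wderiv U k (w k) x = affineDiv A := by
  have h := ae_all_iff.2 fun k => wderiv_ae_eq_of_affine hV hVU hb (hw k) (hA k) k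
  filter_upwards [h] with x hx
  exact Finset.sum_congr rfl fun k _ => hx k

theorem IsDivFree.affineDiv_eq_zero {U V : Set Plane} (hV : IsOpen V) (hne : V.Nonempty)
    (hVU : V ⊆ U) (hb : Bornology.IsBounded V) {w : Fin 2 → Plane → ℝ} (hw : ∀ k, MemH1 U (w k))
    {A : Fin 2 → Plane →ᵃ[ℝ] ℝ} (hA : ∀ k, w k =ᵐ[volume.restrict V] A k) (h : IsDivFree U w) :
    affineDiv A = 0 := by
  have : NeZero (volume.restrict V) := ⟨by
    rw [Ne, Measure.restrict_eq_zero]; exact (hV.measure_pos volume hne).ne'⟩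
  have h2 : ∀ᵐ x ∂(volume.restrict V), ∑ k, wderiv U k (w k) x = 0 :=
    ae_mono (Measure.restrict_mono hVU le_rfl) h
  obtain ⟨x, hx1, hx2⟩ := ((sum_wderiv_ae_eq hV hVU hb hw hA).and h2).exists
  rw [← hx1, hx2]

namespace Quad

variable (Q : Quad)

theorem cross_center_pos (i : Fin 4) :
    0 < cross (Q.a i - Q.diagCross) (Q.a (i + 1) - Q.diagCross) := by
  have h := Q.cross_tri_pos i
  have e : cross (Q.a i - Q.diagCross) (Q.a (i + 1) - Q.diagCross) =
      cross (Q.a i - Q.diagCross) (Q.a (i + 1) - Q.a i) := by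
    simp [cross]; ring
  rwa [e]

theorem exists_smul_opp (i : Fin 4) :
    ∃ m : ℝ, Q.a (i + 2) - Q.diagCross = m • (Q.a i - Q.diagCross) := by
  have h1 := Q.sub_diagCross i
  have h2 := Q.sub_diagCross (i + 2)
  have hA := Q.area2_pos.ne'
  have hT := (Q.turn_pos (i + 3)).ne'
  refine ⟨-(Q.turn (i + 1) / Q.turn (i + 3)), ?_⟩
  rw [show i + 2 + 2 = i by fin_cases i <;> rfl, show i + 2 + 3 = i + 1 by fin_cases i <;> rfl] at h2
  rw [h1, h2, smul_smul, ← neg_sub (Q.a (i + 2)) (Q.a i), smul_neg, ← neg_smul]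
  congr 1
  field_simp

/-- Vertex values with the same edge averages as an affine function differ from it by an
alternating sequence. -/
theorem exists_alternating {F : Fin 4 → ℝ} {l : Plane →ᵃ[ℝ] ℝ}
    (h : ∀ i, (F i + F (i + 1)) / 2 = l (Q.mid i)) :
    ∃ κ : ℝ, ∀ i, F i = l (Q.a i) + altSign i * κ := by
  have hs : ∀ i, F i + F (i + 1) = l (Q.a i) + l (Q.a (i + 1)) := fun i => by
    have := h i
    rw [mid, affine_midpoint] at this
    linarith
  have h0 : F 0 + F 1 = l (Q.a 0) + l (Q.a 1) := hs 0
  have h1 : F 1 + F 2 = l (Q.a 1) + l (Q.a 2) := hs 1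
  have h2 : F 2 + F 3 = l (Q.a 2) + l (Q.a 3) := hs 2
  refine ⟨F 0 - l (Q.a 0), fun i => ?_⟩
  fin_cases i <;> simp [altSign] <;> linarith

/-- A suitable value at the centre makes the piecewise linear field divergence-free. -/
theorem exists_center_value {F : Fin 2 → Fin 4 → ℝ} {l : Fin 2 → Plane →ᵃ[ℝ] ℝ}
    (hl : affineDiv l = 0) (h : ∀ k i, (F k i + F k (i + 1)) / 2 = l k (Q.mid i)) :
    ∃ z : Fin 2 → ℝ, ∀ i, affineDiv (fun k => Q.plAff (F k) (z k) i) = 0 := by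
  choose κ hκ using fun k => Q.exists_alternating (h k)
  set c := Q.diagCross with hc
  set e : Plane := !₂[κ 0, κ 1] with he
  have hJ := Q.cross_center_pos 0
  set q₀ := Q.a 0 - c with hq₀
  set q₁ := Q.a 1 - c with hq₁
  change 0 < cross q₀ q₁ at hJ
  -- Subtracting the divergence-free affine field leaves the values ±e at the vertices and d at the
  -- centre. The triangle at an edge has zero divergence if d × q = ∓e × q for the vectors q from
  -- the centre to its two ends. Cramer's rule in the basis q₀, q₁ solves the first two of these
  -- equations.
  set d : Plane := (cross e q₁ / cross q₀ q₁) • q₀ + (cross e q₀ / cross q₀ q₁) • q₁ with hd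
  have d0 : cross d q₀ = -cross e q₀ := by
    rw [hd, cross_add_left, cross_smul_left, cross_smul_left, cross_self, cross_swap q₁ q₀]
    field_simp; ring
  have d1 : cross d q₁ = cross e q₁ := by
    rw [hd, cross_add_left, cross_smul_left, cross_smul_left, cross_self]
    field_simp; ring
  -- The equations at the other two vertices are multiples of those at q₀ and q₁: the centre lies on
  -- both diagonals, and opposite vertices carry the same sign.
  have hdi : ∀ i, cross d (Q.a i - c) = -altSign i * cross e (Q.a i - c) := by
    obtain ⟨m₀, hm₀⟩ := Q.exists_smul_opp 0
    obtain ⟨m₁, hm₁⟩ := Q.exists_smul_opp 1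
    have hm₀ : Q.a 2 - c = m₀ • q₀ := hm₀
    have hm₁ : Q.a 3 - c = m₁ • q₁ := hm₁
    intro i
    fin_cases i
    · simp only [Fin.zero_eta, altSign, pow_zero, ← hq₀, d0]; ring
    · simp only [Fin.mk_one, altSign, pow_one, ← hq₁, d1]; ring
    · simp only [Fin.reduceFinMk, altSign, hm₀, cross_smul_right, d0]; norm_num
    · simp only [Fin.reduceFinMk, altSign, hm₁, cross_smul_right, d1]; norm_num
  refine ⟨fun k => l k c + d k, fun i => ?_⟩
  have h1 := affineDiv_mul_cross (fun k => Q.plAff (F k) (l k c + d k) i) (Q.a i) (Q.a (i + 1)) c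
  have h2 := affineDiv_mul_cross l (Q.a i) (Q.a (i + 1)) c
  simp only [hc, plAff_left, plAff_right, plAff_center] at h1
  rw [← hc] at h1
  rw [hl, zero_mul] at h2
  have hi := hdi i
  have hi' := hdi (i + 1)
  rw [altSign_succ] at hi'
  have hs : altSign (i + 1) = -altSign i := altSign_succ i
  rw [hκ 0 i, hκ 1 i, hκ 0 (i + 1), hκ 1 (i + 1), hs] at h1
  have e0 : e 0 = κ 0 := rfl
  have e1 : e 1 = κ 1 := rfl
  simp only [cross, e0, e1] at hi hi'
  have h3 : affineDiv (fun k => Q.plAff (F k) (l k c + d k) i) *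
      cross (Q.a i - c) (Q.a (i + 1) - c) = 0 := by
    rw [h1]
    linear_combination -h2 + hi - hi'
  exact (mul_eq_zero.1 h3).resolve_right (Q.cross_center_pos i).ne'

/-- If a piecewise linear field is divergence-free on the four triangles of a cell, then the affine
field with the same edge averages is divergence-free. -/
theorem affineDiv_eq_zero_of_tri {A : Fin 4 → Fin 2 → Plane →ᵃ[ℝ] ℝ} {F : Fin 2 → Fin 4 → ℝ}
    {z : Fin 2 → ℝ} {l : Fin 2 → Plane →ᵃ[ℝ] ℝ} (hA : ∀ i, affineDiv (A i) = 0)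
    (h0 : ∀ i k, A i k (Q.a i) = F k i) (h1 : ∀ i k, A i k (Q.a (i + 1)) = F k (i + 1))
    (hz : ∀ i k, A i k Q.diagCross = z k)
    (h : ∀ k i, (F k i + F k (i + 1)) / 2 = l k (Q.mid i)) : affineDiv l = 0 := by
  choose κ hκ using fun k => Q.exists_alternating (h k)
  have hl : ∀ k i, l k (Q.a i) = F k i - altSign i * κ k := fun k i => by linarith [hκ k i]
  have hAi : ∀ i, 0 = (F 0 i - z 0) * (Q.a (i + 1) - Q.diagCross) 1 -
      (F 1 i - z 1) * (Q.a (i + 1) - Q.diagCross) 0 + ((Q.a i - Q.diagCross) 0 *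
      (F 1 (i + 1) - z 1) - (Q.a i - Q.diagCross) 1 * (F 0 (i + 1) - z 0)) := fun i => by
    have := affineDiv_mul_cross (A i) (Q.a i) (Q.a (i + 1)) Q.diagCross
    rwa [hA, zero_mul, h0, h0, h1, h1, hz, hz] at this
  have hli := fun i => affineDiv_mul_cross l (Q.a i) (Q.a (i + 1)) Q.diagCross
  simp only [hl, altSign_succ] at hli
  have s : altSign 0 = 1 ∧ altSign 1 = -1 ∧ altSign 2 = 1 ∧ altSign 3 = -1 := by
    simp [altSign]; norm_num
  obtain ⟨s0, s1, s2, s3⟩ := s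
  have p0 := Q.cross_center_pos 0
  have p1 := Q.cross_center_pos 1
  have p2 := Q.cross_center_pos 2
  have p3 := Q.cross_center_pos 3
  have a0 := hAi 0
  have a1 := hAi 1
  have a2 := hAi 2
  have a3 := hAi 3
  have l0 := hli 0
  have l1 := hli 1
  have l2 := hli 2
  have l3 := hli 3
  simp only [zero_add, Fin.reduceAdd, PiLp.sub_apply, s0, s1, s2, s3]
    at p0 p1 p2 p3 a0 a1 a2 a3 l0 l1 l2 l3
  -- This is the flux balance of the cell. Summed over the four triangles, the contributions of the
  -- centre value and of the alternating part cancel, and the flux of the affine field is left.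
  have hsum : affineDiv l * (cross (Q.a 0 - Q.diagCross) (Q.a 1 - Q.diagCross) +
      cross (Q.a 1 - Q.diagCross) (Q.a 2 - Q.diagCross) +
      cross (Q.a 2 - Q.diagCross) (Q.a 3 - Q.diagCross) +
      cross (Q.a 3 - Q.diagCross) (Q.a 0 - Q.diagCross)) = 0 := by
    linear_combination l0 + l1 + l2 + l3 - a0 - a1 - a2 - a3
  exact (mul_eq_zero.1 hsum).resolve_right (by positivity)

end Quad

namespace Subdivision

variable {Ω : Set Plane} (G : Subdivision Ω)

/-- The interpolation operator maps the divergence-free linear elements onto the divergence-free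
Park–Sheen functions. -/
theorem mem_parkSheenDivFree_iff (ho : IsOpen Ω) (hs : IsSimplyConnected Ω)
    (hL : IsLipschitzDomain Ω) (u : Fin 2 → Plane → ℝ) : u ∈ G.parkSheenDivFree ↔
      ∃ w ∈ linearElement0DivFree Ω G.crissCross,
        ∀ k, ∀ᵐ x ∂(volume.restrict Ω), u k x = G.interp (w k) x := by
  have hH1 : ∀ (Q : Quad) (v : Plane → ℝ) (l : Plane →ᵃ[ℝ] ℝ),
      v =ᵐ[volume.restrict Q.inner] l → MemH1 Q.inner v := fun Q v l h =>
    (memH1_of_contDiff (contDiff_affine l) Q.isBounded_inner).congr h.symm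
  constructor
  · rintro ⟨hu, hdiv⟩
    choose W l hW hl hWl using fun k => G.exists_vertex_values_of_mem_parkSheen ho hs hL (hu k)
    -- The vertex values of the two components are found independently. Only the centre value,
    -- chosen cell by cell, couples them.
    have hz : ∀ Q ∈ G.cells, ∃ z : Fin 2 → ℝ, ∀ i,
        affineDiv (fun k => Q.plAff (fun i => W k (Q.a i)) (z k) i) = 0 := fun Q hQ =>
      Q.exists_center_value (F := fun k i => W k (Q.a i)) (l := fun k => l k Q)
        (IsDivFree.affineDiv_eq_zero Q.isOpen_inner ⟨_, Q.center_mem_inner⟩ subset_rfl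
          Q.isBounded_inner (fun k => hH1 Q (u k) _ (hl k Q hQ)) (fun k => hl k Q hQ) (hdiv Q hQ))
        fun k i => hWl k Q hQ i
    choose! z hz using hz
    have hmem := fun k => G.pl_mem_linearElement0 (fun Q => z Q k) ho hL (hW k)
    refine ⟨fun k => G.pl (W k) fun Q => z Q k, ⟨hmem, ?_⟩, fun k =>
      G.interp_pl_ae_eq ho hL _ (hW k) (hl k) (hWl k)⟩
    unfold IsDivFree
    rw [G.ae_restrict_iff_cells ho hL]
    intro Q hQ
    have htri : ∀ i, ∀ᵐ x ∂(volume.restrict (Q.tri i)),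
        ∑ k, wderiv Ω k (G.pl (W k) fun Q => z Q k) x = 0 := fun i => by
      rw [← hz Q hQ i]
      refine sum_wderiv_ae_eq (Q.isOpen_tri i)
        ((Q.tri_subset i).trans (G.inner_subset_domain ho hL hQ)) (Q.isBounded_tri i)
        (w := fun k => G.pl (W k) fun Q => z Q k) (fun k => (hmem k).2.1) fun k => ?_
      filter_upwards [ae_restrict_mem (Q.isOpen_tri i).measurableSet] with y hy
      rw [G.pl_eq _ _ hQ (Q.inner_subset (Q.tri_subset i hy)), Quad.pl_eq_of_mem_tri _ _ hy]
    have hall : ∀ᵐ x ∂(volume : Measure Plane), ∀ i, x ∈ Q.tri i →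
        ∑ k, wderiv Ω k (G.pl (W k) fun Q => z Q k) x = 0 := ae_all_iff.2 fun i =>
      (ae_restrict_iff' (Q.isOpen_tri i).measurableSet).1 (htri i)
    filter_upwards [Q.ae_mem_tri, ae_restrict_of_ae hall] with x ⟨i, hi⟩ hx
    exact hx i hi
  · rintro ⟨w, ⟨hw, hdiv⟩, hu⟩
    have hps := fun k => G.mem_parkSheen_of_interp ho hL (hw k) (hu k)
    refine ⟨hps, fun Q hQ => ?_⟩
    have hsub := G.inner_subset_domain ho hL hQ
    choose f hf using fun k => G.exists_nodal_values ho hL (hw k)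
    choose A hA0 hA1 hA2 hA3 using fun i k => hf k Q hQ i
    choose l hl using fun k => (hps k).2.1 Q hQ
    have hdivl : affineDiv l = 0 := by
      refine Q.affineDiv_eq_zero_of_tri (A := A) (F := fun k i => f k (Q.a i))
        (z := fun k => f k Q.diagCross) (fun i => ?_) hA1 hA2 hA3 fun k i => ?_
      · exact IsDivFree.affineDiv_eq_zero (Q.isOpen_tri i) (Q.tri_nonempty i)
          ((Q.tri_subset i).trans hsub) (Q.isBounded_tri i) (fun k => (hw k).2.1) (hA0 i) hdiv
      · rw [← G.edgeMean_eq_vertexMean ho hL (hw k).2 hQ (hA0 i k) (hA1 i k) (hA2 i k),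
          ← Q.edgeMean_affine (l k), ← Q.edgeMean_congr i (hl k)]
        have h1 : u k =ᵐ[volume.restrict Q.inner] G.interp (w k) :=
          (G.ae_restrict_iff_cells ho hL).1 (hu k) Q hQ
        rw [Q.edgeMean_congr i (h1.trans (G.interp_ae_eq hQ (w k))), Q.interp_eq_shape,
          Q.edgeMean_shape]
    have := sum_wderiv_ae_eq Q.isOpen_inner subset_rfl Q.isBounded_inner
      (fun k => hH1 Q (u k) _ (hl k)) hl
    rw [hdivl] at this
    exact this

end Subdivision

end

end QGB

/-! ### The theorem. -/

theorem lemma3p3 :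
    -- the constant depends on the shape regularity bound `ρ` only
    (∀ ρ : ℝ, ∃ C : ℝ, ∀ Ω : Set QGB.Plane, IsOpen Ω → IsSimplyConnected Ω →
      QGB.IsLipschitzDomain Ω → ∀ G : QGB.Subdivision Ω, (∀ Q ∈ G.cells, Q.regularity ≤ ρ) →
        ∀ v : QGB.Plane → ℝ, QGB.MemH10 Ω v → QGB.MemH2 Ω v →
          G.brokenSemiH1 (fun x => G.interp v x - v x) ≤ C * G.meshSize * QGB.semiH2 Ω v) ∧
    -- equality of sets of functions on `Ω`, functions being identified when they agree a.e.
    (∀ Ω : Set QGB.Plane, IsOpen Ω → IsSimplyConnected Ω → QGB.IsLipschitzDomain Ω →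
      ∀ G : QGB.Subdivision Ω,
        (∀ u : QGB.Plane → ℝ, u ∈ G.parkSheen ↔
          ∃ w ∈ QGB.linearElement0 Ω G.crissCross,
            ∀ᵐ x ∂(MeasureTheory.volume.restrict Ω), u x = G.interp w x) ∧
        (∀ u : Fin 2 → QGB.Plane → ℝ, u ∈ G.parkSheenDivFree ↔
          ∃ w ∈ QGB.linearElement0DivFree Ω G.crissCross,
            ∀ k, ∀ᵐ x ∂(MeasureTheory.volume.restrict Ω), u k x = G.interp (w k) x)) := by
  refine ⟨fun ρ => ⟨2 * (2 + 208 * ρ ^ 2), fun Ω ho _ hL G hρ v _ hv => ?_⟩,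
    fun Ω ho hs hL G => ⟨?_, ?_⟩⟩
  · exact G.brokenSemiH1_interp_error_le ho hL hρ hv
  · exact G.mem_parkSheen_iff ho hs hL
  · exact G.mem_parkSheenDivFree_iff ho hs hL
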